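/- Let $n\ge 1$ and $\gamma\in(0,2)$, let $W(t)=\frac1\gamma t^{-\gamma}$ for $t>0$ and $W(t)=0$ for $t\le 0$, and let $$J(u,S)=\int_S\Big(\tfrac12|\nabla u|^2+W(u)\Big)\,dx\in[0,\infty].$$ Write $B_1$ for the open unit ball of $\mathbb R^n$. A function $u\ge 0$ in $H^1_{loc}(B_1)$ is called a *minimizer of $J$ in $B_1$* if for every compact $K\subset B_1$ one has $J(u,K)<\infty$ and $J(u,K)\le J(v,K)$ for all $v\in H^1_{loc}(B_1)$ with $v\ge0$ and $v=u$ a.e. in $B_1\setminus K$. A function $u\ge0$ in $H^1(B_1)$ is called a *minimizer of $J$ in $B_1$ for its own boundary data* if $J(u,B_1)<\infty$ and $J(u,B_1)\le J(v,B_1)$ for all $v\in H^1(B_1)$ with $v\ge 0$ and $v-u\in H^1_0(B_1)$. **Proposition (compactness of minimizers).** Let $(u_k)_{k}$ be a sequence of functions on $B_1$, each of which is a minimizer of $J$ in $B_1$ (in either of the two senses above), and suppose that $u_k\to u$ locally uniformly in $B_1$. Then $u$ is a minimizer of $J$ in $B_1$ (in the first sense). If moreover $u\in H^1(B_1)$,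 then $u$ is also a minimizer of $J$ in $B_1$ for its own boundary data. -/

import Mathlib

open MeasureTheory Filter Topology Set
open scoped ENNReal ContDiff

noncomputable section

namespace AltPhillips

variable {n : ℕ}

/-- The potential `W(t) = t ^ (-γ) / γ` for `t > 0` and `W(t) = 0` for `t ≤ 0`. -/
def potential (γ t : ℝ) : ℝ := if 0 < t then (1 / γ) * t ^ (-γ) else 0

/-- Test functions `C_c^∞(Ω)`. -/
structure IsTestFunction (Ω : Set (EuclideanSpace ℝ (Fin n)))
    (φ : EuclideanSpace ℝ (Fin n) → ℝ) : Prop where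
  smooth : ContDiff ℝ ∞ φ
  compact : HasCompactSupport φ
  support_subset : tsupport φ ⊆ Ω

/-- `G` is the weak (distributional) gradient of `u` in the open set `Ω`. -/
structure HasWeakGradient (Ω : Set (EuclideanSpace ℝ (Fin n)))
    (u : EuclideanSpace ℝ (Fin n) → ℝ)
    (G : EuclideanSpace ℝ (Fin n) → EuclideanSpace ℝ (Fin n)) : Prop where
  locallyIntegrable : LocallyIntegrableOn u Ω volume
  locallyIntegrable_grad : LocallyIntegrableOn G Ω volume
  integral_eq : ∀ φ : EuclideanSpace ℝ (Fin n) → ℝ, IsTestFunction Ω φ →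
    ∀ e : EuclideanSpace ℝ (Fin n),
      ∫ x in Ω, u x * fderiv ℝ φ x e = - ∫ x in Ω, inner ℝ (G x) e * φ x

/-- `u ∈ H¹(Ω)`, with weak gradient `G`. -/
structure IsH1 (Ω : Set (EuclideanSpace ℝ (Fin n)))
    (u : EuclideanSpace ℝ (Fin n) → ℝ)
    (G : EuclideanSpace ℝ (Fin n) → EuclideanSpace ℝ (Fin n)) : Prop where
  weakGradient : HasWeakGradient Ω u G
  memLp : MemLp u 2 (volume.restrict Ω)
  memLp_grad : MemLp G 2 (volume.restrict Ω)

/-- `u ∈ H¹_loc(Ω)`, with weak gradient `G`. -/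
structure IsH1Loc (Ω : Set (EuclideanSpace ℝ (Fin n)))
    (u : EuclideanSpace ℝ (Fin n) → ℝ)
    (G : EuclideanSpace ℝ (Fin n) → EuclideanSpace ℝ (Fin n)) : Prop where
  weakGradient : HasWeakGradient Ω u G
  memLp : ∀ K : Set (EuclideanSpace ℝ (Fin n)), IsCompact K → K ⊆ Ω →
    MemLp u 2 (volume.restrict K)
  memLp_grad : ∀ K : Set (EuclideanSpace ℝ (Fin n)), IsCompact K → K ⊆ Ω →
    MemLp G 2 (volume.restrict K)

/-- `w ∈ H¹₀(Ω)`, the closure of `C_c^∞(Ω)` in `H¹(Ω)`. -/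
def IsH1Zero (Ω : Set (EuclideanSpace ℝ (Fin n)))
    (w : EuclideanSpace ℝ (Fin n) → ℝ) : Prop :=
  ∃ G : EuclideanSpace ℝ (Fin n) → EuclideanSpace ℝ (Fin n), IsH1 Ω w G ∧
    ∃ φ : ℕ → EuclideanSpace ℝ (Fin n) → ℝ, (∀ j, IsTestFunction Ω (φ j)) ∧
      Tendsto (fun j => eLpNorm (fun x => φ j x - w x) 2 (volume.restrict Ω)) atTop (𝓝 0) ∧
      Tendsto (fun j => eLpNorm (fun x => gradient (φ j) x - G x) 2 (volume.restrict Ω))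
        atTop (𝓝 0)

/-- The energy `J(u, S) = ∫_S (|∇u|² / 2 + W(u)) dx ∈ [0, ∞]`, where `G` is the weak gradient
of `u`. -/
def energy (γ : ℝ) (S : Set (EuclideanSpace ℝ (Fin n)))
    (u : EuclideanSpace ℝ (Fin n) → ℝ)
    (G : EuclideanSpace ℝ (Fin n) → EuclideanSpace ℝ (Fin n)) : ℝ≥0∞ :=
  ∫⁻ x in S, ENNReal.ofReal (1 / 2 * ‖G x‖ ^ 2 + potential γ (u x))

/-- `u ≥ 0` minimizes `J` in `Ω` with respect to compactly supported perturbations: `u` lies in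
`H¹_loc(Ω)`, has finite energy on compact subsets of `Ω`, and `J(u, K) ≤ J(v, K)` whenever
`K ⊆ Ω` is compact, `v ≥ 0` lies in `H¹_loc(Ω)`, and `v = u` a.e. in `Ω \ K`. -/
def IsMinimizer (γ : ℝ) (Ω : Set (EuclideanSpace ℝ (Fin n)))
    (u : EuclideanSpace ℝ (Fin n) → ℝ) : Prop :=
  ∃ G : EuclideanSpace ℝ (Fin n) → EuclideanSpace ℝ (Fin n), IsH1Loc Ω u G ∧
    (∀ᵐ x ∂(volume.restrict Ω), 0 ≤ u x) ∧
    ∀ K : Set (EuclideanSpace ℝ (Fin n)), IsCompact K → K ⊆ Ω →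
      energy γ K u G < ⊤ ∧
      ∀ (v : EuclideanSpace ℝ (Fin n) → ℝ)
        (H : EuclideanSpace ℝ (Fin n) → EuclideanSpace ℝ (Fin n)), IsH1Loc Ω v H →
        (∀ᵐ x ∂(volume.restrict Ω), 0 ≤ v x) →
        (∀ᵐ x ∂(volume.restrict (Ω \ K)), v x = u x) →
        energy γ K u G ≤ energy γ K v H

/-- `u ≥ 0` minimizes `J(·, Ω)` for its own boundary data: `u` lies in `H¹(Ω)`, has finite energy,
and `J(u, Ω) ≤ J(v, Ω)` for every `v ≥ 0` in `H¹(Ω)` with `v - u ∈ H¹₀(Ω)`. -/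
def IsDirichletMinimizer (γ : ℝ) (Ω : Set (EuclideanSpace ℝ (Fin n)))
    (u : EuclideanSpace ℝ (Fin n) → ℝ) : Prop :=
  ∃ G : EuclideanSpace ℝ (Fin n) → EuclideanSpace ℝ (Fin n), IsH1 Ω u G ∧
    (∀ᵐ x ∂(volume.restrict Ω), 0 ≤ u x) ∧
    energy γ Ω u G < ⊤ ∧
    ∀ (v : EuclideanSpace ℝ (Fin n) → ℝ)
      (H : EuclideanSpace ℝ (Fin n) → EuclideanSpace ℝ (Fin n)), IsH1 Ω v H →
      (∀ᵐ x ∂(volume.restrict Ω), 0 ≤ v x) →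
      IsH1Zero Ω (fun x => v x - u x) →
      energy γ Ω u G ≤ energy γ Ω v H

end AltPhillips

end

/-! To pass minimality to the limit, a competitor `v` of `u₀` must be glued into `u k`. The
difficulty is the transition layer: an ordinary cutoff may create small positive values, where the
potential is huge, and uniform convergence gives no smallness of `∇(u k - u₀)`. Both problems
disappear if the gluing uses lattice operations only. The glued function is `min (min (max u v) (v +
a)) (u + b)`, with `a = 0` in an inner ball `B` and `b = 0` outside a larger one `K`. At each point
its value and gradient are those of one of `u`, `v`, `v + a`, `u + b`, so the energy in `K \ B` is
controlled by the sum of theirs, and the share of `u` cancels in the minimality inequality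
(`energy_le_of_glue`).

In the layer `r ≤ |x| < ρ` the functions `a` and `b` are built on the barriers `((|x|² - r²)₊)^α`
and `((ρ² - |x|²)₊)^α` with `α = 2 / (2 + γ)`. For this exponent the squared gradient and the
potential of a barrier both blow up like the distance to the power `-β`, `β = 2γ / (2 + γ)`, and `β
< 1` means `γ < 2`. Hence a barrier costs only `O((ρ - r)^(1 - β))`. Adding a nonnegative function
to a positive barrier only lowers the potential. Uniform convergence is needed only to push `|u k -
u₀|` below the barrier height `(ρ² - r²)^α`.

Gluing in `v = 0` bounds the energies of `u k` on smaller balls (`exists_energy_bound`). Weak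
compactness of the gradients and Fatou's lemma give lower semicontinuity
(`exists_weakGradient_energy_le`). Gluing in a general `v`, then letting `k → ∞`, `ρ → r` and
finally the weight `δ` of the cross term tend to `0`, gives local minimality (`energy_ball_le`).

For Dirichlet data the limit is glued with a competitor `v` near the unit sphere. There `v - u` is
not small, but test functions `φ j` converge to it in `H¹`, so `η = θ (v - u - φ j)` equals `v - u`
near the sphere and has small gradient (`IsMinimizerWith.energy_ball_le_of_isH1Zero`); then `r → 1`.
Dirichlet minimizers in the sequence are local minimizers by `IsDirichletMinimizer.isMinimizer`. -/

noncomputable section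

namespace AltPhillips

open scoped Convolution

/-! ### Mollification in `L²` -/

section Mollification

variable {E F : Type*} [NormedAddCommGroup E] [InnerProductSpace ℝ E] [FiniteDimensional ℝ E]
  [MeasurableSpace E] [BorelSpace E] [NormedAddCommGroup F] [NormedSpace ℝ F]

theorem eLpNorm_two_sq {α : Type*} {m : MeasurableSpace α} {ε : Type*} [TopologicalSpace ε]
    [ContinuousENorm ε] (f : α → ε) (μ : Measure α) :
    eLpNorm f 2 μ ^ 2 = ∫⁻ x, ‖f x‖ₑ ^ 2 ∂μ := by
  have := eLpNorm_nnreal_pow_eq_lintegral (f := f) (μ := μ) (p := 2) two_ne_zero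
  simpa using this

/-- The convolution with the normalized bump function `φ`. -/
def mollify (φ : ContDiffBump (0 : E)) (f : E → F) : E → F :=
  φ.normed volume ⋆[ContinuousLinearMap.lsmul ℝ ℝ, volume] f

theorem mollify_congr (φ : ContDiffBump (0 : E)) {f g : E → F} (h : f =ᵐ[volume] g) :
    mollify φ f = mollify φ g :=
  convolution_congr _ EventuallyEq.rfl h

theorem lintegral_normed (φ : ContDiffBump (0 : E)) :
    ∫⁻ x, ENNReal.ofReal (φ.normed volume x) = 1 := by
  rw [← ofReal_integral_eq_lintegral_ofReal φ.integrable_normed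
    (Eventually.of_forall φ.nonneg_normed), φ.integral_normed, ENNReal.ofReal_one]

/-- Jensen's inequality for the probability measure with density `φ.normed`, followed by Tonelli and
translation invariance. -/
theorem eLpNorm_mollify_le (φ : ContDiffBump (0 : E)) {f : E → F}
    (hf : AEStronglyMeasurable f volume) :
    eLpNorm (mollify φ f) 2 volume ≤ eLpNorm f 2 volume := by
  wlog hm : StronglyMeasurable f generalizing f
  · rw [mollify_congr φ hf.ae_eq_mk, eLpNorm_congr_ae hf.ae_eq_mk]
    exact this hf.stronglyMeasurable_mk.aestronglyMeasurable hf.stronglyMeasurable_mk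
  have hρ : Measurable fun x => ENNReal.ofReal (φ.normed volume x) :=
    (φ.continuous_normed.measurable).ennreal_ofReal
  have hfe : Measurable fun x => ‖f x‖ₑ := hm.enorm
  let ν : Measure E := volume.withDensity fun x => ENNReal.ofReal (φ.normed volume x)
  have : IsProbabilityMeasure ν := ⟨by
    simp only [ν, withDensity_apply _ MeasurableSet.univ, Measure.restrict_univ]
    exact lintegral_normed φ⟩
  have key : ∀ x, ‖mollify φ f x‖ₑ ^ 2 ≤
      ∫⁻ t, ENNReal.ofReal (φ.normed volume t) * ‖f (x - t)‖ₑ ^ 2 := by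
    intro x
    have hmx : StronglyMeasurable fun t => f (x - t) :=
      hm.comp_measurable (measurable_const.sub measurable_id)
    have h1 : ‖mollify φ f x‖ₑ ≤ eLpNorm (fun t => f (x - t)) 1 ν := by
      rw [eLpNorm_one_eq_lintegral_enorm, lintegral_withDensity_eq_lintegral_mul _ hρ hmx.enorm]
      refine (enorm_integral_le_lintegral_enorm _).trans (lintegral_mono fun t => ?_)
      simp only [ContinuousLinearMap.lsmul_apply, enorm_smul, Pi.mul_apply]
      rw [Real.enorm_of_nonneg (φ.nonneg_normed t)]
    have h2 := h1.trans (eLpNorm_le_eLpNorm_of_exponent_le (p := 1) (q := 2) (by norm_num)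
      (μ := ν) hmx.aestronglyMeasurable)
    calc ‖mollify φ f x‖ₑ ^ 2 ≤ eLpNorm (fun t => f (x - t)) 2 ν ^ 2 := by gcongr
      _ = _ := by
        rw [eLpNorm_two_sq, lintegral_withDensity_eq_lintegral_mul _ hρ (hmx.enorm.pow_const 2)]
        rfl
  rw [← ENNReal.pow_le_pow_left_iff two_ne_zero, eLpNorm_two_sq, eLpNorm_two_sq]
  calc ∫⁻ x, ‖mollify φ f x‖ₑ ^ 2
      ≤ ∫⁻ x, ∫⁻ t, ENNReal.ofReal (φ.normed volume t) * ‖f (x - t)‖ₑ ^ 2 := lintegral_mono key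
    _ = ∫⁻ t, ∫⁻ x, ENNReal.ofReal (φ.normed volume t) * ‖f (x - t)‖ₑ ^ 2 := by
        rw [lintegral_lintegral_swap]
        refine Measurable.aemeasurable ?_
        exact (hρ.comp measurable_snd).mul
          ((hfe.comp (measurable_fst.sub measurable_snd)).pow_const 2)
    _ = ∫⁻ t, ENNReal.ofReal (φ.normed volume t) * ∫⁻ x, ‖f x‖ₑ ^ 2 := by
        refine lintegral_congr fun t => ?_
        have hmt : Measurable fun x => ‖f (x - t)‖ₑ ^ 2 :=
          (hfe.comp (measurable_id.sub_const t)).pow_const 2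
        rw [lintegral_const_mul _ hmt,
          lintegral_sub_right_eq_self (fun x => ‖f x‖ₑ ^ 2) t]
    _ = ∫⁻ x, ‖f x‖ₑ ^ 2 := by
        rw [lintegral_mul_const _ hρ, lintegral_normed, one_mul]

theorem mollify_sub (φ : ContDiffBump (0 : E)) {f g : E → F}
    (hf : LocallyIntegrable f volume) (hg : LocallyIntegrable g volume) :
    mollify φ (f - g) = mollify φ f - mollify φ g := by
  have h1 : ConvolutionExists (φ.normed volume) f (ContinuousLinearMap.lsmul ℝ ℝ) volume :=
    φ.hasCompactSupport_normed.convolutionExists_left _ φ.continuous_normed hf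
  have h2 : ConvolutionExists (φ.normed volume) g (ContinuousLinearMap.lsmul ℝ ℝ) volume :=
    φ.hasCompactSupport_normed.convolutionExists_left _ φ.continuous_normed hg
  ext x
  simp only [mollify, convolution, Pi.sub_apply, map_sub]
  exact integral_sub (h1 x) (h2 x)

theorem continuous_mollify (φ : ContDiffBump (0 : E)) {f : E → F}
    (hf : LocallyIntegrable f volume) : Continuous (mollify φ f) :=
  φ.hasCompactSupport_normed.continuous_convolution_left _ φ.continuous_normed hf

theorem mollify_eq_zero (φ : ContDiffBump (0 : E)) {f : E → F} {x : E}
    (h : ∀ y, f y ≠ 0 → φ.rOut ≤ dist x y) : mollify φ f x = 0 := by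
  refine integral_eq_zero_of_ae (Eventually.of_forall fun t => ?_)
  by_cases ht : f (x - t) = 0
  · simp [ht]
  · have h1 := h _ ht
    rw [dist_eq_norm, sub_sub_cancel] at h1
    have : t ∉ Function.support (φ.normed volume) := by
      rw [φ.support_normed_eq]; simpa using h1
    simp [Function.notMem_support.1 this]

/-- The contraction bound reduces the claim to a continuous compactly supported `g`. For such `g`
uniform continuity gives a uniformly small error living on a fixed compact neighbourhood of the
support. -/
theorem tendsto_eLpNorm_mollify_sub [CompleteSpace F] {φ : ℕ → ContDiffBump (0 : E)}
    (hφ : Tendsto (fun j => (φ j).rOut) atTop (𝓝 0)) {f : E → F} (hf : MemLp f 2 volume) :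
    Tendsto (fun j => eLpNorm (mollify (φ j) f - f) 2 volume) atTop (𝓝 0) := by
  have h12 : (1 : ℝ≥0∞) ≤ 2 := by norm_num
  rw [ENNReal.tendsto_nhds_zero]
  intro ε hε
  obtain ⟨g, hgs, hgε, hgc, hg⟩ := hf.exists_hasCompactSupport_eLpNorm_sub_le (by norm_num)
    (ε := ε / 3) (ENNReal.div_pos hε.ne' (by norm_num)).ne'
  have hK : IsCompact (Metric.cthickening 1 (tsupport g)) := hgs.isCompact.cthickening
  have huc : UniformContinuous g := hgs.uniformContinuous_of_continuous hgc
  set V := volume (Metric.cthickening 1 (tsupport g)) with hV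
  have hVt : V ≠ ⊤ := hK.measure_lt_top.ne
  -- `η` is so small that the constant `η` on a set of volume `V` has `L²` norm at most `ε / 3`.
  obtain ⟨η, hη0, hη⟩ : ∃ η : ℝ, 0 < η ∧ ENNReal.ofReal η * V ^ (1 / 2 : ℝ) ≤ ε / 3 := by
    have h1 : Tendsto (fun η : ℝ => ENNReal.ofReal η * V ^ (1 / 2 : ℝ)) (𝓝[>] 0) (𝓝 0) := by
      have : Tendsto (fun η : ℝ => ENNReal.ofReal η) (𝓝[>] 0) (𝓝 0) := by
        have := (ENNReal.continuous_ofReal.tendsto 0).mono_left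
          (nhdsWithin_le_nhds (s := Ioi (0 : ℝ)))
        simpa using this
      have h2 := ENNReal.Tendsto.mul_const (b := V ^ (1 / 2 : ℝ)) this
        (Or.inr (ENNReal.rpow_ne_top_of_nonneg (by norm_num) hVt))
      simpa using h2
    have h3 := (ENNReal.tendsto_nhds_zero.1 h1) (ε / 3) (ENNReal.div_pos hε.ne' (by norm_num))
    obtain ⟨η, h4, h5⟩ := (h3.and self_mem_nhdsWithin).exists
    exact ⟨η, h5, h4⟩
  obtain ⟨δ, hδ0, hδ⟩ := Metric.uniformContinuous_iff.1 huc η hη0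
  have hev : ∀ᶠ j in atTop, (φ j).rOut < min δ 1 :=
    hφ.eventually (gt_mem_nhds (lt_min hδ0 one_pos))
  filter_upwards [hev] with j hj
  have hfl : LocallyIntegrable f volume := hf.locallyIntegrable h12
  have hgl : LocallyIntegrable g volume := hgc.locallyIntegrable
  have hA : eLpNorm (mollify (φ j) (f - g)) 2 volume ≤ ε / 3 :=
    (eLpNorm_mollify_le _ (hf.1.sub hg.1)).trans hgε
  have hB : eLpNorm (mollify (φ j) g - g) 2 volume ≤ ε / 3 := by
    have hpt : ∀ x, ‖(mollify (φ j) g - g) x‖ ≤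
        ‖(Metric.cthickening 1 (tsupport g)).indicator (fun _ => η) x‖ := by
      intro x
      by_cases hx : x ∈ Metric.cthickening 1 (tsupport g)
      · rw [indicator_of_mem hx, Pi.sub_apply, ← dist_eq_norm, Real.norm_of_nonneg hη0.le]
        refine ContDiffBump.dist_normed_convolution_le hgc.aestronglyMeasurable fun y hy => ?_
        exact (hδ ((Metric.mem_ball.1 hy).trans (hj.trans_le (min_le_left _ _)))).le
      · have h0 : g x = 0 := by
          by_contra h
          exact hx (Metric.self_subset_cthickening _ (subset_tsupport _ h))
        rw [Pi.sub_apply, h0, mollify_eq_zero, sub_zero, norm_zero]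
        · positivity
        · intro y hy
          by_contra h
          push Not at h
          exact hx (Metric.mem_cthickening_of_dist_le x y 1 _ (subset_tsupport _ hy)
            (h.le.trans (hj.le.trans (min_le_right _ _))))
    refine (eLpNorm_mono hpt).trans ?_
    rw [eLpNorm_indicator_const hK.measurableSet (by norm_num) (by norm_num),
      Real.enorm_of_nonneg hη0.le]
    simpa using hη
  have hC : eLpNorm (g - f) 2 volume ≤ ε / 3 := by rwa [eLpNorm_sub_comm]
  have hsplit : mollify (φ j) f - f
      = mollify (φ j) (f - g) + ((mollify (φ j) g - g) + (g - f)) := by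
    rw [mollify_sub _ hfl hgl]; abel
  have m1 : AEStronglyMeasurable (mollify (φ j) (f - g)) volume :=
    (continuous_mollify _ (hfl.sub hgl)).aestronglyMeasurable
  have m2 : AEStronglyMeasurable (mollify (φ j) g - g) volume :=
    ((continuous_mollify _ hgl).sub hgc).aestronglyMeasurable
  rw [hsplit]
  refine (eLpNorm_add_le m1 (m2.add (hg.1.sub hf.1)) h12).trans ?_
  refine (add_le_add hA ((eLpNorm_add_le m2 (hg.1.sub hf.1) h12).trans (add_le_add hB hC))).trans ?_
  rw [← add_assoc, ENNReal.add_thirds]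

end Mollification

/-! ### Weak gradients and `H¹_loc` -/

section WeakGradient

variable {n : ℕ} {Ω U : Set (EuclideanSpace ℝ (Fin n))}
  {u v φ θ : EuclideanSpace ℝ (Fin n) → ℝ}
  {G H : EuclideanSpace ℝ (Fin n) → EuclideanSpace ℝ (Fin n)}

namespace IsTestFunction

theorem continuous_fderiv_apply (hφ : IsTestFunction Ω φ) (e : EuclideanSpace ℝ (Fin n)) :
    Continuous fun x => fderiv ℝ φ x e :=
  (hφ.smooth.continuous_fderiv (by simp)).clm_apply continuous_const

theorem tsupport_fderiv_apply_subset (φ : EuclideanSpace ℝ (Fin n) → ℝ)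
    (e : EuclideanSpace ℝ (Fin n)) : tsupport (fun x => fderiv ℝ φ x e) ⊆ tsupport φ :=
  (closure_mono fun x hx => by
    contrapose! hx
    simp only [Function.mem_support, ne_eq, not_not] at hx ⊢
    rw [hx]; rfl).trans (tsupport_fderiv_subset ℝ)

theorem hasCompactSupport_fderiv_apply (hφ : IsTestFunction Ω φ)
    (e : EuclideanSpace ℝ (Fin n)) : HasCompactSupport fun x => fderiv ℝ φ x e :=
  hφ.compact.of_isClosed_subset (isClosed_tsupport _) (tsupport_fderiv_apply_subset φ e)

theorem mono (hφ : IsTestFunction U φ) (h : U ⊆ Ω) : IsTestFunction Ω φ :=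
  ⟨hφ.smooth, hφ.compact, hφ.support_subset.trans h⟩

theorem smooth_mul (hφ : IsTestFunction Ω φ) (hθ : ContDiff ℝ ∞ θ) :
    IsTestFunction Ω (fun x => θ x * φ x) :=
  ⟨hθ.mul hφ.smooth, hφ.compact.mul_left, (tsupport_mul_subset_right).trans hφ.support_subset⟩

end IsTestFunction

theorem integrable_mul_of_tsupport_subset {f g : EuclideanSpace ℝ (Fin n) → ℝ}
    (hf : LocallyIntegrableOn f Ω volume) (hg : Continuous g) (hc : HasCompactSupport g)
    (hs : tsupport g ⊆ Ω) : Integrable (fun x => f x * g x) volume := by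
  have h1 : IntegrableOn (fun x => f x * g x) (tsupport g) volume :=
    (hf.integrableOn_compact_subset hs hc).mul_continuousOn hg.continuousOn hc
  refine (integrableOn_iff_integrable_of_support_subset fun x hx => ?_).1 h1
  exact subset_tsupport _ (right_ne_zero_of_mul hx)

theorem _root_.MeasureTheory.LocallyIntegrableOn.inner_const
    (hG : LocallyIntegrableOn G Ω volume) (e : EuclideanSpace ℝ (Fin n)) :
    LocallyIntegrableOn (fun x => inner ℝ (G x) e) Ω volume := by
  intro x hx
  obtain ⟨t, ht, h⟩ := hG x hx
  exact ⟨t, ht, h.inner_const e⟩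

theorem locallyIntegrableOn_of_memLp {F : Type*} [NormedAddCommGroup F]
    {f : EuclideanSpace ℝ (Fin n) → F} (hΩ : IsOpen Ω)
    (hf : ∀ K : Set (EuclideanSpace ℝ (Fin n)), IsCompact K → K ⊆ Ω →
      MemLp f 2 (volume.restrict K)) : LocallyIntegrableOn f Ω volume := by
  rw [locallyIntegrableOn_iff hΩ.isLocallyClosed]
  intro K hKΩ hK
  have : IsFiniteMeasure (volume.restrict K) := ⟨by simpa using hK.measure_lt_top⟩
  exact (hf K hK hKΩ).integrable (by norm_num)

theorem memLp_of_norm_le_mul {F F' F'' : Type*} [NormedAddCommGroup F] [NormedAddCommGroup F']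
    [NormedAddCommGroup F''] {K : Set (EuclideanSpace ℝ (Fin n))}
    {f : EuclideanSpace ℝ (Fin n) → F} {c : EuclideanSpace ℝ (Fin n) → F'}
    {g : EuclideanSpace ℝ (Fin n) → F''} (hK : IsCompact K) (hf : MemLp f 2 (volume.restrict K))
    (hc : Continuous c) (hg : AEStronglyMeasurable g (volume.restrict K))
    (h : ∀ x, ‖g x‖ ≤ ‖c x‖ * ‖f x‖) : MemLp g 2 (volume.restrict K) := by
  obtain ⟨C, hC⟩ := hK.exists_bound_of_continuousOn hc.continuousOn
  refine hf.of_le_mul (c := C) hg ?_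
  refine (ae_restrict_iff' hK.measurableSet).2 (Eventually.of_forall fun x hx => (h x).trans ?_)
  gcongr
  exact hC x hx

namespace HasWeakGradient

theorem integrable_mul_fderiv (h : HasWeakGradient Ω u G) (hφ : IsTestFunction Ω φ)
    (e : EuclideanSpace ℝ (Fin n)) : Integrable (fun x => u x * fderiv ℝ φ x e) volume :=
  integrable_mul_of_tsupport_subset h.locallyIntegrable (hφ.continuous_fderiv_apply e)
    (hφ.hasCompactSupport_fderiv_apply e)
    ((IsTestFunction.tsupport_fderiv_apply_subset φ e).trans hφ.support_subset)

theorem integrable_inner_mul (h : HasWeakGradient Ω u G) (hφ : IsTestFunction Ω φ)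
    (e : EuclideanSpace ℝ (Fin n)) : Integrable (fun x => inner ℝ (G x) e * φ x) volume :=
  integrable_mul_of_tsupport_subset (h.locallyIntegrable_grad.inner_const e)
    hφ.smooth.continuous hφ.compact hφ.support_subset

theorem mono (h : HasWeakGradient Ω u G) (hU : U ⊆ Ω) : HasWeakGradient U u G where
  locallyIntegrable := h.locallyIntegrable.mono_set hU
  locallyIntegrable_grad := h.locallyIntegrable_grad.mono_set hU
  integral_eq φ hφ e := by
    have key : ∀ {f g : EuclideanSpace ℝ (Fin n) → ℝ}, tsupport g ⊆ U →
        ∫ x in U, f x * g x = ∫ x in Ω, f x * g x := by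
      intro f g hg
      rw [setIntegral_eq_integral_of_forall_compl_eq_zero,
        setIntegral_eq_integral_of_forall_compl_eq_zero]
      · intro x hx
        rw [image_eq_zero_of_notMem_tsupport fun hx' => hx (hU (hg hx')), mul_zero]
      · intro x hx
        rw [image_eq_zero_of_notMem_tsupport fun hx' => hx (hg hx'), mul_zero]
    rw [key hφ.support_subset, key ((IsTestFunction.tsupport_fderiv_apply_subset φ e).trans
      hφ.support_subset)]
    exact h.integral_eq φ (hφ.mono hU) e

theorem congr (h : HasWeakGradient Ω u G) (hΩ : IsOpen Ω) (hu : u =ᵐ[volume.restrict Ω] v)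
    (hG : G =ᵐ[volume.restrict Ω] H) : HasWeakGradient Ω v H where
  locallyIntegrable := by
    rw [locallyIntegrableOn_iff hΩ.isLocallyClosed]
    intro K hKΩ hK
    exact (h.locallyIntegrable.integrableOn_compact_subset hKΩ hK).congr
      (ae_restrict_of_ae_restrict_of_subset hKΩ hu)
  locallyIntegrable_grad := by
    rw [locallyIntegrableOn_iff hΩ.isLocallyClosed]
    intro K hKΩ hK
    exact (h.locallyIntegrable_grad.integrableOn_compact_subset hKΩ hK).congr
      (ae_restrict_of_ae_restrict_of_subset hKΩ hG)
  integral_eq φ hφ e := by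
    have h1 : ∫ x in Ω, v x * fderiv ℝ φ x e = ∫ x in Ω, u x * fderiv ℝ φ x e :=
      integral_congr_ae (by filter_upwards [hu] with x hx; rw [hx])
    have h2 : ∫ x in Ω, inner ℝ (H x) e * φ x = ∫ x in Ω, inner ℝ (G x) e * φ x :=
      integral_congr_ae (by filter_upwards [hG] with x hx; rw [hx])
    rw [h1, h2, h.integral_eq φ hφ e]

theorem add (hu : HasWeakGradient Ω u G) (hv : HasWeakGradient Ω v H) :
    HasWeakGradient Ω (fun x => u x + v x) (fun x => G x + H x) where
  locallyIntegrable := hu.locallyIntegrable.add hv.locallyIntegrable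
  locallyIntegrable_grad := hu.locallyIntegrable_grad.add hv.locallyIntegrable_grad
  integral_eq φ hφ e := by
    simp only [add_mul, inner_add_left]
    rw [integral_add (hu.integrable_mul_fderiv hφ e).integrableOn
      (hv.integrable_mul_fderiv hφ e).integrableOn,
      integral_add (hu.integrable_inner_mul hφ e).integrableOn
      (hv.integrable_inner_mul hφ e).integrableOn, hu.integral_eq φ hφ e, hv.integral_eq φ hφ e]
    ring

theorem neg (hu : HasWeakGradient Ω u G) :
    HasWeakGradient Ω (fun x => - u x) (fun x => - G x) where
  locallyIntegrable := hu.locallyIntegrable.neg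
  locallyIntegrable_grad := hu.locallyIntegrable_grad.neg
  integral_eq φ hφ e := by
    simp only [neg_mul, inner_neg_left, integral_neg, hu.integral_eq φ hφ e]

theorem sub (hu : HasWeakGradient Ω u G) (hv : HasWeakGradient Ω v H) :
    HasWeakGradient Ω (fun x => u x - v x) (fun x => G x - H x) := by
  simpa only [sub_eq_add_neg] using hu.add hv.neg

/-- Each component of `G - H` is orthogonal to all test functions, so the fundamental lemma of the
calculus of variations applies. Thanks to this locality, energies on an open set can be compared by
comparing the functions alone. -/
theorem ae_eq_of_ae_eq (hΩ : IsOpen Ω) (hu : HasWeakGradient Ω u G) (hv : HasWeakGradient Ω v H)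
    (h : u =ᵐ[volume.restrict Ω] v) : G =ᵐ[volume.restrict Ω] H := by
  have hd : LocallyIntegrableOn (fun x => G x - H x) Ω volume :=
    hu.locallyIntegrable_grad.sub hv.locallyIntegrable_grad
  have key : ∀ e : EuclideanSpace ℝ (Fin n), ∀ᵐ x ∂volume, x ∈ Ω → inner ℝ (G x - H x) e = 0 := by
    intro e
    refine hΩ.ae_eq_zero_of_integral_contDiff_smul_eq_zero (hd.inner_const e) ?_
    intro φ h1 h2 h3
    have hφ : IsTestFunction Ω φ := ⟨h1, h2, h3⟩
    have hu' := hu.integral_eq φ hφ e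
    have hv' := hv.integral_eq φ hφ e
    have huv : ∫ x in Ω, u x * fderiv ℝ φ x e = ∫ x in Ω, v x * fderiv ℝ φ x e :=
      integral_congr_ae (by filter_upwards [h] with x hx; rw [hx])
    have h4 : ∫ x, φ x • inner ℝ (G x - H x) e
        = ∫ x in Ω, (inner ℝ (G x) e * φ x - inner ℝ (H x) e * φ x) := by
      rw [← setIntegral_eq_integral_of_forall_compl_eq_zero (s := Ω)]
      · refine integral_congr_ae (Eventually.of_forall fun x => ?_)
        simp only [smul_eq_mul, inner_sub_left]
        ring
      · intro x hx
        rw [image_eq_zero_of_notMem_tsupport fun hx' => hx (h3 hx'), zero_smul]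
    rw [h4, integral_sub (hu.integrable_inner_mul hφ e).integrableOn
      (hv.integrable_inner_mul hφ e).integrableOn]
    linarith
  have hall : ∀ᵐ x ∂volume, ∀ i : Fin n, x ∈ Ω →
      inner ℝ (G x - H x) (EuclideanSpace.single i (1 : ℝ)) = 0 := ae_all_iff.2 fun i => key _
  rw [EventuallyEq, ae_restrict_iff' hΩ.measurableSet]
  filter_upwards [hall] with x hx hxΩ
  ext i
  have := hx i hxΩ
  simp only [EuclideanSpace.inner_single_right] at this
  simpa [sub_eq_zero] using this

end HasWeakGradient

namespace IsH1Loc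

theorem of_memLp (hΩ : IsOpen Ω)
    (hu : ∀ K : Set (EuclideanSpace ℝ (Fin n)), IsCompact K → K ⊆ Ω →
      MemLp u 2 (volume.restrict K))
    (hG : ∀ K : Set (EuclideanSpace ℝ (Fin n)), IsCompact K → K ⊆ Ω →
      MemLp G 2 (volume.restrict K))
    (h : ∀ φ : EuclideanSpace ℝ (Fin n) → ℝ, IsTestFunction Ω φ →
      ∀ e : EuclideanSpace ℝ (Fin n),
        ∫ x in Ω, u x * fderiv ℝ φ x e = - ∫ x in Ω, inner ℝ (G x) e * φ x) :
    IsH1Loc Ω u G :=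
  ⟨⟨locallyIntegrableOn_of_memLp hΩ hu, locallyIntegrableOn_of_memLp hΩ hG, h⟩, hu, hG⟩

theorem add (hu : IsH1Loc Ω u G) (hv : IsH1Loc Ω v H) :
    IsH1Loc Ω (fun x => u x + v x) (fun x => G x + H x) :=
  ⟨hu.1.add hv.1, fun K h h' => (hu.2 K h h').add (hv.2 K h h'),
    fun K h h' => (hu.3 K h h').add (hv.3 K h h')⟩

theorem neg (hu : IsH1Loc Ω u G) : IsH1Loc Ω (fun x => - u x) (fun x => - G x) :=
  ⟨hu.1.neg, fun K h h' => (hu.2 K h h').neg, fun K h h' => (hu.3 K h h').neg⟩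

theorem sub (hu : IsH1Loc Ω u G) (hv : IsH1Loc Ω v H) :
    IsH1Loc Ω (fun x => u x - v x) (fun x => G x - H x) :=
  ⟨hu.1.sub hv.1, fun K h h' => (hu.2 K h h').sub (hv.2 K h h'),
    fun K h h' => (hu.3 K h h').sub (hv.3 K h h')⟩

theorem congr (h : IsH1Loc Ω u G) (hΩ : IsOpen Ω) (hu : u =ᵐ[volume.restrict Ω] v)
    (hG : G =ᵐ[volume.restrict Ω] H) : IsH1Loc Ω v H :=
  ⟨h.1.congr hΩ hu hG,
    fun K h1 h' => (memLp_congr_ae (ae_restrict_of_ae_restrict_of_subset h' hu)).1 (h.2 K h1 h'),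
    fun K h1 h' => (memLp_congr_ae (ae_restrict_of_ae_restrict_of_subset h' hG)).1 (h.3 K h1 h')⟩

theorem _root_.AltPhillips.IsH1.isH1Loc (h : IsH1 Ω u G) : IsH1Loc Ω u G :=
  ⟨h.1, fun _ _ hK => h.2.mono_measure (Measure.restrict_mono hK le_rfl),
    fun _ _ hK => h.3.mono_measure (Measure.restrict_mono hK le_rfl)⟩

/-- The product rule: `θ φ` is again a test function, and testing `u` against it produces the term
with the derivative of `θ`. -/
theorem smooth_mul (hΩ : IsOpen Ω) (hu : IsH1Loc Ω u G) (hθ : ContDiff ℝ ∞ θ) :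
    IsH1Loc Ω (fun x => θ x * u x) (fun x => θ x • G x + u x • gradient θ x) := by
  have hgrad : Continuous (gradient θ) :=
    (InnerProductSpace.toDual ℝ _).symm.continuous.comp (hθ.continuous_fderiv (by simp))
  refine of_memLp hΩ (fun K hK hKΩ => ?_) (fun K hK hKΩ => ?_) fun φ hφ e => ?_
  · exact memLp_of_norm_le_mul hK (hu.2 K hK hKΩ) hθ.continuous
      (hθ.continuous.aestronglyMeasurable.mul (hu.2 K hK hKΩ).1) fun x => (norm_mul _ _).le
  · refine (memLp_of_norm_le_mul hK (hu.3 K hK hKΩ) hθ.continuous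
      (hθ.continuous.aestronglyMeasurable.smul (hu.3 K hK hKΩ).1)
      fun x => (norm_smul (θ x) (G x)).le).add
      (memLp_of_norm_le_mul hK (hu.2 K hK hKΩ) hgrad
      ((hu.2 K hK hKΩ).1.smul hgrad.aestronglyMeasurable)
      fun x => by rw [norm_smul, mul_comm])
  · have h1 := hu.1.integral_eq _ (hφ.smooth_mul hθ) e
    have hd : ∀ x, fderiv ℝ (fun x => θ x * φ x) x e
        = θ x * fderiv ℝ φ x e + φ x * fderiv ℝ θ x e := by
      intro x
      rw [fderiv_fun_mul (hθ.differentiable (by simp) x) (hφ.smooth.differentiable (by simp) x)]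
      simp
    have hin : ∀ x, inner ℝ (gradient θ x) e = fderiv ℝ θ x e := fun x =>
      InnerProductSpace.toDual_symm_apply
    have i2 : Integrable (fun x => u x * (φ x * fderiv ℝ θ x e)) volume := by
      refine integrable_mul_of_tsupport_subset hu.1.locallyIntegrable
        (hφ.smooth.continuous.mul ((hθ.continuous_fderiv (by simp)).clm_apply continuous_const))
        hφ.compact.mul_right (tsupport_mul_subset_left.trans hφ.support_subset)
    have i1 : Integrable (fun x => u x * (θ x * fderiv ℝ φ x e)) volume := by
      refine integrable_mul_of_tsupport_subset hu.1.locallyIntegrable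
        (hθ.continuous.mul (hφ.continuous_fderiv_apply e))
        (hφ.hasCompactSupport_fderiv_apply e).mul_left (tsupport_mul_subset_right.trans
          ((IsTestFunction.tsupport_fderiv_apply_subset φ e).trans hφ.support_subset))
    have i3 : Integrable (fun x => inner ℝ (G x) e * (θ x * φ x)) volume :=
      hu.1.integrable_inner_mul (hφ.smooth_mul hθ) e
    simp only [hd, mul_add] at h1
    rw [integral_add i1.integrableOn i2.integrableOn] at h1
    have h2 : ∫ x in Ω, inner ℝ (θ x • G x + u x • gradient θ x) e * φ x
        = (∫ x in Ω, inner ℝ (G x) e * (θ x * φ x)) + ∫ x in Ω, u x * (φ x * fderiv ℝ θ x e) := by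
      rw [← integral_add i3.integrableOn i2.integrableOn]
      refine integral_congr_ae (Eventually.of_forall fun x => ?_)
      simp only [inner_add_left, real_inner_smul_left, hin]
      ring
    have h3 : ∫ x in Ω, θ x * u x * fderiv ℝ φ x e = ∫ x in Ω, u x * (θ x * fderiv ℝ φ x e) :=
      integral_congr_ae (Eventually.of_forall fun x => by ring)
    rw [h2, h3]
    linarith

theorem of_contDiff (hΩ : IsOpen Ω) {f : EuclideanSpace ℝ (Fin n) → ℝ} (hf : ContDiff ℝ 1 f) :
    IsH1Loc Ω f (gradient f) := by
  have hgrad : Continuous (gradient f) :=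
    (InnerProductSpace.toDual ℝ _).symm.continuous.comp (hf.continuous_fderiv (by simp))
  have hm : ∀ {F : Type} [NormedAddCommGroup F] {g : EuclideanSpace ℝ (Fin n) → F},
      Continuous g → ∀ K : Set (EuclideanSpace ℝ (Fin n)), IsCompact K → K ⊆ Ω →
      MemLp g 2 (volume.restrict K) := by
    intro F _ g hg K hK _
    have : IsFiniteMeasure (volume.restrict K) := ⟨by simpa using hK.measure_lt_top⟩
    obtain ⟨C, hC⟩ := hK.exists_bound_of_continuousOn hg.continuousOn
    refine MemLp.of_bound (hg.aestronglyMeasurable) C ?_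
    exact (ae_restrict_iff' hK.measurableSet).2 (Eventually.of_forall hC)
  have hl : LocallyIntegrableOn f Ω volume := hf.continuous.locallyIntegrable.locallyIntegrableOn _
  refine of_memLp hΩ (hm hf.continuous) (hm hgrad) fun φ hφ e => ?_
  have hin : ∀ x, inner ℝ (gradient f x) e = fderiv ℝ f x e := fun x =>
      InnerProductSpace.toDual_symm_apply
  simp only [hin]
  have hfe : Continuous fun x => fderiv ℝ f x e :=
    (hf.continuous_fderiv (by simp)).clm_apply continuous_const
  rw [setIntegral_eq_integral_of_forall_compl_eq_zero,
    setIntegral_eq_integral_of_forall_compl_eq_zero]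
  · refine integral_mul_fderiv_eq_neg_fderiv_mul_of_integrable ?_ ?_ ?_
      (fun x _ => hf.differentiable (by simp) x) (fun x _ => hφ.smooth.differentiable (by simp) x)
    · exact integrable_mul_of_tsupport_subset (hfe.locallyIntegrable.locallyIntegrableOn _)
        hφ.smooth.continuous hφ.compact hφ.support_subset
    · exact integrable_mul_of_tsupport_subset hl (hφ.continuous_fderiv_apply e)
        (hφ.hasCompactSupport_fderiv_apply e)
        ((IsTestFunction.tsupport_fderiv_apply_subset φ e).trans hφ.support_subset)
    · exact integrable_mul_of_tsupport_subset hl hφ.smooth.continuous hφ.compact hφ.support_subset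
  · intro x hx
    rw [image_eq_zero_of_notMem_tsupport fun hx' => hx (hφ.support_subset hx'), mul_zero]
  · intro x hx
    rw [image_eq_zero_of_notMem_tsupport (f := fun x => fderiv ℝ φ x e) fun hx' =>
      hx (hφ.support_subset (IsTestFunction.tsupport_fderiv_apply_subset φ e hx')), mul_zero]

/-- Dominated convergence in the defining identity; local majorants suffice because test functions
have compact support. Positive parts and barriers, which are not `C¹`, enter `H¹_loc` through this
lemma. -/
theorem of_tendsto (hΩ : IsOpen Ω) {w : ℕ → EuclideanSpace ℝ (Fin n) → ℝ}
    {D : ℕ → EuclideanSpace ℝ (Fin n) → EuclideanSpace ℝ (Fin n)}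
    {g g' : EuclideanSpace ℝ (Fin n) → ℝ} (h : ∀ m, HasWeakGradient Ω (w m) (D m))
    (hg : ∀ K : Set (EuclideanSpace ℝ (Fin n)), IsCompact K → K ⊆ Ω →
      MemLp g 2 (volume.restrict K))
    (hg' : ∀ K : Set (EuclideanSpace ℝ (Fin n)), IsCompact K → K ⊆ Ω →
      MemLp g' 2 (volume.restrict K))
    (hwm : ∀ m, AEStronglyMeasurable (w m) (volume.restrict Ω))
    (hDm : ∀ m, AEStronglyMeasurable (D m) (volume.restrict Ω))
    (hw : ∀ m, ∀ᵐ x ∂(volume.restrict Ω), ‖w m x‖ ≤ g x)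
    (hD : ∀ m, ∀ᵐ x ∂(volume.restrict Ω), ‖D m x‖ ≤ g' x)
    (hwt : ∀ᵐ x ∂(volume.restrict Ω), Tendsto (fun m => w m x) atTop (𝓝 (u x)))
    (hDt : ∀ᵐ x ∂(volume.restrict Ω), Tendsto (fun m => D m x) atTop (𝓝 (G x))) :
    IsH1Loc Ω u G := by
  have hum : AEStronglyMeasurable u (volume.restrict Ω) :=
    aestronglyMeasurable_of_tendsto_ae atTop hwm hwt
  have hGm : AEStronglyMeasurable G (volume.restrict Ω) :=
    aestronglyMeasurable_of_tendsto_ae atTop hDm hDt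
  have hub : ∀ᵐ x ∂(volume.restrict Ω), ‖u x‖ ≤ g x := by
    filter_upwards [hwt, ae_all_iff.2 hw] with x h1 h2
    exact le_of_tendsto h1.norm (Eventually.of_forall h2)
  have hGb : ∀ᵐ x ∂(volume.restrict Ω), ‖G x‖ ≤ g' x := by
    filter_upwards [hDt, ae_all_iff.2 hD] with x h1 h2
    exact le_of_tendsto h1.norm (Eventually.of_forall h2)
  have hgl := locallyIntegrableOn_of_memLp hΩ hg
  have hgl' := locallyIntegrableOn_of_memLp hΩ hg'
  refine of_memLp hΩ (fun K hK hKΩ => ?_) (fun K hK hKΩ => ?_) fun φ hφ e => ?_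
  · refine (hg K hK hKΩ).mono' (hum.mono_measure (Measure.restrict_mono hKΩ le_rfl))
      (ae_restrict_of_ae_restrict_of_subset hKΩ hub)
  · refine (hg' K hK hKΩ).mono' (hGm.mono_measure (Measure.restrict_mono hKΩ le_rfl))
      (ae_restrict_of_ae_restrict_of_subset hKΩ hGb)
  · have t1 : Tendsto (fun m => ∫ x in Ω, w m x * fderiv ℝ φ x e) atTop
        (𝓝 (∫ x in Ω, u x * fderiv ℝ φ x e)) := by
      refine tendsto_integral_of_dominated_convergence (fun x => g x * ‖fderiv ℝ φ x e‖)
        (fun m => ((h m).integrable_mul_fderiv hφ e).integrableOn.1) ?_ (fun m => ?_) ?_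
      · refine (integrable_mul_of_tsupport_subset hgl (hφ.continuous_fderiv_apply e).norm
          (hφ.hasCompactSupport_fderiv_apply e).norm ?_).integrableOn
        refine (closure_mono ?_).trans
          ((IsTestFunction.tsupport_fderiv_apply_subset φ e).trans hφ.support_subset)
        exact (Function.support_comp_subset norm_zero _)
      · filter_upwards [hw m] with x hx
        rw [norm_mul]; gcongr
      · filter_upwards [hwt] with x hx
        exact hx.mul_const _
    have t2 : Tendsto (fun m => ∫ x in Ω, inner ℝ (D m x) e * φ x) atTop
        (𝓝 (∫ x in Ω, inner ℝ (G x) e * φ x)) := by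
      refine tendsto_integral_of_dominated_convergence (fun x => g' x * (‖e‖ * ‖φ x‖))
        (fun m => ((h m).integrable_inner_mul hφ e).integrableOn.1) ?_ (fun m => ?_) ?_
      · refine (integrable_mul_of_tsupport_subset hgl'
          (continuous_const.mul hφ.smooth.continuous.norm)
          hφ.compact.norm.mul_left ?_).integrableOn
        refine (closure_mono ?_).trans hφ.support_subset
        exact (Function.support_mul_subset_right _ _).trans
          (Function.support_comp_subset norm_zero _)
      · filter_upwards [hD m] with x hx
        rw [norm_mul, ← mul_assoc]
        gcongr
        exact (norm_inner_le_norm _ _).trans (by gcongr)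
      · filter_upwards [hDt] with x hx
        exact (hx.inner tendsto_const_nhds).mul_const _
    simp only [(h _).integral_eq φ hφ e] at t1
    exact tendsto_nhds_unique t1 t2.neg

theorem aestronglyMeasurable (h : IsH1Loc Ω u G) :
    AEStronglyMeasurable u (volume.restrict Ω) :=
  h.1.locallyIntegrable.aestronglyMeasurable

theorem aestronglyMeasurable_grad (h : IsH1Loc Ω u G) :
    AEStronglyMeasurable G (volume.restrict Ω) :=
  h.1.locallyIntegrable_grad.aestronglyMeasurable

end IsH1Loc

end WeakGradient

/-! ### Approximation of compactly supported `H¹` functions -/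

section Approximation

variable {n : ℕ} {Ω K : Set (EuclideanSpace ℝ (Fin n))}
  {u v w φ : EuclideanSpace ℝ (Fin n) → ℝ}
  {G H : EuclideanSpace ℝ (Fin n) → EuclideanSpace ℝ (Fin n)}

-- Equality to `1` on a neighbourhood of `K`, and not only on `K`, makes the derivative of the
-- cutoff vanish on `K`.
open scoped Manifold in
theorem exists_cutoff (hK : IsCompact K) (hΩ : IsOpen Ω) (hKΩ : K ⊆ Ω) :
    ∃ η : EuclideanSpace ℝ (Fin n) → ℝ, IsTestFunction Ω η ∧ (∀ᶠ x in 𝓝ˢ K, η x = 1) ∧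
      ∀ x, η x ∈ Icc (0 : ℝ) 1 := by
  obtain ⟨L, hL, hKL, hLΩ⟩ := exists_compact_between hK hΩ hKΩ
  obtain ⟨f, h1, h0, hf⟩ := exists_contMDiffMap_one_nhds_of_subset_interior
    (n := (⊤ : ℕ∞)) 𝓘(ℝ, EuclideanSpace ℝ (Fin n)) hK.isClosed hKL
  have hsupp : tsupport f ⊆ L := closure_minimal (fun x hx => by
    by_contra hxL
    exact hx (h0 x hxL)) hL.isClosed
  exact ⟨f, ⟨f.contMDiff.contDiff, hL.of_isClosed_subset (isClosed_tsupport _) hsupp,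
    hsupp.trans hLΩ⟩, h1, hf⟩

theorem fderiv_normed_sub_apply (ρ : ContDiffBump (0 : EuclideanSpace ℝ (Fin n)))
    (x y e : EuclideanSpace ℝ (Fin n)) :
    fderiv ℝ (fun z => ρ.normed volume (x - z)) y e = - fderiv ℝ (ρ.normed volume) (x - y) e := by
  have h1 : HasFDerivAt (fun z : EuclideanSpace ℝ (Fin n) => x - z)
      (-(ContinuousLinearMap.id ℝ (EuclideanSpace ℝ (Fin n)))) y := by
    simpa using (hasFDerivAt_id y).const_sub x
  have h2 := ((ρ.contDiff_normed (μ := volume) (n := ⊤)).differentiable (by simp)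
    (x - y)).hasFDerivAt
  have h3 : HasFDerivAt (fun z => ρ.normed volume (x - z)) _ y := h2.comp y h1
  rw [h3.fderiv]
  simp

theorem fderiv_mollify_apply (ρ : ContDiffBump (0 : EuclideanSpace ℝ (Fin n)))
    (hul : LocallyIntegrable u volume) (x e : EuclideanSpace ℝ (Fin n)) :
    fderiv ℝ (mollify ρ u) x e = ∫ t, u t * fderiv ℝ (ρ.normed volume) (x - t) e := by
  have hρ : ContDiff ℝ 1 (ρ.normed volume) := ρ.contDiff_normed
  have hρs : HasCompactSupport (ρ.normed volume) := ρ.hasCompactSupport_normed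
  have hd := hρs.hasFDerivAt_convolution_left (ContinuousLinearMap.lsmul ℝ ℝ) hρ hul x
  have hex1 := ((hρs.fderiv ℝ).convolutionExists_left
      ((ContinuousLinearMap.lsmul ℝ ℝ).precompL (EuclideanSpace ℝ (Fin n)))
      (hρ.continuous_fderiv (by simp)) hul x).integrable_swap
  rw [mollify, hd.fderiv, MeasureTheory.convolution_eq_swap,
    ContinuousLinearMap.integral_apply hex1]
  refine integral_congr_ae (Eventually.of_forall fun t => ?_)
  exact mul_comm _ _

/-- The weak gradient identity tested with `z ↦ ρ (x - z)` moves the derivative from the mollifier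
to `u`. -/
theorem gradient_mollify (ρ : ContDiffBump (0 : EuclideanSpace ℝ (Fin n)))
    (hu : HasWeakGradient univ u G) (x : EuclideanSpace ℝ (Fin n)) :
    gradient (mollify ρ u) x = mollify ρ G x := by
  have hul : LocallyIntegrable u volume := locallyIntegrableOn_univ.1 hu.locallyIntegrable
  have hGl : LocallyIntegrable G volume := locallyIntegrableOn_univ.1 hu.locallyIntegrable_grad
  have hρ : ContDiff ℝ ∞ (ρ.normed volume) := ρ.contDiff_normed
  have hρs : HasCompactSupport (ρ.normed volume) := ρ.hasCompactSupport_normed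
  have htest : IsTestFunction univ fun z => ρ.normed volume (x - z) :=
    ⟨hρ.comp (contDiff_const.sub contDiff_id),
      hρs.comp_homeomorph (Homeomorph.subLeft x), subset_univ _⟩
  have hex2 : Integrable (fun t => ρ.normed volume (x - t) • G t) volume :=
    (hρs.convolutionExists_left (ContinuousLinearMap.lsmul ℝ ℝ)
      hρ.continuous hGl x).integrable_swap
  have hG : mollify ρ G x = ∫ t, ρ.normed volume (x - t) • G t :=
    MeasureTheory.convolution_eq_swap _
  refine ext_inner_right ℝ fun e => ?_
  rw [gradient, InnerProductSpace.toDual_symm_apply, fderiv_mollify_apply ρ hul, hG,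
    real_inner_comm, ← integral_inner hex2]
  have h := hu.integral_eq _ htest e
  simp only [setIntegral_univ, fderiv_normed_sub_apply, mul_neg, integral_neg, neg_inj] at h
  rw [h]
  refine integral_congr_ae (Eventually.of_forall fun t => ?_)
  simp only [real_inner_smul_right]
  rw [real_inner_comm, mul_comm]

/-- A function in `H¹_loc(Ω)` that vanishes outside a compact subset of `Ω` is approximated by
test functions. -/
theorem IsH1Loc.exists_testFunction (hΩ : IsOpen Ω) (hw : IsH1Loc Ω w G) (hK : IsCompact K)
    (hKΩ : K ⊆ Ω) (h0 : ∀ᵐ x ∂(volume.restrict (Ω \ K)), w x = 0) :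
    IsH1 Ω w G ∧ ∃ φ : ℕ → EuclideanSpace ℝ (Fin n) → ℝ, (∀ j, IsTestFunction Ω (φ j)) ∧
      Tendsto (fun j => eLpNorm (fun x => φ j x - w x) 2 (volume.restrict Ω)) atTop (𝓝 0) ∧
      Tendsto (fun j => eLpNorm (fun x => gradient (φ j) x - G x) 2 (volume.restrict Ω))
        atTop (𝓝 0) := by
  have hΩK : IsOpen (Ω \ K) := hΩ.sdiff hK.isClosed
  have hz : HasWeakGradient (Ω \ K) (fun _ => 0) (fun _ => 0) :=
    ⟨locallyIntegrable_const 0 |>.locallyIntegrableOn _,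
      locallyIntegrable_const 0 |>.locallyIntegrableOn _, by simp⟩
  -- Off `K` the gradient vanishes along with `w`, so both may be replaced by their indicators on
  -- `K`.
  have hG0 : ∀ᵐ x ∂(volume.restrict (Ω \ K)), G x = 0 :=
    (hw.1.mono sdiff_subset).ae_eq_of_ae_eq hΩK hz h0
  have hind : ∀ {F : Type} [NormedAddCommGroup F] {f : EuclideanSpace ℝ (Fin n) → F},
      (∀ᵐ x ∂(volume.restrict (Ω \ K)), f x = 0) → K.indicator f =ᵐ[volume.restrict Ω] f := by
    intro F _ f hf
    rw [EventuallyEq, ae_restrict_iff' hΩ.measurableSet]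
    rw [ae_restrict_iff' hΩK.measurableSet] at hf
    filter_upwards [hf] with x hx hxΩ
    by_cases hxK : x ∈ K
    · rw [indicator_of_mem hxK]
    · rw [indicator_of_notMem hxK, hx ⟨hxΩ, hxK⟩]
  have hwi := hind h0
  have hGi := hind hG0
  have mw : MemLp (K.indicator w) 2 volume :=
    (memLp_indicator_iff_restrict hK.measurableSet).2 (hw.2 K hK hKΩ)
  have mG : MemLp (K.indicator G) 2 volume :=
    (memLp_indicator_iff_restrict hK.measurableSet).2 (hw.3 K hK hKΩ)
  have hH1 : IsH1 Ω w G :=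
    ⟨hw.1, (memLp_congr_ae hwi).1 (mw.restrict Ω), (memLp_congr_ae hGi).1 (mG.restrict Ω)⟩
  refine ⟨hH1, ?_⟩
  -- Extension by zero has a weak gradient on the whole space: a cutoff equal to `1` near `K` makes
  -- any test function admissible in `Ω` without changing it where the indicators live.
  have hglob : HasWeakGradient univ (K.indicator w) (K.indicator G) := by
    refine ⟨(mw.locallyIntegrable (by norm_num)).locallyIntegrableOn _,
      (mG.locallyIntegrable (by norm_num)).locallyIntegrableOn _, fun φ hφ e => ?_⟩
    obtain ⟨η, hη, hη1, -⟩ := exists_cutoff hK hΩ hKΩ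
    have htest : IsTestFunction Ω fun x => φ x * η x := hη.smooth_mul hφ.smooth
    have h1 : ∀ x ∈ K, (fun x => φ x * η x) =ᶠ[𝓝 x] φ := by
      intro x hx
      filter_upwards [(eventually_nhdsSet_iff_forall.1 hη1) x hx] with y hy
      rw [hy, mul_one]
    have h2 := (hw.1.congr hΩ hwi.symm hGi.symm).integral_eq _ htest e
    have e1 : ∀ x, K.indicator w x * fderiv ℝ (fun x => φ x * η x) x e
        = K.indicator w x * fderiv ℝ φ x e := by
      intro x
      by_cases hx : x ∈ K
      · rw [(h1 x hx).fderiv_eq]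
      · simp [hx]
    have e2 : ∀ x, inner ℝ (K.indicator G x) e * (φ x * η x)
        = inner ℝ (K.indicator G x) e * φ x := by
      intro x
      by_cases hx : x ∈ K
      · rw [show φ x * η x = φ x from (h1 x hx).self_of_nhds]
      · simp [hx]
    simp only [e1, e2] at h2
    rw [setIntegral_eq_integral_of_forall_compl_eq_zero,
      setIntegral_eq_integral_of_forall_compl_eq_zero] at h2
    · simpa using h2
    · intro x hx
      rw [indicator_of_notMem fun h => hx (hKΩ h)]; simp
    · intro x hx
      rw [indicator_of_notMem fun h => hx (hKΩ h)]; simp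
  obtain ⟨δ, hδ0, hδ⟩ := hK.exists_cthickening_subset_open hΩ hKΩ
  have hpos : ∀ j : ℕ, 0 < δ / (j + 1) := fun j => by positivity
  -- Radii at most `δ` keep the mollified functions supported in the `δ`-thickening of `K`, inside
  -- `Ω`.
  let ρ : ℕ → ContDiffBump (0 : EuclideanSpace ℝ (Fin n)) := fun j =>
    ⟨δ / (j + 1) / 2, δ / (j + 1), half_pos (hpos j), half_lt_self (hpos j)⟩
  have hρ : Tendsto (fun j => (ρ j).rOut) atTop (𝓝 0) :=
    tendsto_const_div_atTop_nhds_zero_nat δ |>.comp (tendsto_add_atTop_nat 1) |>.congr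
      fun j => by simp [ρ]
  have hsupp : ∀ j, tsupport (mollify (ρ j) (K.indicator w)) ⊆ Metric.cthickening δ K := by
    intro j
    refine closure_minimal (fun x hx => ?_) Metric.isClosed_cthickening
    by_contra hxK
    refine hx (mollify_eq_zero _ fun y hy => ?_)
    by_contra hlt
    push Not at hlt
    have hyK : y ∈ K := by
      by_contra h
      exact hy (indicator_of_notMem h _)
    refine hxK (Metric.mem_cthickening_of_dist_le x y δ K hyK (hlt.le.trans ?_))
    exact div_le_self hδ0.le (by simp)
  refine ⟨fun j => mollify (ρ j) (K.indicator w), fun j => ⟨?_, ?_, (hsupp j).trans hδ⟩, ?_, ?_⟩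
  · exact (ρ j).hasCompactSupport_normed.contDiff_convolution_left _ (n := ⊤)
      (ρ j).contDiff_normed (mw.locallyIntegrable (by norm_num))
  · exact hK.cthickening.of_isClosed_subset (isClosed_tsupport _) (hsupp j)
  · refine tendsto_of_tendsto_of_tendsto_of_le_of_le tendsto_const_nhds
      (tendsto_eLpNorm_mollify_sub hρ mw) (fun _ => zero_le) fun j => ?_
    refine le_trans (le_of_eq (eLpNorm_congr_ae ?_)) (eLpNorm_restrict_le _ _ _ Ω)
    filter_upwards [hwi] with x hx
    rw [Pi.sub_apply, hx]
  · refine tendsto_of_tendsto_of_tendsto_of_le_of_le tendsto_const_nhds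
      (tendsto_eLpNorm_mollify_sub hρ mG) (fun _ => zero_le) fun j => ?_
    refine le_trans (le_of_eq (eLpNorm_congr_ae ?_)) (eLpNorm_restrict_le _ _ _ Ω)
    filter_upwards [hGi] with x hx
    rw [Pi.sub_apply, hx, gradient_mollify _ hglob]

end Approximation

/-! ### The chain rule -/

section ChainRule

theorem tendsto_integral_zero_of_tendsto_eLpNorm {α F : Type*} {m : MeasurableSpace α}
    [NormedAddCommGroup F] {μ : Measure α} {h : ℕ → α → F} {c : ℕ → α → ℝ} {g : α → ℝ}
    (hh : Tendsto (fun j => eLpNorm (h j) 2 μ) atTop (𝓝 0))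
    (hm : ∀ j, AEStronglyMeasurable (h j) μ) (hg : MemLp g 2 μ)
    (hc : ∀ j x, |c j x| ≤ ‖h j x‖ * |g x|) :
    Tendsto (fun j => ∫ x, c j x ∂μ) atTop (𝓝 0) := by
  have key : Tendsto (fun j => ‖∫ x, c j x ∂μ‖ₑ) atTop (𝓝 0) := by
    have h1 : Tendsto (fun j => eLpNorm (h j) 2 μ * eLpNorm g 2 μ) atTop (𝓝 0) := by
      simpa using ENNReal.Tendsto.mul_const hh (Or.inr hg.2.ne)
    refine tendsto_of_tendsto_of_tendsto_of_le_of_le tendsto_const_nhds h1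
      (fun _ => zero_le) fun j => ?_
    calc ‖∫ x, c j x ∂μ‖ₑ ≤ ∫⁻ x, ‖c j x‖ₑ ∂μ := enorm_integral_le_lintegral_enorm _
      _ ≤ ∫⁻ x, ‖((fun x => ‖h j x‖) • g) x‖ₑ ∂μ := by
          refine lintegral_mono fun x => enorm_le_iff_norm_le.2 ?_
          simpa using hc j x
      _ = eLpNorm ((fun x => ‖h j x‖) • g) 1 μ := eLpNorm_one_eq_lintegral_enorm.symm
      _ ≤ eLpNorm (fun x => ‖h j x‖) 2 μ * eLpNorm g 2 μ :=
          eLpNorm_smul_le_mul_eLpNorm hg.1 (hm j).norm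
      _ = _ := by rw [eLpNorm_norm]
  have h2 := (ENNReal.tendsto_toReal ENNReal.zero_ne_top).comp key
  rw [tendsto_zero_iff_norm_tendsto_zero]
  simpa [Function.comp_def] using h2

variable {n : ℕ} {Ω : Set (EuclideanSpace ℝ (Fin n))}
  {u v : EuclideanSpace ℝ (Fin n) → ℝ}
  {G H : EuclideanSpace ℝ (Fin n) → EuclideanSpace ℝ (Fin n)}

theorem gradient_comp {F F' : ℝ → ℝ} {f : EuclideanSpace ℝ (Fin n) → ℝ}
    (hF : ∀ s, HasDerivAt F (F' s) s) (x : EuclideanSpace ℝ (Fin n))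
    (hf : DifferentiableAt ℝ f x) :
    gradient (fun y => F (f y)) x = F' (f x) • gradient f x := by
  have h := (hF (f x)).comp_hasFDerivAt x hf.hasFDerivAt
  have h' : HasFDerivAt (fun y => F (f y)) (F' (f x) • fderiv ℝ f x) x := h
  rw [gradient, h'.fderiv, map_smul]
  rfl

/-- After localization by a cutoff, `u` is a limit of test functions, for which the rule is
classical. Since `F` is `1`-Lipschitz, the compositions converge in `L²`. Since `F'` is only
continuous and bounded, its factor is treated by dominated convergence along an almost everywhere
convergent subsequence. -/
theorem IsH1Loc.comp (hΩ : IsOpen Ω) (hu : IsH1Loc Ω u G) {F F' : ℝ → ℝ}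
    (hF : ∀ s, HasDerivAt F (F' s) s) (hF' : Continuous F') (h1 : ∀ s, |F' s| ≤ 1)
    (h0 : F 0 = 0) : IsH1Loc Ω (fun x => F (u x)) (fun x => F' (u x) • G x) := by
  have hlip : ∀ a b, |F a - F b| ≤ |a - b| := by
    intro a b
    have := Convex.norm_image_sub_le_of_norm_hasDerivWithin_le (f := F) (f' := F') (C := 1)
      (s := univ) (fun x _ => (hF x).hasDerivWithinAt) (fun x _ => h1 x) convex_univ
      (mem_univ b) (mem_univ a)
    simpa using this
  have hFc : Continuous F := continuous_iff_continuousAt.2 fun s => (hF s).continuousAt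
  have hF1 : ContDiff ℝ 1 F := by
    rw [contDiff_one_iff_deriv]
    refine ⟨fun s => (hF s).differentiableAt, ?_⟩
    rwa [show deriv F = F' from funext fun s => (hF s).deriv]
  refine of_memLp hΩ (fun K hK hKΩ => ?_) (fun K hK hKΩ => ?_) fun φ hφ e => ?_
  · refine (hu.2 K hK hKΩ).mono (hFc.comp_aestronglyMeasurable (hu.2 K hK hKΩ).1)
      (Eventually.of_forall fun x => ?_)
    simpa [h0] using hlip (u x) 0
  · refine (hu.3 K hK hKΩ).mono ((hF'.comp_aestronglyMeasurable (hu.2 K hK hKΩ).1).smul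
      (hu.3 K hK hKΩ).1) (Eventually.of_forall fun x => ?_)
    rw [norm_smul]
    exact mul_le_of_le_one_left (norm_nonneg _) (h1 _)
  · obtain ⟨η, hη, hη1, -⟩ := exists_cutoff hφ.compact hΩ hφ.support_subset
    have hw := hu.smooth_mul hΩ hη.smooth
    set w := fun x => η x * u x with hwdef
    set D := fun x => η x • G x + u x • gradient η x with hDdef
    have hw0 : ∀ᵐ x ∂(volume.restrict (Ω \ tsupport η)), w x = 0 := by
      rw [ae_restrict_iff' (hΩ.sdiff (isClosed_tsupport η)).measurableSet]
      refine Eventually.of_forall fun x hx => ?_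
      simp [hwdef, image_eq_zero_of_notMem_tsupport hx.2]
    obtain ⟨hH1, f, hf, hfw, hfD⟩ := hw.exists_testFunction hΩ hη.compact hη.support_subset hw0
    have hfc : ∀ j, Continuous (f j) := fun j => (hf j).smooth.continuous
    have hgc : ∀ j, Continuous (gradient (f j)) := fun j =>
      (InnerProductSpace.toDual ℝ _).symm.continuous.comp ((hf j).smooth.continuous_fderiv (by simp))
    obtain ⟨ns, hns, hae⟩ := (tendstoInMeasure_of_tendsto_eLpNorm (p := 2) two_ne_zero
      (fun j => (hfc j).aestronglyMeasurable) hH1.2.1 hfw).exists_seq_tendsto_ae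
    have hfw' := hfw.comp hns.tendsto_atTop
    have hfD' := hfD.comp hns.tendsto_atTop
    have hφ2 : MemLp φ 2 (volume.restrict Ω) :=
      (hφ.smooth.continuous.memLp_of_hasCompactSupport hφ.compact).restrict Ω
    have hφe2 : MemLp (fun x => fderiv ℝ φ x e) 2 (volume.restrict Ω) :=
      ((hφ.continuous_fderiv_apply e).memLp_of_hasCompactSupport
        (hφ.hasCompactSupport_fderiv_apply e)).restrict Ω
    have eqj : ∀ j, ∫ x in Ω, F (f (ns j) x) * fderiv ℝ φ x e
        = - ∫ x in Ω, inner ℝ (F' (f (ns j) x) • gradient (f (ns j)) x) e * φ x := by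
      intro j
      have := (of_contDiff hΩ (hF1.comp ((hf (ns j)).smooth.of_le (by simp)))).1.integral_eq φ hφ e
      simp only [Function.comp_def] at this
      rw [this]
      congr 1
      refine integral_congr_ae (Eventually.of_forall fun x => ?_)
      simp only
      rw [gradient_comp hF x ((hf (ns j)).smooth.differentiable (by simp) x)]
    have iu : ∀ j, Integrable (fun x => F (f (ns j) x) * fderiv ℝ φ x e) (volume.restrict Ω) :=
      fun j => (integrable_mul_of_tsupport_subset
        ((hFc.comp (hfc (ns j))).locallyIntegrable.locallyIntegrableOn univ)
        (hφ.continuous_fderiv_apply e)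
        (hφ.hasCompactSupport_fderiv_apply e) (subset_univ _)).integrableOn
    have iw : Integrable (fun x => F (w x) * fderiv ℝ φ x e) (volume.restrict Ω) := by
      refine MemLp.integrable_mul (p := 2) (q := 2) ?_ hφe2
      refine hH1.2.mono (hFc.comp_aestronglyMeasurable hH1.2.1) (Eventually.of_forall fun x => ?_)
      simpa [h0] using hlip (w x) 0
    have t1 : Tendsto (fun j => ∫ x in Ω, F (f (ns j) x) * fderiv ℝ φ x e) atTop
        (𝓝 (∫ x in Ω, F (w x) * fderiv ℝ φ x e)) := by
      have h2 := tendsto_integral_zero_of_tendsto_eLpNorm (μ := volume.restrict Ω)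
        (c := fun j x => F (f (ns j) x) * fderiv ℝ φ x e - F (w x) * fderiv ℝ φ x e) hfw'
        (fun j => (hfc (ns j)).aestronglyMeasurable.sub hH1.2.1) hφe2 (fun j x => by
          rw [← sub_mul, abs_mul, Real.norm_eq_abs]
          exact mul_le_mul_of_nonneg_right (hlip _ _) (abs_nonneg _))
      have h3 := h2.add_const (∫ x in Ω, F (w x) * fderiv ℝ φ x e)
      rw [zero_add] at h3
      refine h3.congr fun j => ?_
      rw [integral_sub (iu j) iw]
      ring
    have hFm : ∀ j, Continuous fun x => F' (f (ns j) x) := fun j => hF'.comp (hfc (ns j))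
    have iD : Integrable (fun x => inner ℝ (D x) e * φ x) (volume.restrict Ω) :=
      (hw.1.integrable_inner_mul hφ e).integrableOn
    have iDj : ∀ j, Integrable (fun x => F' (f (ns j) x) * (inner ℝ (D x) e * φ x))
        (volume.restrict Ω) := fun j =>
      iD.mono ((hFm j).aestronglyMeasurable.mul iD.1) (Eventually.of_forall fun x => by
        rw [norm_mul]
        exact mul_le_of_le_one_left (norm_nonneg _) (h1 _))
    have t2 : Tendsto (fun j => ∫ x in Ω, F' (f (ns j) x) * (inner ℝ (D x) e * φ x)) atTop
        (𝓝 (∫ x in Ω, F' (w x) * (inner ℝ (D x) e * φ x))) := by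
      refine tendsto_integral_of_dominated_convergence _ (fun j => (iDj j).1) iD.norm
        (fun j => Eventually.of_forall fun x => ?_) ?_
      · rw [norm_mul]
        exact mul_le_of_le_one_left (norm_nonneg _) (h1 _)
      · filter_upwards [hae] with x hx
        exact ((hF'.tendsto _).comp hx).mul_const _
    have ij : ∀ j, Integrable
        (fun x => inner ℝ (F' (f (ns j) x) • gradient (f (ns j)) x) e * φ x)
        (volume.restrict Ω) := by
      intro j
      refine (integrable_mul_of_tsupport_subset (Ω := univ) ?_ hφ.smooth.continuous hφ.compact
        (subset_univ _)).integrableOn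
      exact (((hFm j).smul (hgc (ns j))).inner continuous_const).locallyIntegrable
        |>.locallyIntegrableOn univ
    -- Replacing the gradient of the approximation by `D` costs an `L²` error because `|F'| ≤ 1`;
    -- what remains is the limit `t2`.
    have t3 : Tendsto (fun j => ∫ x in Ω,
        inner ℝ (F' (f (ns j) x) • gradient (f (ns j)) x) e * φ x) atTop
        (𝓝 (∫ x in Ω, F' (w x) * (inner ℝ (D x) e * φ x))) := by
      have h2 := tendsto_integral_zero_of_tendsto_eLpNorm (μ := volume.restrict Ω)
        (g := fun x => ‖e‖ * φ x)
        (c := fun j x => inner ℝ (F' (f (ns j) x) • gradient (f (ns j)) x) e * φ x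
          - F' (f (ns j) x) * (inner ℝ (D x) e * φ x)) hfD'
        (fun j => (hgc (ns j)).aestronglyMeasurable.sub hH1.3.1) (hφ2.const_mul _) (fun j x => by
          have : inner ℝ (F' (f (ns j) x) • gradient (f (ns j)) x) e * φ x
            - F' (f (ns j) x) * (inner ℝ (D x) e * φ x)
            = F' (f (ns j) x) * (inner ℝ (gradient (f (ns j)) x - D x) e * φ x) := by
            rw [real_inner_smul_left, inner_sub_left]; ring
          rw [this, abs_mul]
          refine (mul_le_of_le_one_left (abs_nonneg _) (h1 _)).trans ?_
          rw [abs_mul, abs_mul, abs_norm, ← mul_assoc]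
          exact mul_le_mul_of_nonneg_right (abs_real_inner_le_norm _ _) (abs_nonneg _))
      have h3 := h2.add t2
      rw [zero_add] at h3
      refine h3.congr fun j => ?_
      rw [integral_sub (ij j) (iDj j)]
      ring
    have key : ∫ x in Ω, F (w x) * fderiv ℝ φ x e
        = - ∫ x in Ω, F' (w x) * (inner ℝ (D x) e * φ x) :=
      tendsto_nhds_unique (t1.congr eqj) t3.neg
    have hloc : ∀ x ∈ tsupport φ, η =ᶠ[𝓝 x] fun _ => 1 := fun x hx =>
      (eventually_nhdsSet_iff_forall.1 hη1) x hx
    have e1 : ∀ x, F (u x) * fderiv ℝ φ x e = F (w x) * fderiv ℝ φ x e := by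
      intro x
      by_cases hx : x ∈ tsupport φ
      · rw [hwdef]; simp [(hloc x hx).self_of_nhds]
      · rw [image_eq_zero_of_notMem_tsupport (f := fun x => fderiv ℝ φ x e) fun hx' =>
          hx (IsTestFunction.tsupport_fderiv_apply_subset φ e hx'), mul_zero, mul_zero]
    have e2 : ∀ x, inner ℝ (F' (u x) • G x) e * φ x = F' (w x) * (inner ℝ (D x) e * φ x) := by
      intro x
      by_cases hx : x ∈ tsupport φ
      · have hg : gradient η x = 0 := by
          rw [gradient, (hloc x hx).fderiv_eq]; simp
        simp only [hwdef, hDdef, (hloc x hx).self_of_nhds, hg, real_inner_smul_left]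
        simp [mul_assoc]
      · rw [image_eq_zero_of_notMem_tsupport hx, mul_zero, mul_zero, mul_zero]
    simp only [e1, e2]
    exact key

end ChainRule

/-! ### Positive parts, lattice operations and powers -/

section Lattice

/-- The function `t ↦ t₊ ^ α`. -/
def posPow (α s : ℝ) : ℝ := (max s 0) ^ α

/-- The derivative of `posPow α` away from the origin, extended by zero. -/
def dposPow (α s : ℝ) : ℝ := if 0 < s then α * s ^ (α - 1) else 0

theorem hasDerivAt_max_zero_sq (s : ℝ) :
    HasDerivAt (fun t : ℝ => (max t 0) ^ 2) (2 * max s 0) s := by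
  rcases lt_trichotomy s 0 with hs | rfl | hs
  · rw [max_eq_right hs.le, mul_zero]
    refine (hasDerivAt_const s (0 : ℝ)).congr_of_eventuallyEq ?_
    filter_upwards [gt_mem_nhds hs] with t ht
    rw [max_eq_right ht.le]; norm_num
  · rw [hasDerivAt_iff_isLittleO_nhds_zero]
    simp only [zero_add, max_self, mul_zero, smul_zero, sub_zero, ne_eq, OfNat.ofNat_ne_zero,
      not_false_eq_true, zero_pow]
    refine (Asymptotics.isBigO_of_le _ fun t => ?_).trans_isLittleO
      (Asymptotics.isLittleO_pow_id (𝕜 := ℝ) one_lt_two)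
    rw [norm_pow, norm_pow]
    gcongr
    rcases le_total t 0 with h | h <;> simp [h]
  · rw [max_eq_left hs.le]
    refine ((hasDerivAt_id s).pow 2).congr_of_eventuallyEq ?_ |>.congr_deriv (by simp)
    filter_upwards [lt_mem_nhds hs] with t ht
    rw [max_eq_left ht.le]; rfl

theorem sq_rpow_half {m : ℝ} (hm : 0 ≤ m) (p : ℝ) : (m ^ 2) ^ (p / 2) = m ^ p := by
  rw [← Real.rpow_natCast, ← Real.rpow_mul hm]
  congr 1
  push_cast
  ring

/-- The choice is `(s₊² + ε²)^(α/2) - ε^α`. It stays below `s₊^α` by subadditivity of `t ↦ t^(α/2)`,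
and its derivative stays below that of `s₊^α` because `α/2 - 1` is negative. The case `α = 1` serves
positive parts, the general case the barriers. -/
theorem exists_smooth_approx_posPow {α : ℝ} (hα : 0 < α) (hα1 : α ≤ 1) :
    ∃ F F' : ℕ → ℝ → ℝ, (∀ m s, HasDerivAt (F m) (F' m s) s) ∧ (∀ m, Continuous (F' m)) ∧
      (∀ m, F m 0 = 0) ∧ (∀ m s, |F m s| ≤ posPow α s) ∧ (∀ m s, |F' m s| ≤ dposPow α s) ∧
      (∀ s, Tendsto (fun m => F m s) atTop (𝓝 (posPow α s))) ∧
      ∀ s, Tendsto (fun m => F' m s) atTop (𝓝 (dposPow α s)) := by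
  let ε : ℕ → ℝ := fun m => 1 / ((m : ℝ) + 1)
  have hε : ∀ m, 0 < ε m := fun m => by positivity
  have hεt : Tendsto (fun m => ε m ^ 2) atTop (𝓝 0) := by
    simpa [ε] using (tendsto_one_div_add_atTop_nhds_zero_nat (𝕜 := ℝ)).pow 2
  have hpos : ∀ m s, 0 < (max s 0) ^ 2 + ε m ^ 2 := fun m s => by
    have := hε m; positivity
  refine ⟨fun m s => ((max s 0) ^ 2 + ε m ^ 2) ^ (α / 2) - (ε m ^ 2) ^ (α / 2),
    fun m s => α * max s 0 * ((max s 0) ^ 2 + ε m ^ 2) ^ (α / 2 - 1), ?_, ?_, ?_, ?_, ?_, ?_, ?_⟩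
  · intro m s
    have h := (((hasDerivAt_max_zero_sq s).add_const (ε m ^ 2)).rpow_const (p := α / 2)
      (Or.inl (hpos m s).ne')).sub_const ((ε m ^ 2) ^ (α / 2))
    refine h.congr_deriv ?_
    ring
  · intro m
    refine (continuous_const.mul (continuous_id.max continuous_const)).mul ?_
    exact (((continuous_id.max continuous_const).pow 2).add continuous_const).rpow_const
      fun s => Or.inl (hpos m s).ne'
  · intro m; simp
  · intro m s
    have h1 : (ε m ^ 2) ^ (α / 2) ≤ ((max s 0) ^ 2 + ε m ^ 2) ^ (α / 2) :=
      Real.rpow_le_rpow (by positivity) (by nlinarith [sq_nonneg (max s 0)]) (by positivity)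
    have h2 : ((max s 0) ^ 2 + ε m ^ 2) ^ (α / 2)
        ≤ ((max s 0) ^ 2) ^ (α / 2) + (ε m ^ 2) ^ (α / 2) :=
      Real.rpow_add_le_add_rpow (by positivity) (by positivity) (by positivity) (by linarith)
    rw [abs_of_nonneg (by linarith), posPow, ← sq_rpow_half (le_max_right s 0)]
    linarith
  · intro m s
    simp only [dposPow]
    split_ifs with hs
    · rw [max_eq_left hs.le, abs_of_nonneg (by have := hε m; positivity), mul_assoc]
      have h1 : (s ^ 2 + ε m ^ 2) ^ (α / 2 - 1) ≤ (s ^ 2) ^ (α / 2 - 1) :=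
        Real.rpow_le_rpow_of_nonpos (by positivity) (by nlinarith [sq_nonneg (ε m)]) (by linarith)
      have h2 : (s ^ 2) ^ (α / 2 - 1) = s ^ (α - 2) := by
        rw [← sq_rpow_half hs.le]; congr 1; ring
      have h3 : s * s ^ (α - 2) = s ^ (α - 1) := by
        rw [show α - 1 = 1 + (α - 2) by ring, Real.rpow_add hs, Real.rpow_one]
      rw [← h3]
      gcongr
      exact h1.trans h2.le
    · rw [max_eq_right (not_lt.1 hs)]; simp
  · intro s
    have h1 : Tendsto (fun m => ((max s 0) ^ 2 + ε m ^ 2) ^ (α / 2)) atTop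
        (𝓝 (((max s 0) ^ 2 + 0) ^ (α / 2))) :=
      (hεt.const_add _).rpow_const (Or.inr (by positivity))
    have h2 : Tendsto (fun m => (ε m ^ 2) ^ (α / 2)) atTop (𝓝 (0 ^ (α / 2))) :=
      hεt.rpow_const (Or.inr (by positivity))
    have h3 := h1.sub h2
    rwa [Real.zero_rpow (by positivity), sub_zero, add_zero, sq_rpow_half (le_max_right s 0)] at h3
  · intro s
    simp only [dposPow]
    split_ifs with hs
    · rw [max_eq_left hs.le]
      have h1 : Tendsto (fun m => (s ^ 2 + ε m ^ 2) ^ (α / 2 - 1)) atTop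
          (𝓝 ((s ^ 2 + 0) ^ (α / 2 - 1))) :=
        (hεt.const_add _).rpow_const (Or.inl (by positivity))
      have h2 := h1.const_mul (α * s)
      have h4 : (s ^ 2) ^ (α / 2 - 1) = s ^ (α - 2) := by
        rw [← sq_rpow_half hs.le]; congr 1; ring
      have h3 : s * s ^ (α - 2) = s ^ (α - 1) := by
        rw [show α - 1 = 1 + (α - 2) by ring, Real.rpow_add hs, Real.rpow_one]
      rwa [add_zero, h4, mul_assoc α s, h3] at h2
    · rw [max_eq_right (not_lt.1 hs)]; simp

variable {n : ℕ} {Ω : Set (EuclideanSpace ℝ (Fin n))}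
  {u v q : EuclideanSpace ℝ (Fin n) → ℝ}
  {G H : EuclideanSpace ℝ (Fin n) → EuclideanSpace ℝ (Fin n)}

/-- The approximating derivatives vanish at `0`, so the limit gradient is zero on `{u = 0}` without
a separate argument. -/
theorem IsH1Loc.posPart (hΩ : IsOpen Ω) (hu : IsH1Loc Ω u G) :
    IsH1Loc Ω (fun x => max (u x) 0) (fun x => if 0 < u x then G x else 0) := by
  obtain ⟨F, F', hF, hF'c, hF0, hFb, hF'b, hFt, hF't⟩ :=
    exists_smooth_approx_posPow (α := 1) one_pos le_rfl
  have hd : ∀ s, dposPow 1 s = if 0 < s then 1 else 0 := fun s => by simp [dposPow]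
  have hp : ∀ s, posPow 1 s = max s 0 := fun s => by simp [posPow]
  have hd1 : ∀ s, dposPow 1 s ≤ 1 := fun s => by rw [hd]; split_ifs <;> norm_num
  have hm := fun m => hu.comp hΩ (hF m) (hF'c m) (fun s => (hF'b m s).trans (hd1 s)) (hF0 m)
  refine of_tendsto hΩ (w := fun m x => F m (u x)) (D := fun m x => F' m (u x) • G x)
    (g := fun x => ‖u x‖) (g' := fun x => ‖G x‖) (fun m => (hm m).1)
    (fun K hK hKΩ => (hu.2 K hK hKΩ).norm) (fun K hK hKΩ => (hu.3 K hK hKΩ).norm)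
    (fun m => (hm m).aestronglyMeasurable) (fun m => (hm m).aestronglyMeasurable_grad)
    (fun m => Eventually.of_forall fun x => (hFb m _).trans ?_)
    (fun m => Eventually.of_forall fun x => ?_)
    (Eventually.of_forall fun x => ?_) (Eventually.of_forall fun x => ?_)
  · rw [hp]
    exact max_le (le_abs_self _) (abs_nonneg _)
  · rw [norm_smul]
    exact mul_le_of_le_one_left (norm_nonneg _) ((hF'b m _).trans (hd1 _))
  · simpa only [hp] using hFt (u x)
  · have := (hF't (u x)).smul_const (G x)
    rw [hd] at this
    simpa using this

theorem IsH1Loc.max (hΩ : IsOpen Ω) (hu : IsH1Loc Ω u G) (hv : IsH1Loc Ω v H) :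
    IsH1Loc Ω (fun x => max (u x) (v x)) (fun x => if u x < v x then H x else G x) := by
  refine (hu.add ((hv.sub hu).posPart hΩ)).congr hΩ (Eventually.of_forall fun x => ?_)
    (Eventually.of_forall fun x => ?_)
  · simp only
    rcases le_total (u x) (v x) with h | h <;> simp [h]
  · simp only [sub_pos]
    split_ifs <;> simp

theorem IsH1Loc.min (hΩ : IsOpen Ω) (hu : IsH1Loc Ω u G) (hv : IsH1Loc Ω v H) :
    IsH1Loc Ω (fun x => min (u x) (v x)) (fun x => if v x < u x then H x else G x) := by
  refine (hu.sub ((hu.sub hv).posPart hΩ)).congr hΩ (Eventually.of_forall fun x => ?_)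
    (Eventually.of_forall fun x => ?_)
  · simp only
    rcases le_total (u x) (v x) with h | h <;> simp [h]
  · simp only [sub_pos]
    split_ifs <;> simp

theorem IsH1Loc.abs (hΩ : IsOpen Ω) (hu : IsH1Loc Ω u G) :
    IsH1Loc Ω (fun x => |u x|) (fun x => if u x < - u x then - G x else G x) :=
  hu.max hΩ hu.neg

/-- For `α < 1` the derivative of the power is unbounded near `0`, so square integrability of the
formal gradient is a hypothesis; the formal gradient is also the majorant for the approximations. -/
theorem IsH1Loc.posPow_comp (hΩ : IsOpen Ω) {α : ℝ} (hα : 0 < α) (hα1 : α ≤ 1)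
    (hq : ContDiff ℝ 1 q)
    (hg : ∀ K : Set (EuclideanSpace ℝ (Fin n)), IsCompact K → K ⊆ Ω →
      MemLp (fun x => dposPow α (q x) * ‖gradient q x‖) 2 (volume.restrict K)) :
    IsH1Loc Ω (fun x => posPow α (q x)) (fun x => dposPow α (q x) • gradient q x) := by
  obtain ⟨F, F', hF, hF'c, hF0, hFb, hF'b, hFt, hF't⟩ := exists_smooth_approx_posPow hα hα1
  have hF1 : ∀ m, ContDiff ℝ 1 (F m) := fun m => by
    rw [contDiff_one_iff_deriv]
    refine ⟨fun s => (hF m s).differentiableAt, ?_⟩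
    rw [show deriv (F m) = F' m from funext fun s => (hF m s).deriv]
    exact hF'c m
  have hm : ∀ m, IsH1Loc Ω (fun x => F m (q x)) (fun x => F' m (q x) • gradient q x) := fun m =>
    (of_contDiff hΩ ((hF1 m).comp hq)).congr hΩ EventuallyEq.rfl
      (Eventually.of_forall fun x => gradient_comp (hF m) x (hq.differentiable (by simp) x))
  have hpc : Continuous fun x => posPow α (q x) :=
    (hq.continuous.max continuous_const).rpow_const fun x => Or.inr hα.le
  have hpm : ∀ K : Set (EuclideanSpace ℝ (Fin n)), IsCompact K → K ⊆ Ω →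
      MemLp (fun x => posPow α (q x)) 2 (volume.restrict K) := by
    intro K hK _
    have : IsFiniteMeasure (volume.restrict K) := ⟨by simpa using hK.measure_lt_top⟩
    obtain ⟨C, hC⟩ := hK.exists_bound_of_continuousOn hpc.continuousOn
    refine MemLp.of_bound hpc.aestronglyMeasurable C ?_
    exact (ae_restrict_iff' hK.measurableSet).2 (Eventually.of_forall hC)
  exact of_tendsto hΩ (fun m => (hm m).1) hpm hg
    (fun m => (hm m).aestronglyMeasurable) (fun m => (hm m).aestronglyMeasurable_grad)
    (fun m => Eventually.of_forall fun x => hFb m _)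
    (fun m => Eventually.of_forall fun x => by
      rw [norm_smul]
      exact mul_le_mul_of_nonneg_right (hF'b m _) (norm_nonneg _))
    (Eventually.of_forall fun x => hFt (q x))
    (Eventually.of_forall fun x => (hF't (q x)).smul_const _)

end Lattice

/-! ### Integrals of singular radial weights -/

section Barrier

variable {n : ℕ}

/-- The weight `s₊ ^ (-β)`, with value `0` for `s ≤ 0`. -/
def weight (β s : ℝ) : ℝ := if 0 < s then s ^ (-β) else 0

theorem weight_nonneg (β s : ℝ) : 0 ≤ weight β s := by
  unfold weight; split_ifs with h
  · positivity
  · exact le_rfl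

theorem measurable_weight (β : ℝ) : Measurable (weight β) :=
  Measurable.ite measurableSet_Ioi (measurable_id.pow_const _) measurable_const

/-- Polar coordinates, with the Jacobian `y^(n-1)` at most `1` inside the unit ball. The endpoints
are null, so `f` and `g` are compared on the open interval only. -/
theorem lintegral_radial_le (hn : 1 ≤ n) {f g : ℝ → ℝ} {a b : ℝ} (ha : 0 ≤ a) (hab : a ≤ b)
    (hb : b ≤ 1) (hf : Measurable f) (hf0 : ∀ y, 0 ≤ f y) (hfs : ∀ y, y ∉ Ico a b → f y = 0)
    (hfg : ∀ y ∈ Ioo a b, f y ≤ g y) (hg : IntervalIntegrable g volume a b) :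
    ∫⁻ x : EuclideanSpace ℝ (Fin n), ENNReal.ofReal (f ‖x‖) ≤
      (n * volume (Metric.ball (0 : EuclideanSpace ℝ (Fin n)) 1)) *
        ENNReal.ofReal (∫ y in a..b, g y) := by
  have : Nontrivial (EuclideanSpace ℝ (Fin n)) := by
    have : Nonempty (Fin n) := ⟨⟨0, hn⟩⟩
    infer_instance
  have hgi : IntegrableOn g (Ioo a b) volume := by
    rw [intervalIntegrable_iff_integrableOn_Ioo_of_le hab] at hg
    exact hg
  have hdim : Module.finrank ℝ (EuclideanSpace ℝ (Fin n)) = n := by simp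
  have hle : ∀ᵐ y ∂(volume : Measure ℝ), y ^ (n - 1) * f y ≤ (Ioo a b).indicator g y := by
    filter_upwards [compl_mem_ae_iff.2 (measure_singleton a)] with y hy
    by_cases hyab : y ∈ Ioo a b
    · rw [indicator_of_mem hyab]
      have h1 : y ^ (n - 1) ≤ 1 := pow_le_one₀ (ha.trans hyab.1.le) (hyab.2.le.trans hb)
      exact (mul_le_of_le_one_left (hf0 y) h1).trans (hfg y hyab)
    · rw [indicator_of_notMem hyab, hfs y, mul_zero]
      exact fun h => hyab ⟨lt_of_le_of_ne h.1 (Ne.symm hy), h.2⟩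
  have hh0 : ∀ y ∈ Ioi (0 : ℝ), 0 ≤ y ^ (n - 1) * f y := fun y hy =>
    mul_nonneg (pow_nonneg (le_of_lt hy) _) (hf0 y)
  have hgi' : Integrable ((Ioo a b).indicator g) volume :=
    (integrable_indicator_iff measurableSet_Ioo).2 hgi
  have hfi : IntegrableOn (fun y => y ^ (n - 1) * f y) (Ioi 0) volume := by
    refine hgi'.integrableOn.mono' (by fun_prop) ?_
    filter_upwards [ae_restrict_of_ae hle, ae_restrict_mem measurableSet_Ioi] with y hy hy0
    rwa [Real.norm_of_nonneg (hh0 y hy0)]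
  have hint : Integrable (fun x : EuclideanSpace ℝ (Fin n) => f ‖x‖) volume := by
    refine (integrable_fun_norm_addHaar volume).2 ?_
    simpa only [hdim, smul_eq_mul] using hfi
  have hI : ∫ y in Ioi (0 : ℝ), y ^ (n - 1) * f y ≤ ∫ y in a..b, g y := by
    calc ∫ y in Ioi (0 : ℝ), y ^ (n - 1) * f y
        ≤ ∫ y in Ioi (0 : ℝ), (Ioo a b).indicator g y :=
          setIntegral_mono_ae hfi hgi'.integrableOn hle
      _ = ∫ y in a..b, g y := by
          rw [setIntegral_indicator measurableSet_Ioo,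
            inter_eq_self_of_subset_right (show Ioo a b ⊆ Ioi 0 from fun y hy => ha.trans_lt hy.1),
            intervalIntegral.integral_of_le hab, integral_Ioc_eq_integral_Ioo]
  rw [← ofReal_integral_eq_lintegral_ofReal hint (Eventually.of_forall fun x => hf0 _),
    integral_fun_norm_addHaar volume, hdim]
  simp only [smul_eq_mul, nsmul_eq_mul]
  rw [ENNReal.ofReal_mul (by positivity), ENNReal.ofReal_mul measureReal_nonneg,
    ENNReal.ofReal_natCast, Measure.real, ENNReal.ofReal_toReal measure_ball_lt_top.ne, ← mul_assoc]
  gcongr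

theorem intervalIntegral_rpow_neg {β : ℝ} (hβ1 : β < 1) (a b : ℝ) :
    IntervalIntegrable (fun y => (y - a) ^ (-β)) volume a b ∧
      ∫ y in a..b, (y - a) ^ (-β) = (b - a) ^ (1 - β) / (1 - β) := by
  constructor
  · have h := (intervalIntegral.intervalIntegrable_rpow' (a := 0) (b := b - a)
      (r := -β) (by linarith)).comp_sub_right a
    simpa using h
  · rw [intervalIntegral.integral_comp_sub_right (fun y => y ^ (-β)) a,
      integral_rpow (Or.inl (by linarith)), sub_self, Real.zero_rpow (by linarith)]
    rw [sub_zero]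
    congr 1 <;> [congr 1; skip] <;> ring

theorem intervalIntegral_rpow_neg' {β : ℝ} (hβ1 : β < 1) (a b : ℝ) :
    IntervalIntegrable (fun y => (b - y) ^ (-β)) volume a b ∧
      ∫ y in a..b, (b - y) ^ (-β) = (b - a) ^ (1 - β) / (1 - β) := by
  constructor
  · have h := (intervalIntegral.intervalIntegrable_rpow' (a := b - a) (b := 0)
      (r := -β) (by linarith)).comp_sub_left b
    simpa using h
  · rw [intervalIntegral.integral_comp_sub_left (fun y => y ^ (-β)) b,
      integral_rpow (Or.inl (by linarith)), sub_self, Real.zero_rpow (by linarith)]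
    rw [sub_zero]
    congr 1 <;> [congr 1; skip] <;> ring

/-- The constant in the bound for the integral of a radial weight over an annulus. -/
def annulusConst (n : ℕ) (β : ℝ) : ℝ≥0∞ :=
  n * volume (Metric.ball (0 : EuclideanSpace ℝ (Fin n)) 1) * ENNReal.ofReal (2 / (1 - β))

theorem annulusConst_ne_top (n : ℕ) (β : ℝ) : annulusConst n β ≠ ⊤ :=
  ENNReal.mul_ne_top (ENNReal.mul_ne_top (by simp) measure_ball_lt_top.ne) ENNReal.ofReal_ne_top

/-- The `2` in `2 / (1 - β)` leaves room for the factor `2^β ≤ 2` of the outer weight; the inner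
weight does not need it. -/
theorem setLIntegral_annulus_le (hn : 1 ≤ n) {β : ℝ} {r ρ : ℝ} (hr : 0 ≤ r)
    (hrρ : r ≤ ρ) (hρ : ρ ≤ 1) {f g : ℝ → ℝ} (hf : Measurable f) (hf0 : ∀ y, 0 ≤ f y)
    (hfg : ∀ y ∈ Ioo r ρ, f y ≤ g y) (hg : IntervalIntegrable g volume r ρ)
    (hgI : ∫ y in r..ρ, g y ≤ 2 / (1 - β) * (ρ - r) ^ (1 - β)) (hβ1 : β < 1) :
    ∫⁻ x in Metric.ball (0 : EuclideanSpace ℝ (Fin n)) ρ \ Metric.ball 0 r,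
      ENNReal.ofReal (f ‖x‖) ≤ annulusConst n β * ENNReal.ofReal ((ρ - r) ^ (1 - β)) := by
  have h := lintegral_radial_le hn (f := (Ico r ρ).indicator f) hr hrρ hρ
    (hf.indicator measurableSet_Ico) (fun y => indicator_nonneg (fun y _ => hf0 y) y)
    (fun y hy => indicator_of_notMem hy _)
    (fun y hy => by rw [indicator_of_mem (Ioo_subset_Ico_self hy)]; exact hfg y hy) hg
  have hmeas : MeasurableSet (Metric.ball (0 : EuclideanSpace ℝ (Fin n)) ρ \ Metric.ball 0 r) :=
    measurableSet_ball.diff measurableSet_ball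
  rw [← lintegral_indicator hmeas]
  refine le_trans (lintegral_mono fun x => ?_) (h.trans ?_)
  · by_cases hx : x ∈ Metric.ball (0 : EuclideanSpace ℝ (Fin n)) ρ \ Metric.ball 0 r
    · rw [indicator_of_mem hx, indicator_of_mem]
      simpa [and_comm] using hx
    · rw [indicator_of_notMem hx]
      exact zero_le
  · rw [annulusConst, mul_assoc _ (ENNReal.ofReal (2 / (1 - β))),
      ← ENNReal.ofReal_mul (div_nonneg zero_le_two (by linarith))]
    gcongr

theorem setLIntegral_weight_inner_le (hn : 1 ≤ n) {β : ℝ} (hβ : 0 < β) (hβ1 : β < 1) {r ρ : ℝ}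
    (hr : 1 / 2 ≤ r) (hrρ : r ≤ ρ) (hρ : ρ ≤ 1) :
    ∫⁻ x in Metric.ball (0 : EuclideanSpace ℝ (Fin n)) ρ \ Metric.ball 0 r,
      ENNReal.ofReal (weight β (‖x‖ ^ 2 - r ^ 2)) ≤
        annulusConst n β * ENNReal.ofReal ((ρ - r) ^ (1 - β)) := by
  obtain ⟨hi, hI⟩ := intervalIntegral_rpow_neg hβ1 r ρ
  refine setLIntegral_annulus_le hn (f := fun y => weight β (y ^ 2 - r ^ 2)) (by linarith) hrρ hρ
    ((measurable_weight β).comp (by fun_prop)) (fun y => weight_nonneg _ _) (fun y hy => ?_) hi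
    ?_ hβ1
  -- Here `y + r ≥ 1`, as both radii are at least `1/2`.
  · have h1 : y - r ≤ y ^ 2 - r ^ 2 := by nlinarith [hy.1]
    have h2 : 0 < y - r := by linarith [hy.1]
    rw [weight, if_pos (h2.trans_le h1)]
    exact Real.rpow_le_rpow_of_nonpos h2 h1 (by linarith)
  · rw [hI, div_mul_eq_mul_div]
    have : 0 ≤ (ρ - r) ^ (1 - β) := Real.rpow_nonneg (by linarith) _
    have : 0 < 1 - β := by linarith
    gcongr
    linarith

theorem setLIntegral_weight_outer_le (hn : 1 ≤ n) {β : ℝ} (hβ : 0 < β) (hβ1 : β < 1) {r ρ : ℝ}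
    (hr : 0 ≤ r) (hrρ : r ≤ ρ) (hρ2 : 1 / 2 ≤ ρ) (hρ : ρ ≤ 1) :
    ∫⁻ x in Metric.ball (0 : EuclideanSpace ℝ (Fin n)) ρ \ Metric.ball 0 r,
      ENNReal.ofReal (weight β (ρ ^ 2 - ‖x‖ ^ 2)) ≤
        annulusConst n β * ENNReal.ofReal ((ρ - r) ^ (1 - β)) := by
  obtain ⟨hi, hI⟩ := intervalIntegral_rpow_neg' hβ1 r ρ
  refine setLIntegral_annulus_le hn (f := fun y => weight β (ρ ^ 2 - y ^ 2))
    (g := fun y => 2 * (ρ - y) ^ (-β)) hr hrρ hρ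
    ((measurable_weight β).comp (by fun_prop)) (fun y => weight_nonneg _ _) (fun y hy => ?_)
    (hi.const_mul 2) ?_ hβ1
  · have h2 : 0 < ρ - y := by linarith [hy.2]
    have hy0 : 0 < y := hr.trans_lt hy.1
    -- Here `ρ + y ≥ 1/2` follows from `ρ` alone, so the inner radius may be `0`.
    have h1 : (1 / 2) * (ρ - y) ≤ ρ ^ 2 - y ^ 2 := by nlinarith [hy.1]
    rw [weight, if_pos (by nlinarith)]
    refine (Real.rpow_le_rpow_of_nonpos (by positivity) h1 (by linarith)).trans ?_
    rw [Real.mul_rpow (by norm_num) h2.le]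
    gcongr
    rw [one_div, Real.inv_rpow zero_le_two, ← Real.rpow_neg zero_le_two, neg_neg]
    calc (2 : ℝ) ^ β ≤ 2 ^ (1 : ℝ) := Real.rpow_le_rpow_of_exponent_le one_le_two hβ1.le
      _ = 2 := Real.rpow_one 2
  · rw [intervalIntegral.integral_const_mul, hI]
    exact le_of_eq (by ring)

end Barrier

/-! ### Barriers of finite energy -/

section Barrier

variable {n : ℕ} {γ : ℝ}

theorem potential_nonneg (hγ : 0 < γ) (t : ℝ) : 0 ≤ potential γ t := by
  unfold potential; split_ifs with h
  · positivity
  · exact le_rfl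

theorem potential_anti (hγ : 0 < γ) {s t : ℝ} (hs : 0 < s) (hst : s ≤ t) :
    potential γ t ≤ potential γ s := by
  rw [potential, potential, if_pos hs, if_pos (hs.trans_le hst)]
  have := Real.rpow_le_rpow_of_nonpos hs hst (neg_nonpos.2 hγ.le)
  gcongr

theorem measurable_potential (γ : ℝ) : Measurable (potential γ) :=
  Measurable.ite measurableSet_Ioi (measurable_const.mul (measurable_id.pow_const _))
    measurable_const

/-- The exponent of the barriers. -/
def barrierExp (γ : ℝ) : ℝ := 2 / (2 + γ)

/-- The exponent of the blow-up of the energy density of the barriers. -/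
def barrierDecay (γ : ℝ) : ℝ := 2 * γ / (2 + γ)

theorem barrierExp_pos (hγ : 0 < γ) : 0 < barrierExp γ := by unfold barrierExp; positivity

theorem barrierExp_le_one (hγ : 0 < γ) : barrierExp γ ≤ 1 := by
  rw [barrierExp, div_le_one (by linarith)]; linarith

theorem barrierDecay_pos (hγ : 0 < γ) : 0 < barrierDecay γ := by unfold barrierDecay; positivity

/-- The condition `γ < 2` enters here: it makes the energy density of a barrier integrable up to the
sphere where the barrier vanishes. -/
theorem barrierDecay_lt_one (hγ : 0 < γ) (hγ2 : γ < 2) : barrierDecay γ < 1 := by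
  rw [barrierDecay, div_lt_one (by linarith)]; linarith

/-- The exponent `α = 2 / (2 + γ)` solves `2 (α - 1) = -γ α`, so the squared gradient has the same
singularity as the potential in `potential_posPow`. -/
theorem dposPow_sq_le (hγ : 0 < γ) (s : ℝ) :
    dposPow (barrierExp γ) s ^ 2 ≤ weight (barrierDecay γ) s := by
  unfold dposPow weight
  split_ifs with hs
  · have h1 := barrierExp_pos hγ
    have h2 := barrierExp_le_one hγ
    have h3 : (s ^ (barrierExp γ - 1)) ^ 2 = s ^ (-barrierDecay γ) := by
      rw [← Real.rpow_natCast, ← Real.rpow_mul hs.le]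
      congr 1
      unfold barrierExp barrierDecay
      push_cast
      field_simp
      ring
    rw [mul_pow, h3]
    exact mul_le_of_le_one_left (by positivity) (pow_le_one₀ h1.le h2)
  · simp

theorem potential_posPow (hγ : 0 < γ) (s : ℝ) :
    potential γ (posPow (barrierExp γ) s) = 1 / γ * weight (barrierDecay γ) s := by
  have h1 := barrierExp_pos hγ
  rcases lt_or_ge 0 s with hs | hs
  · have hp : 0 < posPow (barrierExp γ) s := by
      rw [posPow, max_eq_left hs.le]; positivity
    rw [potential, if_pos hp, weight, if_pos hs, posPow, max_eq_left hs.le, ← Real.rpow_mul hs.le]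
    congr 2
    unfold barrierExp barrierDecay
    field_simp
  · rw [posPow, max_eq_right hs, Real.zero_rpow h1.ne', potential, if_neg (lt_irrefl _), weight,
      if_neg (not_lt.2 hs), mul_zero]

theorem gradient_norm_sq_sub (c : ℝ) (x : EuclideanSpace ℝ (Fin n)) :
    gradient (fun y => ‖y‖ ^ 2 - c) x = (2 : ℝ) • x := by
  refine HasGradientAt.gradient ?_
  rw [hasGradientAt_iff_hasFDerivAt]
  refine ((hasStrictFDerivAt_norm_sq x).hasFDerivAt.sub_const c).congr_fderiv ?_
  ext y
  simp

theorem gradient_sub_norm_sq (c : ℝ) (x : EuclideanSpace ℝ (Fin n)) :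
    gradient (fun y => c - ‖y‖ ^ 2) x = (-2 : ℝ) • x := by
  refine HasGradientAt.gradient ?_
  rw [hasGradientAt_iff_hasFDerivAt]
  refine ((hasStrictFDerivAt_norm_sq x).hasFDerivAt.const_sub c).congr_fderiv ?_
  ext y
  simp

/-- The barrier `((|x|² - r²)₊) ^ α`. -/
def innerBarrier (γ r : ℝ) (x : EuclideanSpace ℝ (Fin n)) : ℝ :=
  posPow (barrierExp γ) (‖x‖ ^ 2 - r ^ 2)

/-- The gradient of `innerBarrier`. -/
def innerBarrierGrad (γ r : ℝ) (x : EuclideanSpace ℝ (Fin n)) : EuclideanSpace ℝ (Fin n) :=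
  dposPow (barrierExp γ) (‖x‖ ^ 2 - r ^ 2) • gradient (fun y => ‖y‖ ^ 2 - r ^ 2) x

/-- The barrier `((ρ² - |x|²)₊) ^ α`. -/
def outerBarrier (γ ρ : ℝ) (x : EuclideanSpace ℝ (Fin n)) : ℝ :=
  posPow (barrierExp γ) (ρ ^ 2 - ‖x‖ ^ 2)

/-- The gradient of `outerBarrier`. -/
def outerBarrierGrad (γ ρ : ℝ) (x : EuclideanSpace ℝ (Fin n)) : EuclideanSpace ℝ (Fin n) :=
  dposPow (barrierExp γ) (ρ ^ 2 - ‖x‖ ^ 2) • gradient (fun y => ρ ^ 2 - ‖y‖ ^ 2) x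

theorem posPow_nonneg (α s : ℝ) : 0 ≤ posPow α s := Real.rpow_nonneg (le_max_right _ _) _

theorem posPow_of_nonpos {α s : ℝ} (hα : 0 < α) (hs : s ≤ 0) : posPow α s = 0 := by
  rw [posPow, max_eq_right hs, Real.zero_rpow hα.ne']

theorem posPow_mono {α s t : ℝ} (hα : 0 < α) (h : s ≤ t) : posPow α s ≤ posPow α t :=
  Real.rpow_le_rpow (le_max_right _ _) (max_le_max_right _ h) hα.le

theorem posPow_pos {α s : ℝ} (hs : 0 < s) : 0 < posPow α s := by
  rw [posPow, max_eq_left hs.le]; positivity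

theorem norm_innerBarrierGrad_sq_le (hγ : 0 < γ) (r : ℝ) {x : EuclideanSpace ℝ (Fin n)}
    (hx : ‖x‖ ≤ 1) :
    ‖innerBarrierGrad γ r x‖ ^ 2 ≤ 4 * weight (barrierDecay γ) (‖x‖ ^ 2 - r ^ 2) := by
  rw [innerBarrierGrad, gradient_norm_sq_sub, norm_smul, norm_smul, mul_pow, mul_pow,
    Real.norm_eq_abs, sq_abs]
  have h1 := dposPow_sq_le hγ (‖x‖ ^ 2 - r ^ 2)
  have h2 : ‖x‖ ^ 2 ≤ 1 := pow_le_one₀ (norm_nonneg _) hx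
  have h3 : ‖(2 : ℝ)‖ ^ 2 = 4 := by norm_num
  rw [h3]
  nlinarith [sq_nonneg (dposPow (barrierExp γ) (‖x‖ ^ 2 - r ^ 2)),
    weight_nonneg (barrierDecay γ) (‖x‖ ^ 2 - r ^ 2)]

theorem norm_outerBarrierGrad_sq_le (hγ : 0 < γ) (ρ : ℝ) {x : EuclideanSpace ℝ (Fin n)}
    (hx : ‖x‖ ≤ 1) :
    ‖outerBarrierGrad γ ρ x‖ ^ 2 ≤ 4 * weight (barrierDecay γ) (ρ ^ 2 - ‖x‖ ^ 2) := by
  rw [outerBarrierGrad, gradient_sub_norm_sq, norm_smul, norm_smul, mul_pow, mul_pow,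
    Real.norm_eq_abs, sq_abs]
  have h1 := dposPow_sq_le hγ (ρ ^ 2 - ‖x‖ ^ 2)
  have h2 : ‖x‖ ^ 2 ≤ 1 := pow_le_one₀ (norm_nonneg _) hx
  have h3 : ‖(-2 : ℝ)‖ ^ 2 = 4 := by norm_num
  rw [h3]
  nlinarith [sq_nonneg (dposPow (barrierExp γ) (ρ ^ 2 - ‖x‖ ^ 2)),
    weight_nonneg (barrierDecay γ) (ρ ^ 2 - ‖x‖ ^ 2)]

/-- The constant in the energy bounds for the barriers. -/
def barrierConst (n : ℕ) (γ : ℝ) : ℝ≥0∞ :=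
  ENNReal.ofReal (4 + 1 / γ) * annulusConst n (barrierDecay γ)

theorem barrierConst_ne_top (n : ℕ) (γ : ℝ) : barrierConst n γ ≠ ⊤ :=
  ENNReal.mul_ne_top ENNReal.ofReal_ne_top (annulusConst_ne_top _ _)

/-- In `hfg` the `4` comes from `|∇|x|²|² ≤ 4` on the unit ball and `1 / γ` from the potential. -/
theorem lintegral_barrier_le {S : Set (EuclideanSpace ℝ (Fin n))} (hS : MeasurableSet S)
    (hS1 : S ⊆ Metric.ball 0 1) (hγ : 0 < γ) {f g : EuclideanSpace ℝ (Fin n) → ℝ} {c : ℝ≥0∞}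
    (hfg : ∀ x, ‖x‖ ≤ 1 → f x ≤ 4 * g x + 1 / γ * g x)
    (hc : ∫⁻ x in S, ENNReal.ofReal (g x) ≤ annulusConst n (barrierDecay γ) * c) :
    ∫⁻ x in S, ENNReal.ofReal (f x) ≤ barrierConst n γ * c := by
  rw [barrierConst, mul_assoc]
  refine le_trans ?_ (mul_le_mul_right hc _)
  rw [← lintegral_const_mul' _ _ ENNReal.ofReal_ne_top]
  refine setLIntegral_mono' hS fun x hx => ?_
  rw [← ENNReal.ofReal_mul (by positivity)]
  refine ENNReal.ofReal_le_ofReal ((hfg x ?_).trans_eq (by ring))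
  have := hS1 hx
  rw [mem_ball_zero_iff] at this
  exact this.le

theorem lintegral_innerBarrier_le (hn : 1 ≤ n) (hγ : 0 < γ) (hγ2 : γ < 2) {r ρ : ℝ}
    (hr : 1 / 2 ≤ r) (hrρ : r ≤ ρ) (hρ : ρ ≤ 1) :
    ∫⁻ x in Metric.ball (0 : EuclideanSpace ℝ (Fin n)) ρ \ Metric.ball 0 r,
      ENNReal.ofReal (‖innerBarrierGrad γ r x‖ ^ 2 + potential γ (innerBarrier γ r x)) ≤
        barrierConst n γ * ENNReal.ofReal ((ρ - r) ^ (1 - barrierDecay γ)) :=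
  lintegral_barrier_le (measurableSet_ball.diff measurableSet_ball)
    (sdiff_subset.trans (Metric.ball_subset_ball hρ)) hγ
    (fun _ hx => add_le_add (norm_innerBarrierGrad_sq_le hγ r hx) (potential_posPow hγ _).le)
    (setLIntegral_weight_inner_le hn (barrierDecay_pos hγ) (barrierDecay_lt_one hγ hγ2) hr hrρ hρ)

theorem lintegral_outerBarrier_le (hn : 1 ≤ n) (hγ : 0 < γ) (hγ2 : γ < 2) {r ρ : ℝ}
    (hr : 0 ≤ r) (hrρ : r ≤ ρ) (hρ2 : 1 / 2 ≤ ρ) (hρ : ρ ≤ 1) :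
    ∫⁻ x in Metric.ball (0 : EuclideanSpace ℝ (Fin n)) ρ \ Metric.ball 0 r,
      ENNReal.ofReal (‖outerBarrierGrad γ ρ x‖ ^ 2 + potential γ (outerBarrier γ ρ x)) ≤
        barrierConst n γ * ENNReal.ofReal ((ρ - r) ^ (1 - barrierDecay γ)) :=
  lintegral_barrier_le (measurableSet_ball.diff measurableSet_ball)
    (sdiff_subset.trans (Metric.ball_subset_ball hρ)) hγ
    (fun _ hx => add_le_add (norm_outerBarrierGrad_sq_le hγ ρ hx) (potential_posPow hγ _).le)
    (setLIntegral_weight_outer_le hn (barrierDecay_pos hγ) (barrierDecay_lt_one hγ hγ2)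
      hr hrρ hρ2 hρ)

/-- `S` is the annulus carrying the barrier. On the rest of `K` the factor `dposPow` is zero, so the
energy bound over `S` suffices. -/
theorem memLp_dposPow_mul {q : EuclideanSpace ℝ (Fin n) → ℝ} (hq : ContDiff ℝ 1 q) {α : ℝ}
    {S K : Set (EuclideanSpace ℝ (Fin n))} (hS : MeasurableSet S) (hKm : MeasurableSet K)
    (h0 : ∀ x ∈ K, x ∉ S → q x ≤ 0) {c : ℝ≥0∞} (hc : c ≠ ⊤)
    (h : ∫⁻ x in S, ENNReal.ofReal (‖dposPow α (q x) • gradient q x‖ ^ 2) ≤ c) :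
    MemLp (fun x => dposPow α (q x) * ‖gradient q x‖) 2 (volume.restrict K) := by
  have hgrad : Continuous (gradient q) :=
    (InnerProductSpace.toDual ℝ _).symm.continuous.comp (hq.continuous_fderiv (by simp))
  have hdm : Measurable (dposPow α) :=
    Measurable.ite measurableSet_Ioi (measurable_const.mul (measurable_id.pow_const _))
      measurable_const
  refine ⟨((hdm.comp hq.continuous.measurable).mul hgrad.norm.measurable).aestronglyMeasurable, ?_⟩
  suffices hs : ∫⁻ x in K, ‖dposPow α (q x) * ‖gradient q x‖‖ₑ ^ 2 < ⊤ by
    rw [← eLpNorm_two_sq, ENNReal.pow_lt_top_iff] at hs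
    simpa using hs
  refine lt_of_le_of_lt ?_ (h.trans_lt hc.lt_top)
  rw [← lintegral_indicator hKm, ← lintegral_indicator hS]
  refine lintegral_mono fun x => ?_
  by_cases hxK : x ∈ K
  · rw [indicator_of_mem hxK]
    by_cases hxS : x ∈ S
    · rw [indicator_of_mem hxS, ENNReal.ofReal_pow (norm_nonneg _), ofReal_norm]
      refine pow_le_pow_left' (enorm_le_iff_norm_le.2 ?_) 2
      rw [norm_smul, norm_mul, norm_norm]
    · rw [dposPow, if_neg (not_lt.2 (h0 x hxK hxS)), zero_mul]
      simp
  · rw [indicator_of_notMem hxK]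
    exact zero_le

theorem isH1Loc_innerBarrier (hn : 1 ≤ n) (hγ : 0 < γ) (hγ2 : γ < 2) {r : ℝ}
    (hr : 1 / 2 ≤ r) (hr1 : r ≤ 1) :
    IsH1Loc (Metric.ball (0 : EuclideanSpace ℝ (Fin n)) 1) (innerBarrier γ r)
      (innerBarrierGrad γ r) := by
  have hq : ContDiff ℝ 1 fun x : EuclideanSpace ℝ (Fin n) => ‖x‖ ^ 2 - r ^ 2 :=
    (contDiff_norm_sq ℝ).sub contDiff_const
  refine IsH1Loc.posPow_comp Metric.isOpen_ball (barrierExp_pos hγ) (barrierExp_le_one hγ) hq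
    fun K hK hK1 => memLp_dposPow_mul hq (measurableSet_ball.diff measurableSet_ball)
      hK.measurableSet (fun x hx hxS => ?_)
      (ENNReal.mul_ne_top (barrierConst_ne_top n γ) ENNReal.ofReal_ne_top)
      (le_trans (lintegral_mono fun x => ENNReal.ofReal_le_ofReal ?_)
        (lintegral_innerBarrier_le hn hγ hγ2 hr hr1 le_rfl))
  · have hxr : ‖x‖ < r := by
      by_contra h
      exact hxS ⟨hK1 hx, by simpa using h⟩
    nlinarith [norm_nonneg x]
  · exact le_add_of_nonneg_right (potential_nonneg hγ _)

theorem isH1Loc_outerBarrier (hn : 1 ≤ n) (hγ : 0 < γ) (hγ2 : γ < 2) {ρ : ℝ}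
    (hρ : 1 / 2 ≤ ρ) (hρ1 : ρ ≤ 1) :
    IsH1Loc (Metric.ball (0 : EuclideanSpace ℝ (Fin n)) 1) (outerBarrier γ ρ)
      (outerBarrierGrad γ ρ) := by
  have hq : ContDiff ℝ 1 fun x : EuclideanSpace ℝ (Fin n) => ρ ^ 2 - ‖x‖ ^ 2 :=
    contDiff_const.sub (contDiff_norm_sq ℝ)
  refine IsH1Loc.posPow_comp Metric.isOpen_ball (barrierExp_pos hγ) (barrierExp_le_one hγ) hq
    fun K hK hK1 => memLp_dposPow_mul hq (measurableSet_ball.diff measurableSet_ball)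
      hK.measurableSet (fun x hx hxS => ?_)
      (ENNReal.mul_ne_top (barrierConst_ne_top n γ) ENNReal.ofReal_ne_top)
      (le_trans (lintegral_mono fun x => ENNReal.ofReal_le_ofReal ?_)
        (lintegral_outerBarrier_le hn hγ hγ2 le_rfl (by linarith) hρ hρ1))
  · have hxr : ρ ≤ ‖x‖ := by
      by_contra h
      exact hxS ⟨by simpa using h, by simp⟩
    nlinarith [norm_nonneg x]
  · exact le_add_of_nonneg_right (potential_nonneg hγ _)

end Barrier

/-! ### Gluing of competitors -/

section Gluing

variable {n : ℕ} {γ : ℝ} {Ω S T K B : Set (EuclideanSpace ℝ (Fin n))}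
  {u v a b : EuclideanSpace ℝ (Fin n) → ℝ}
  {G H Da Db : EuclideanSpace ℝ (Fin n) → EuclideanSpace ℝ (Fin n)}

theorem IsH1Loc.aemeasurable_density (hu : IsH1Loc Ω u G) (γ : ℝ) (hS : S ⊆ Ω) :
    AEMeasurable (fun x => ENNReal.ofReal (1 / 2 * ‖G x‖ ^ 2 + potential γ (u x)))
      (volume.restrict S) := by
  have h1 := (hu.aestronglyMeasurable.mono_measure (Measure.restrict_mono hS le_rfl)).aemeasurable
  have h2 := (hu.aestronglyMeasurable_grad.mono_measure
    (Measure.restrict_mono hS le_rfl)).norm.aemeasurable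
  exact (((h2.pow_const 2).const_mul _).add
    ((measurable_potential γ).comp_aemeasurable h1)).ennreal_ofReal

theorem energy_congr (hu : u =ᵐ[volume.restrict S] v) (hG : G =ᵐ[volume.restrict S] H) :
    energy γ S u G = energy γ S v H := by
  refine lintegral_congr_ae ?_
  filter_upwards [hu, hG] with x h1 h2
  rw [h1, h2]

theorem energy_mono_set (h : S ⊆ T) : energy γ S u G ≤ energy γ T u G :=
  lintegral_mono_set h

theorem energy_add_sdiff (hS : MeasurableSet S) (h : S ⊆ T) :
    energy γ S u G + energy γ (T \ S) u G = energy γ T u G := by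
  have := lintegral_inter_add_sdiff
    (fun x => ENNReal.ofReal (1 / 2 * ‖G x‖ ^ 2 + potential γ (u x))) (μ := volume) T hS
  rwa [inter_eq_self_of_subset_right h] at this

theorem IsH1Loc.energy_congr (hu : IsH1Loc Ω u G) (hv : IsH1Loc Ω v H) (hS : IsOpen S)
    (hSΩ : S ⊆ Ω) (h : u =ᵐ[volume.restrict S] v) : energy γ S u G = energy γ S v H :=
  AltPhillips.energy_congr h ((hu.1.mono hSΩ).ae_eq_of_ae_eq hS (hv.1.mono hSΩ) h)

theorem density_add_le {x y : EuclideanSpace ℝ (Fin n)} {s t q : ℝ}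
    (h : potential γ t ≤ potential γ s + q) :
    1 / 2 * ‖x + y‖ ^ 2 + potential γ t ≤
      (1 / 2 * ‖x‖ ^ 2 + potential γ s) + (‖x‖ * ‖y‖ + 1 / 2 * ‖y‖ ^ 2 + q) := by
  have h1 := norm_add_le x y
  have h2 : ‖x + y‖ ^ 2 ≤ (‖x‖ + ‖y‖) ^ 2 := by gcongr
  nlinarith

/-- Comparison of `u` with `min (max u v) (v + a) (u + b)`, which agrees with `v` in `B` and with
`u` outside `K`. -/
theorem energy_le_of_glue (hΩ : IsOpen Ω) (hB : IsOpen B) (hBK : B ⊆ K)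
    (hKΩ : K ⊆ Ω) (hu : IsH1Loc Ω u G) (hv : IsH1Loc Ω v H) (ha : IsH1Loc Ω a Da)
    (hb : IsH1Loc Ω b Db) (hu0 : ∀ᵐ x ∂(volume.restrict Ω), 0 ≤ u x)
    (hv0 : ∀ᵐ x ∂(volume.restrict Ω), 0 ≤ v x) (ha0 : ∀ᵐ x ∂(volume.restrict Ω), 0 ≤ a x)
    (hb0 : ∀ᵐ x ∂(volume.restrict Ω), 0 ≤ b x)
    (haB : ∀ᵐ x ∂(volume.restrict B), a x = 0)
    (hbB : ∀ᵐ x ∂(volume.restrict B), v x ≤ u x + b x)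
    (hbK : ∀ᵐ x ∂(volume.restrict (Ω \ K)), b x = 0)
    (haK : ∀ᵐ x ∂(volume.restrict (Ω \ K)), u x ≤ v x + a x)
    {q : EuclideanSpace ℝ (Fin n) → ℝ}
    (hq : ∀ᵐ x ∂(volume.restrict (K \ B)),
      potential γ (u x + b x) ≤ potential γ (u x) + q x)
    (hfin : energy γ K u G < ⊤)
    (hmin : ∀ (w : EuclideanSpace ℝ (Fin n) → ℝ)
        (D : EuclideanSpace ℝ (Fin n) → EuclideanSpace ℝ (Fin n)), IsH1Loc Ω w D →
        (∀ᵐ x ∂(volume.restrict Ω), 0 ≤ w x) →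
        (∀ᵐ x ∂(volume.restrict (Ω \ K)), w x = u x) →
        energy γ K u G ≤ energy γ K w D) :
    energy γ B u G ≤ energy γ B v H + (energy γ (K \ B) v H +
      (energy γ (K \ B) (fun x => v x + a x) (fun x => H x + Da x) +
        ∫⁻ x in K \ B, ENNReal.ofReal (‖G x‖ * ‖Db x‖ + 1 / 2 * ‖Db x‖ ^ 2 + q x))) := by
  have hBΩ := hBK.trans hKΩ
  have hAΩ : K \ B ⊆ Ω := sdiff_subset.trans hKΩ
  have hva := hv.add ha
  have hub := hu.add hb
  -- Only lattice operations are used, so value and gradient of `w` at a point are those of one of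
  -- `u`, `v`, `v + a`, `u + b`.
  have hw := ((hu.max hΩ hv).min hΩ hva).min hΩ hub
  set w := fun x => min (min (max (u x) (v x)) (v x + a x)) (u x + b x) with hwdef
  set D := fun x => if u x + b x < min (max (u x) (v x)) (v x + a x) then G x + Db x else
    if v x + a x < max (u x) (v x) then H x + Da x else if u x < v x then H x else G x with hDdef
  have hw0 : ∀ᵐ x ∂(volume.restrict Ω), 0 ≤ w x := by
    filter_upwards [hu0, hv0, ha0, hb0] with x h1 h2 h3 h4
    exact le_min (le_min (le_max_of_le_left h1) (add_nonneg h2 h3)) (add_nonneg h1 h4)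
  have hwK : ∀ᵐ x ∂(volume.restrict (Ω \ K)), w x = u x := by
    filter_upwards [hbK, haK] with x h1 h2
    simp only [hwdef, h1, add_zero]
    exact min_eq_right (le_min (le_max_left _ _) h2)
  have hwB : w =ᵐ[volume.restrict B] v := by
    filter_upwards [haB, hbB] with x h1 h2
    simp only [hwdef, h1, add_zero]
    rw [min_eq_right (le_max_right _ _), min_eq_left h2]
  have hmw := hmin w D hw hw0 hwK
  rw [← energy_add_sdiff hB.measurableSet hBK, ← energy_add_sdiff hB.measurableSet hBK,
    hw.energy_congr hv hB hBΩ hwB] at hmw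
  -- One of four densities occurs at each point; that of `u + b` is at most that of `u` plus the
  -- cross terms and `q`.
  have hA : energy γ (K \ B) w D ≤ energy γ (K \ B) u G + (energy γ (K \ B) v H +
      (energy γ (K \ B) (fun x => v x + a x) (fun x => H x + Da x) +
        ∫⁻ x in K \ B, ENNReal.ofReal (‖G x‖ * ‖Db x‖ + 1 / 2 * ‖Db x‖ ^ 2 + q x))) := by
    unfold energy
    rw [← lintegral_add_left' (hva.aemeasurable_density γ hAΩ),
      ← lintegral_add_left' (hv.aemeasurable_density γ hAΩ),
      ← lintegral_add_left' (hu.aemeasurable_density γ hAΩ)]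
    refine lintegral_mono_ae ?_
    filter_upwards [hq] with x hx
    simp only [hwdef, hDdef]
    split_ifs with h1 h2 h3
    · rw [min_eq_right h1.le]
      refine (ENNReal.ofReal_le_ofReal (density_add_le hx)).trans
        (ENNReal.ofReal_add_le.trans ?_)
      gcongr
      exact le_add_left (le_add_left le_rfl)
    · rw [min_eq_left (not_lt.1 h1), min_eq_right h2.le]
      exact le_add_left (le_add_left (le_add_right le_rfl))
    · rw [min_eq_left (not_lt.1 h1), min_eq_left (not_lt.1 h2), max_eq_right h3.le]
      exact le_add_left (le_add_right le_rfl)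
    · rw [min_eq_left (not_lt.1 h1), min_eq_left (not_lt.1 h2), max_eq_left (not_lt.1 h3)]
      exact le_add_right le_rfl
  have hAfin : energy γ (K \ B) u G ≠ ⊤ :=
    ((energy_mono_set sdiff_subset).trans_lt hfin).ne
  -- The energy of `u` in `K \ B` stands on both sides and is finite, so it cancels.
  refine (ENNReal.add_le_add_iff_right hAfin).1 (hmw.trans ((add_le_add_right hA _).trans_eq ?_))
  ring

/-- A difference vanishing off a compact set lies in `H¹₀`, so local competitors are Dirichlet
competitors, and the finite energy off `K` cancels. -/
theorem IsDirichletMinimizer.isMinimizer (hΩ : IsOpen Ω) (h : IsDirichletMinimizer γ Ω u) :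
    IsMinimizer γ Ω u := by
  obtain ⟨G, hu, hu0, hfin, hmin⟩ := h
  refine ⟨G, hu.isH1Loc, hu0, fun K hK hKΩ =>
    ⟨(energy_mono_set hKΩ).trans_lt hfin, fun v H hv hv0 hvu => ?_⟩⟩
  have hd := hv.sub hu.isH1Loc
  obtain ⟨hd1, φ, hφ⟩ := hd.exists_testFunction hΩ hK hKΩ (by
    filter_upwards [hvu] with x hx
    rw [hx, sub_self])
  have hvH1 : IsH1 Ω v H :=
    ⟨hv.1, (hd1.2.add hu.2).ae_eq (Eventually.of_forall fun x => by simp),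
      (hd1.3.add hu.3).ae_eq (Eventually.of_forall fun x => by simp)⟩
  have hle := hmin v H hvH1 hv0 ⟨_, hd1, φ, hφ⟩
  have hout := hv.energy_congr (γ := γ) hu.isH1Loc (hΩ.sdiff hK.isClosed) sdiff_subset hvu
  rw [← energy_add_sdiff hK.measurableSet hKΩ, ← energy_add_sdiff hK.measurableSet hKΩ, hout]
    at hle
  exact (ENNReal.add_le_add_iff_right
    ((energy_mono_set sdiff_subset).trans_lt hfin).ne).1 hle

end Gluing

/-! ### Weak compactness and lower semicontinuity -/

section Compactness

/-- Banach–Alaoglu in the dual space; an ultrafilter takes the place of a weakly convergent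
subsequence. -/
theorem exists_ultrafilter_tendsto_inner {F : Type*} [NormedAddCommGroup F]
    [InnerProductSpace ℝ F] [CompleteSpace F] {f : ℕ → F} {R : ℝ} (hf : ∀ k, ‖f k‖ ≤ R) :
    ∃ 𝒰 : Ultrafilter ℕ, (𝒰 : Filter ℕ) ≤ atTop ∧ ∃ g₀ : F, ∀ g : F,
      Tendsto (fun k => inner ℝ (f k) g) 𝒰 (𝓝 (inner ℝ g₀ g)) := by
  have hc := WeakDual.isCompact_closedBall (𝕜 := ℝ) (0 : StrongDual ℝ F) R
  let Φ : ℕ → WeakDual ℝ F := fun k =>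
    StrongDual.toWeakDual (InnerProductSpace.toDual ℝ F (f k))
  obtain ⟨ℓ, -, hℓ⟩ := hc.ultrafilter_le_nhds ((Ultrafilter.of atTop).map Φ) (by
    rw [le_principal_iff]
    refine Ultrafilter.mem_map.2 (Eventually.of_forall fun k => ?_)
    change InnerProductSpace.toDual ℝ F (f k) ∈ Metric.closedBall 0 R
    rw [mem_closedBall_zero_iff, LinearIsometryEquiv.norm_map]
    exact hf k)
  refine ⟨Ultrafilter.of atTop, Ultrafilter.of_le _,
    (InnerProductSpace.toDual ℝ F).symm (WeakDual.toStrongDual ℓ), fun g => ?_⟩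
  have h1 : Tendsto Φ ((Ultrafilter.of atTop : Ultrafilter ℕ) : Filter ℕ) (𝓝 ℓ) := hℓ
  have h2 := ((WeakDual.eval_continuous g).tendsto ℓ).comp h1
  rw [InnerProductSpace.toDual_symm_apply]
  exact h2

variable {n : ℕ} {γ : ℝ} {U : Set (EuclideanSpace ℝ (Fin n))}
  {u : EuclideanSpace ℝ (Fin n) → ℝ} {w : ℕ → EuclideanSpace ℝ (Fin n) → ℝ}
  {D : ℕ → EuclideanSpace ℝ (Fin n) → EuclideanSpace ℝ (Fin n)}

/-- The potential blows up at `0` from the right but has the value `0` there. It is thus only lower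
semicontinuous, which is the direction Fatou's lemma needs. -/
theorem potential_le_liminf {s : ℕ → ℝ} {t : ℝ} (h : Tendsto s atTop (𝓝 t)) :
    ENNReal.ofReal (potential γ t) ≤
      liminf (fun j => ENNReal.ofReal (potential γ (s j))) atTop := by
  rcases lt_or_ge 0 t with ht | ht
  · have h1 : ContinuousAt (potential γ) t := by
      have h2 : ContinuousAt (fun t : ℝ => (1 / γ) * t ^ (-γ)) t :=
        continuousAt_const.mul (Real.continuousAt_rpow_const _ _ (Or.inl ht.ne'))
      refine h2.congr ?_
      filter_upwards [lt_mem_nhds ht] with y hy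
      rw [potential, if_pos hy]
    exact ((ENNReal.continuous_ofReal.tendsto _).comp (h1.tendsto.comp h)).liminf_eq.ge
  · rw [potential, if_neg (not_lt.2 ht), ENNReal.ofReal_zero]
    exact zero_le

theorem energy_eq_add (hγ : 0 < γ) {S : Set (EuclideanSpace ℝ (Fin n))}
    {G : EuclideanSpace ℝ (Fin n) → EuclideanSpace ℝ (Fin n)}
    (hG : AEStronglyMeasurable G (volume.restrict S)) :
    energy γ S u G = 2⁻¹ * eLpNorm G 2 (volume.restrict S) ^ 2 +
      ∫⁻ x in S, ENNReal.ofReal (potential γ (u x)) := by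
  rw [eLpNorm_two_sq, ← lintegral_const_mul' _ _ (by simp),
    ← lintegral_add_left' ((hG.enorm.pow_const 2).const_mul _)]
  refine lintegral_congr fun x => ?_
  rw [ENNReal.ofReal_add (by positivity) (potential_nonneg hγ _), ENNReal.ofReal_mul (by norm_num),
    ENNReal.ofReal_pow (norm_nonneg _), ofReal_norm, one_div, ENNReal.ofReal_inv_of_pos two_pos]
  simp

/-- Uniform convergence identifies the weak `L²` limit of the gradients as a gradient of `u`. The
Dirichlet part is lower semicontinuous by expanding a square, the potential part by Fatou. -/
theorem exists_weakGradient_energy_le (hγ : 0 < γ) (hU : IsOpen U)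
    (h : ∀ k, HasWeakGradient U (w k) (D k)) {C : ℝ≥0∞} (hC : C ≠ ⊤)
    (hE : ∀ k, energy γ U (w k) (D k) ≤ C) (hw : TendstoUniformlyOn w u atTop U) :
    ∃ G, HasWeakGradient U u G ∧ MemLp G 2 (volume.restrict U) ∧ energy γ U u G ≤ C := by
  have hDm : ∀ k, AEStronglyMeasurable (D k) (volume.restrict U) := fun k =>
    (h k).locallyIntegrable_grad.aestronglyMeasurable
  have hwm : ∀ k, AEStronglyMeasurable (w k) (volume.restrict U) := fun k =>
    (h k).locallyIntegrable.aestronglyMeasurable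
  have hum : AEStronglyMeasurable u (volume.restrict U) := by
    refine aestronglyMeasurable_of_tendsto_ae atTop hwm ?_
    filter_upwards [ae_restrict_mem hU.measurableSet] with x hx
    exact hw.tendsto_at hx
  -- `1 + 2 * C` avoids a square root: a norm above `1` is at most its square.
  have hD2 : ∀ k, eLpNorm (D k) 2 (volume.restrict U) ≤ 1 + 2 * C := by
    intro k
    have h1 : 2⁻¹ * eLpNorm (D k) 2 (volume.restrict U) ^ 2 ≤ C :=
      le_trans (by rw [energy_eq_add hγ (hDm k)]; exact le_self_add) (hE k)
    have h2 : eLpNorm (D k) 2 (volume.restrict U) ^ 2 ≤ 2 * C := by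
      rwa [ENNReal.inv_mul_le_iff two_ne_zero (by simp)] at h1
    rcases le_total (eLpNorm (D k) 2 (volume.restrict U)) 1 with h3 | h3
    · exact h3.trans le_self_add
    · refine le_trans ?_ (h2.trans le_add_self)
      rw [sq]
      exact le_mul_of_one_le_left' h3
  have hCt : 1 + 2 * C ≠ ⊤ := by finiteness
  have hDL : ∀ k, MemLp (D k) 2 (volume.restrict U) := fun k =>
    ⟨hDm k, (hD2 k).trans_lt hCt.lt_top⟩
  obtain ⟨𝒰, h𝒰, g₀, hg₀⟩ := exists_ultrafilter_tendsto_inner (f := fun k => (hDL k).toLp)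
    (R := (1 + 2 * C).toReal) (fun k => by
      rw [Lp.norm_toLp]
      exact ENNReal.toReal_mono hCt (hD2 k))
  have hul : LocallyIntegrableOn u U volume := by
    obtain ⟨k, hk⟩ := ((Metric.tendstoUniformlyOn_iff.1 hw) 1 one_pos).exists
    rw [locallyIntegrableOn_iff hU.isLocallyClosed]
    intro K hKU hK
    have h1 : IntegrableOn (w k) K volume :=
      (h k).locallyIntegrable.integrableOn_compact_subset hKU hK
    have h2 : IntegrableOn (fun _ : EuclideanSpace ℝ (Fin n) => (1 : ℝ)) K volume :=
      integrableOn_const hK.measure_lt_top.ne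
    refine (h1.norm.add h2).mono' (hum.mono_measure (Measure.restrict_mono hKU le_rfl)) ?_
    refine (ae_restrict_iff' hK.measurableSet).2 (Eventually.of_forall fun x hx => ?_)
    have h3 := hk x (hKU hx)
    rw [Real.dist_eq, ← Real.norm_eq_abs] at h3
    have h4 := norm_add_le (u x - w k x) (w k x)
    rw [sub_add_cancel] at h4
    simp only [Pi.add_apply]
    linarith
  have hwg : HasWeakGradient U u g₀ := by
    refine ⟨hul, ?_, fun φ hφ e => ?_⟩
    · refine locallyIntegrableOn_of_memLp hU fun K hK hKU => ?_
      exact (Lp.memLp g₀).mono_measure (Measure.restrict_mono hKU le_rfl)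
    · have i1 := fun k => ((h k).integrable_mul_fderiv hφ e).integrableOn (s := U)
      have i2 : IntegrableOn (fun x => u x * fderiv ℝ φ x e) U volume :=
        (integrable_mul_of_tsupport_subset hul (hφ.continuous_fderiv_apply e)
          (hφ.hasCompactSupport_fderiv_apply e)
          ((IsTestFunction.tsupport_fderiv_apply_subset φ e).trans hφ.support_subset)).integrableOn
      have t1 : Tendsto (fun k => ∫ x in U, w k x * fderiv ℝ φ x e) atTop
          (𝓝 (∫ x in U, u x * fderiv ℝ φ x e)) := by
        have h1 : Tendsto (fun k => ∫ x in U, (w k x - u x) * fderiv ℝ φ x e) atTop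
            (𝓝 (∫ x in U, (0 : ℝ))) := by
          refine tendsto_integral_filter_of_dominated_convergence (fun x => ‖fderiv ℝ φ x e‖)
            (Eventually.of_forall fun k => ((hwm k).sub hum).mul
              (hφ.continuous_fderiv_apply e).aestronglyMeasurable) ?_ ?_ ?_
          · filter_upwards [(Metric.tendstoUniformlyOn_iff.1 hw) 1 one_pos] with k hk
            filter_upwards [ae_restrict_mem hU.measurableSet] with x hx
            rw [norm_mul]
            refine mul_le_of_le_one_left (norm_nonneg _) ?_
            have := hk x hx
            rw [dist_comm, dist_eq_norm] at this
            exact this.le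
          · exact (((hφ.continuous_fderiv_apply e).integrable_of_hasCompactSupport
              (hφ.hasCompactSupport_fderiv_apply e)).norm).integrableOn
          · filter_upwards [ae_restrict_mem hU.measurableSet] with x hx
            have := (hw.tendsto_at hx).sub_const (u x)
            rw [sub_self] at this
            simpa using this.mul_const (fderiv ℝ φ x e)
        have h2 := h1.add_const (∫ x in U, u x * fderiv ℝ φ x e)
        simp only [integral_zero, zero_add] at h2
        refine h2.congr fun k => ?_
        have i3 : Integrable (fun x => (w k x - u x) * fderiv ℝ φ x e) (volume.restrict U) := by
          simp only [sub_mul]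
          exact (i1 k).sub i2
        rw [← integral_add i3 i2]
        exact integral_congr_ae (Eventually.of_forall fun x => by ring)
      have hΦ : MemLp (fun x => φ x • e) 2 (volume.restrict U) :=
        ((hφ.smooth.continuous.smul continuous_const).memLp_of_hasCompactSupport
          hφ.compact.smul_right).restrict U
      have hin : ∀ (G : EuclideanSpace ℝ (Fin n) → EuclideanSpace ℝ (Fin n))
          (f : Lp (EuclideanSpace ℝ (Fin n)) 2 (volume.restrict U)), f =ᵐ[volume.restrict U] G →
          inner ℝ f hΦ.toLp = ∫ x in U, inner ℝ (G x) e * φ x := by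
        intro G f hf
        rw [L2.inner_def]
        refine integral_congr_ae ?_
        filter_upwards [hf, hΦ.coeFn_toLp] with x h1 h2
        rw [h1, h2, real_inner_smul_right, mul_comm]
      have t2 := hg₀ hΦ.toLp
      simp only [hin _ _ (hDL _).coeFn_toLp, hin g₀ g₀ EventuallyEq.rfl] at t2
      have t3 := (t1.mono_left h𝒰)
      simp only [(h _).integral_eq φ hφ e] at t3
      exact tendsto_nhds_unique t3 t2.neg
  refine ⟨g₀, hwg, Lp.memLp g₀, ?_⟩
  rw [energy_eq_add hγ (Lp.aestronglyMeasurable g₀)]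
  have hnorm : ∀ f : Lp (EuclideanSpace ℝ (Fin n)) 2 (volume.restrict U),
      2⁻¹ * eLpNorm f 2 (volume.restrict U) ^ 2 = ENNReal.ofReal (1 / 2 * ‖f‖ ^ 2) := by
    intro f
    rw [ENNReal.ofReal_mul (by norm_num), ENNReal.ofReal_pow (norm_nonneg _), ofReal_norm,
      Lp.enorm_def, one_div, ENNReal.ofReal_inv_of_pos two_pos]
    simp
  refine ENNReal.le_of_forall_pos_le_add fun δ hδ _ => ?_
  have hev : ∀ᶠ k in (𝒰 : Filter ℕ), ENNReal.ofReal (1 / 2 * ‖g₀‖ ^ 2) +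
      ∫⁻ x in U, ENNReal.ofReal (potential γ (w k x)) ≤ C + δ := by
    have h1 := (hg₀ g₀).eventually (lt_mem_nhds (show inner ℝ g₀ g₀ - δ < inner ℝ g₀ g₀ by
      simpa using hδ))
    filter_upwards [h1] with k hk
    rw [real_inner_self_eq_norm_sq] at hk
    have h2 : 1 / 2 * ‖g₀‖ ^ 2 ≤ 1 / 2 * ‖(hDL k).toLp‖ ^ 2 + δ := by
      have h3 := norm_sub_sq_real ((hDL k).toLp) g₀
      have h4 := sq_nonneg ‖(hDL k).toLp - g₀‖
      linarith
    have h3 := hE k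
    rw [energy_eq_add hγ (hDm k), ← eLpNorm_congr_ae (hDL k).coeFn_toLp, hnorm] at h3
    calc _ ≤ (ENNReal.ofReal (1 / 2 * ‖(hDL k).toLp‖ ^ 2) + δ) +
          ∫⁻ x in U, ENNReal.ofReal (potential γ (w k x)) := by
            gcongr
            refine (ENNReal.ofReal_le_ofReal h2).trans (ENNReal.ofReal_add_le.trans ?_)
            rw [ENNReal.ofReal_coe_nnreal]
      _ = (ENNReal.ofReal (1 / 2 * ‖(hDL k).toLp‖ ^ 2) +
          ∫⁻ x in U, ENNReal.ofReal (potential γ (w k x))) + δ := by ring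
      _ ≤ C + δ := by gcongr
  -- Fatou needs a sequence. The bound holds on a set of the ultrafilter, hence for infinitely many
  -- `k`.
  obtain ⟨ns, hns, hle⟩ := extraction_of_frequently_atTop (hev.frequently.filter_mono h𝒰)
  have hfatou : ∫⁻ x in U, ENNReal.ofReal (potential γ (u x)) ≤
      C + δ - ENNReal.ofReal (1 / 2 * ‖g₀‖ ^ 2) := by
    calc ∫⁻ x in U, ENNReal.ofReal (potential γ (u x))
        ≤ ∫⁻ x in U, liminf (fun j => ENNReal.ofReal (potential γ (w (ns j) x))) atTop := by
          refine lintegral_mono_ae ?_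
          filter_upwards [ae_restrict_mem hU.measurableSet] with x hx
          exact potential_le_liminf ((hw.tendsto_at hx).comp hns.tendsto_atTop)
      _ ≤ liminf (fun j => ∫⁻ x in U, ENNReal.ofReal (potential γ (w (ns j) x))) atTop :=
          lintegral_liminf_le' fun j =>
            ((measurable_potential γ).comp_aemeasurable (hwm _).aemeasurable).ennreal_ofReal
      _ ≤ _ := by
          refine liminf_le_of_frequently_le' (Frequently.of_forall fun j => ?_)
          exact ENNReal.le_sub_of_add_le_left ENNReal.ofReal_ne_top (hle j)
  rw [hnorm]
  refine (add_le_add_right hfatou _).trans_eq (add_tsub_cancel_of_le ?_)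
  exact le_self_add.trans (hle 0)

end Compactness

/-! ### Locally uniform energy bounds -/

section UniformBound

variable {n : ℕ} {γ : ℝ}

theorem exists_radial_cutoff (n : ℕ) {r ρ : ℝ} (hr : 0 < r) (hrρ : r < ρ) :
    ∃ θ : EuclideanSpace ℝ (Fin n) → ℝ, ContDiff ℝ ∞ θ ∧ (∀ x, 0 ≤ θ x) ∧ (∀ x, θ x ≤ 1) ∧
      (∀ x, ‖x‖ ≤ r → θ x = 0) ∧ (∀ x, ρ ≤ ‖x‖ → θ x = 1) ∧
      (∀ x, ‖x‖ < r → gradient θ x = 0) ∧ ∃ L, ∀ x, ‖gradient θ x‖ ≤ L := by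
  let f : ContDiffBump (0 : EuclideanSpace ℝ (Fin n)) := ⟨r, ρ, hr, hrρ⟩
  have hf : ContDiff ℝ ∞ (fun x => f x) := f.contDiff
  have hgrad : ∀ x, gradient (fun x => 1 - f x) x
      = (InnerProductSpace.toDual ℝ _).symm (- fderiv ℝ f x) := by
    intro x
    rw [gradient, fderiv_const_sub]
  refine ⟨fun x => 1 - f x, contDiff_const.sub hf, fun x => sub_nonneg.2 f.le_one,
    fun x => sub_le_self _ f.nonneg, fun x hx => ?_, fun x hx => ?_, fun x hx => ?_, ?_⟩
  · simp only [f.one_of_mem_closedBall (by simpa using hx : x ∈ Metric.closedBall 0 r), sub_self]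
  · simp only [f.zero_of_le_dist (by simpa using hx : ρ ≤ dist x 0), sub_zero]
  · have h1 : f =ᶠ[𝓝 x] fun _ => (1 : ℝ) := by
      filter_upwards [Metric.isOpen_ball.mem_nhds (show x ∈ Metric.ball 0 r by simpa using hx)]
        with y hy
      exact f.one_of_mem_closedBall (Metric.ball_subset_closedBall hy)
    rw [hgrad, h1.fderiv_eq]
    simp
  · obtain ⟨L, hL⟩ := (hf.continuous_fderiv (by simp)).bounded_above_of_compact_support
      (f.hasCompactSupport.fderiv ℝ)
    refine ⟨L, fun x => ?_⟩
    rw [hgrad, LinearIsometryEquiv.norm_map, norm_neg]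
    exact hL x

theorem closedBall_ae_eq_ball {ρ : ℝ} (hρ : ρ ≠ 0) :
    (Metric.closedBall (0 : EuclideanSpace ℝ (Fin n)) ρ : Set _) =ᵐ[volume] Metric.ball 0 ρ := by
  rw [ae_eq_set, Metric.closedBall_sdiff_ball, Measure.addHaar_sphere_of_ne_zero _ _ hρ]
  exact ⟨rfl, by rw [sdiff_eq_empty.2 Metric.ball_subset_closedBall, measure_empty]⟩

theorem restrict_closedBall_sdiff {ρ : ℝ} (hρ : ρ ≠ 0) (S : Set (EuclideanSpace ℝ (Fin n))) :
    volume.restrict (Metric.closedBall (0 : EuclideanSpace ℝ (Fin n)) ρ \ S)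
      = volume.restrict (Metric.ball 0 ρ \ S) :=
  Measure.restrict_congr_set ((closedBall_ae_eq_ball hρ).diff EventuallyEq.rfl)

/-- If `t > 0`, monotonicity already bounds the left side by the potential of `t`; the other summand
covers `t = 0`. -/
theorem potential_add_le (hγ : 0 < γ) {s t : ℝ} (hs : 0 ≤ s) (ht : 0 ≤ t) :
    potential γ (s + t) ≤ potential γ s + potential γ t := by
  rcases ht.eq_or_lt with h | h
  · rw [← h, add_zero]
    exact le_add_of_nonneg_right (potential_nonneg hγ _)
  · exact (potential_anti hγ h (le_add_of_nonneg_left hs)).trans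
      (le_add_of_nonneg_left (potential_nonneg hγ _))

theorem potential_zero (γ : ℝ) : potential γ 0 = 0 := if_neg (lt_irrefl _)

theorem norm_add_sq_le (x y : EuclideanSpace ℝ (Fin n)) :
    ‖x + y‖ ^ 2 ≤ 2 * ‖x‖ ^ 2 + 2 * ‖y‖ ^ 2 := by
  have h1 := norm_add_le x y
  have h2 : ‖x + y‖ ^ 2 ≤ (‖x‖ + ‖y‖) ^ 2 := by gcongr
  nlinarith [sq_nonneg (‖x‖ - ‖y‖)]

theorem innerBarrier_nonneg (γ r : ℝ) (x : EuclideanSpace ℝ (Fin n)) : 0 ≤ innerBarrier γ r x :=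
  posPow_nonneg _ _

theorem outerBarrier_nonneg (γ r : ℝ) (x : EuclideanSpace ℝ (Fin n)) : 0 ≤ outerBarrier γ r x :=
  posPow_nonneg _ _

theorem innerBarrier_eq_zero (hγ : 0 < γ) {r : ℝ} {x : EuclideanSpace ℝ (Fin n)} (hx : ‖x‖ ≤ r) :
    innerBarrier γ r x = 0 :=
  posPow_of_nonpos (barrierExp_pos hγ) (by nlinarith [norm_nonneg x])

theorem outerBarrier_eq_zero (hγ : 0 < γ) {ρ : ℝ} (hρ : 0 ≤ ρ) {x : EuclideanSpace ℝ (Fin n)}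
    (hx : ρ ≤ ‖x‖) : outerBarrier γ ρ x = 0 :=
  posPow_of_nonpos (barrierExp_pos hγ) (by nlinarith [norm_nonneg x])

theorem le_innerBarrier (hγ : 0 < γ) {r ρ : ℝ} (hρ : 0 ≤ ρ) {x : EuclideanSpace ℝ (Fin n)}
    (hx : ρ ≤ ‖x‖) : posPow (barrierExp γ) (ρ ^ 2 - r ^ 2) ≤ innerBarrier γ r x :=
  posPow_mono (barrierExp_pos hγ) (by nlinarith [norm_nonneg x])

theorem le_outerBarrier (hγ : 0 < γ) {r ρ : ℝ} {x : EuclideanSpace ℝ (Fin n)}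
    (hx : ‖x‖ ≤ r) : posPow (barrierExp γ) (ρ ^ 2 - r ^ 2) ≤ outerBarrier γ ρ x :=
  posPow_mono (barrierExp_pos hγ) (by nlinarith [norm_nonneg x])

/-- `u` minimizes `J` in `Ω` in the sense of `IsMinimizer`, with weak gradient `G`. -/
def IsMinimizerWith (γ : ℝ) (Ω : Set (EuclideanSpace ℝ (Fin n)))
    (u : EuclideanSpace ℝ (Fin n) → ℝ)
    (G : EuclideanSpace ℝ (Fin n) → EuclideanSpace ℝ (Fin n)) : Prop :=
  IsH1Loc Ω u G ∧ (∀ᵐ x ∂(volume.restrict Ω), 0 ≤ u x) ∧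
    ∀ K : Set (EuclideanSpace ℝ (Fin n)), IsCompact K → K ⊆ Ω →
      energy γ K u G < ⊤ ∧
      ∀ (v : EuclideanSpace ℝ (Fin n) → ℝ)
        (H : EuclideanSpace ℝ (Fin n) → EuclideanSpace ℝ (Fin n)), IsH1Loc Ω v H →
        (∀ᵐ x ∂(volume.restrict Ω), 0 ≤ v x) →
        (∀ᵐ x ∂(volume.restrict (Ω \ K)), v x = u x) →
        energy γ K u G ≤ energy γ K v H

theorem closedBall_subset_unitBall {ρ : ℝ} (hρ : ρ < 1) :
    Metric.closedBall (0 : EuclideanSpace ℝ (Fin n)) ρ ⊆ Metric.ball 0 1 :=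
  Metric.closedBall_subset_ball hρ

theorem isH1Loc_zero (Ω : Set (EuclideanSpace ℝ (Fin n))) :
    IsH1Loc Ω (fun _ => 0) (fun _ => 0) :=
  ⟨⟨locallyIntegrable_const 0 |>.locallyIntegrableOn _,
      locallyIntegrable_const 0 |>.locallyIntegrableOn _, by simp⟩,
    fun _ _ _ => MemLp.zero', fun _ _ _ => MemLp.zero'⟩

theorem energy_zero (γ : ℝ) (S : Set (EuclideanSpace ℝ (Fin n))) :
    energy γ S (fun _ => 0) (fun _ => 0) = 0 := by
  simp [energy, potential_zero]

variable {u : ℕ → EuclideanSpace ℝ (Fin n) → ℝ} {u₀ : EuclideanSpace ℝ (Fin n) → ℝ}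
  {G : ℕ → EuclideanSpace ℝ (Fin n) → EuclideanSpace ℝ (Fin n)}

theorem tendstoUniformlyOn_closedBall
    (hconv : TendstoLocallyUniformlyOn u u₀ atTop (Metric.ball 0 1)) {ρ : ℝ} (hρ : ρ < 1) :
    TendstoUniformlyOn u u₀ atTop (Metric.closedBall 0 ρ) :=
  (tendstoLocallyUniformlyOn_iff_forall_isCompact Metric.isOpen_ball).1 hconv _
    (closedBall_subset_unitBall hρ) (isCompact_closedBall _ _)

/-- The competitor is in effect `min (u k) a`, where `a` vanishes in the ball and is made of the
inner barrier and one fixed member `u j`. In the layer the gradient of `a` does not involve `k`, and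
its potential is at most that of the barrier. -/
theorem exists_energy_bound (hn : 1 ≤ n) (hγ : 0 < γ) (hγ2 : γ < 2)
    (hmin : ∀ k, IsMinimizerWith γ (Metric.ball 0 1) (u k) (G k))
    (hconv : TendstoLocallyUniformlyOn u u₀ atTop (Metric.ball 0 1)) {r : ℝ} (hr : 1 / 2 ≤ r)
    (hr1 : r < 1) :
    ∃ C : ℝ≥0∞, C ≠ ⊤ ∧ ∀ᶠ k in atTop, energy γ (Metric.ball 0 r) (u k) (G k) ≤ C := by
  -- The cutoff `θ` of `u j` is `1` from `ρ₁` on, before the layer ends at `ρ`. Between `ρ` and `ρ₂`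
  -- the barrier dominates `|u k - u j|`. Beyond `ρ₂` closeness is not available and `τ = 1` adds
  -- the difference itself; as `τ = 0` up to `ρ`, this costs nothing in the layer.
  obtain ⟨ρ₁, hrρ₁, hρ₁⟩ := exists_between hr1
  obtain ⟨ρ, hρ₁ρ, hρ1⟩ := exists_between hρ₁
  obtain ⟨ρ₂, hρρ₂, hρ₂1⟩ := exists_between hρ1
  have hrρ : r < ρ := hrρ₁.trans hρ₁ρ
  obtain ⟨θ, hθ, hθ0, hθ1, hθr, hθρ, -, -⟩ :=
    exists_radial_cutoff n (show 0 < r by linarith) hrρ₁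
  obtain ⟨τ, hτ, hτ0, hτ1, hτr, hτρ, hτg, -⟩ :=
    exists_radial_cutoff n (show 0 < ρ by linarith) hρρ₂
  set ε := posPow (barrierExp γ) (ρ ^ 2 - r ^ 2) with hε
  have hε0 : 0 < ε := posPow_pos (by nlinarith)
  -- `ε` is the barrier height at radius `ρ`; with `u k` and `u j` both within `ε / 2` of the limit
  -- they differ by at most `ε`.
  have hunif := (Metric.tendstoUniformlyOn_iff.1 (tendstoUniformlyOn_closedBall hconv hρ₂1))
    (ε / 2) (by positivity)
  obtain ⟨j, hj⟩ := hunif.exists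
  have hΩ : IsOpen (Metric.ball (0 : EuclideanSpace ℝ (Fin n)) 1) := Metric.isOpen_ball
  have hψ := isH1Loc_innerBarrier hn hγ hγ2 hr hr1.le
  have hP := (hmin j).1.smooth_mul hΩ hθ
  set P := fun x => θ x • G j x + u j x • gradient θ x with hPdef
  have hKc : IsCompact (Metric.closedBall (0 : EuclideanSpace ℝ (Fin n)) ρ) :=
    isCompact_closedBall _ _
  have hKΩ := closedBall_subset_unitBall (n := n) hρ1
  refine ⟨eLpNorm P 2 (volume.restrict (Metric.closedBall 0 ρ)) ^ 2 +
    barrierConst n γ * ENNReal.ofReal ((ρ - r) ^ (1 - barrierDecay γ)), ?_, ?_⟩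
  · have := (hP.3 _ hKc hKΩ).2.ne
    have := barrierConst_ne_top n γ
    finiteness
  filter_upwards [hunif] with k hk
  have hclose : ∀ x ∈ Metric.closedBall 0 ρ₂, |u k x - u j x| ≤ ε := by
    intro x hx
    have h1 := hk x hx
    have h2 := hj x hx
    rw [Real.dist_eq] at h1 h2
    rw [abs_lt] at h1 h2
    rw [abs_le]
    constructor <;> linarith
  have hd := (((hmin k).1.sub (hmin j).1).abs hΩ).smooth_mul hΩ hτ
  have ha := (hP.add hψ).add hd
  have hmk := (hmin k).2.2 _ hKc hKΩ
  have hglue := energy_le_of_glue (γ := γ) hΩ (Metric.isOpen_ball (x := 0) (ε := r))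
    (Metric.ball_subset_closedBall.trans (Metric.closedBall_subset_closedBall hrρ.le)) hKΩ
    (hmin k).1 (isH1Loc_zero _) ha (isH1Loc_zero _) (hmin k).2.1
    (Eventually.of_forall fun x => le_rfl) ?_ (Eventually.of_forall fun x => le_rfl) ?_ ?_ ?_ ?_
    (q := fun _ => 0) (Eventually.of_forall fun x => by simp) hmk.1 hmk.2
  rotate_left
  · filter_upwards [(hmin j).2.1] with x hx
    have := innerBarrier_nonneg γ r x
    have := hθ0 x
    have := hτ0 x
    positivity
  · filter_upwards [ae_restrict_mem measurableSet_ball] with x hx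
    have hx' : ‖x‖ < r := by simpa using hx
    simp [hθr x hx'.le, hτr x (hx'.le.trans hrρ.le), innerBarrier_eq_zero hγ hx'.le]
  · have h1 := ae_restrict_of_ae_restrict_of_subset (Metric.ball_subset_ball hr1.le) (hmin k).2.1
    filter_upwards [h1] with x hx
    simpa using hx
  · exact Eventually.of_forall fun x => rfl
  · filter_upwards [ae_restrict_mem (measurableSet_ball.diff measurableSet_closedBall)] with x hx
    have hxρ : ρ < ‖x‖ := by simpa using hx.2
    rw [hθρ x (hρ₁ρ.le.trans hxρ.le), one_mul, zero_add]
    have h0 := innerBarrier_nonneg γ r x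
    rcases le_or_gt ‖x‖ ρ₂ with h | h
    · have h1 := (le_abs_self _).trans (hclose x (by simpa using h))
      have h2 := le_innerBarrier hγ (r := r) (by linarith) hxρ.le
      have h3 : 0 ≤ τ x * |u k x - u j x| := mul_nonneg (hτ0 x) (abs_nonneg _)
      linarith
    · rw [hτρ x h.le, one_mul]
      have := le_abs_self (u k x - u j x)
      linarith
  refine hglue.trans ?_
  simp only [energy_zero, norm_zero, mul_zero, ne_eq, OfNat.ofNat_ne_zero, not_false_eq_true,
    zero_pow, add_zero, ENNReal.ofReal_zero, lintegral_zero, zero_add]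
  unfold energy
  rw [restrict_closedBall_sdiff (by linarith)]
  have hAmeas : MeasurableSet
      (Metric.ball (0 : EuclideanSpace ℝ (Fin n)) ρ \ Metric.ball 0 r) :=
    measurableSet_ball.diff measurableSet_ball
  calc _ ≤ ∫⁻ x in Metric.ball (0 : EuclideanSpace ℝ (Fin n)) ρ \ Metric.ball 0 r,
        (‖P x‖ₑ ^ 2 + ENNReal.ofReal
          (‖innerBarrierGrad γ r x‖ ^ 2 + potential γ (innerBarrier γ r x))) := by
        refine lintegral_mono_ae ?_
        filter_upwards [ae_restrict_mem hAmeas, ae_restrict_of_ae_restrict_of_subset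
          (sdiff_subset.trans (Metric.ball_subset_ball hρ1.le)) (hmin j).2.1] with x hx hj0
        have hxρ : ‖x‖ < ρ := by simpa using hx.1
        have hxr : r ≤ ‖x‖ := by simpa using hx.2
        rw [hτr x hxρ.le, hτg x hxρ]
        simp only [zero_mul, zero_smul, smul_zero, add_zero]
        rw [← ofReal_norm, ← ENNReal.ofReal_pow (norm_nonneg _),
          ← ENNReal.ofReal_add (by positivity)
            (add_nonneg (by positivity) (potential_nonneg hγ _))]
        refine ENNReal.ofReal_le_ofReal ?_
        have h1 := norm_add_sq_le (P x) (innerBarrierGrad γ r x)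
        have h2 : potential γ (θ x * u j x + innerBarrier γ r x)
            ≤ potential γ (innerBarrier γ r x) := by
          -- On the sphere of radius `r` the barrier is `0` and monotonicity of the potential fails,
          -- but `θ` vanishes there too.
          rcases hxr.eq_or_lt with h | h
          · rw [hθr x h.ge, zero_mul, zero_add]
          · exact potential_anti hγ (posPow_pos (by nlinarith))
              (le_add_of_nonneg_left (mul_nonneg (hθ0 x) hj0))
        linarith
    _ ≤ _ := by
        rw [lintegral_add_left']
        · refine add_le_add ?_ (lintegral_innerBarrier_le hn hγ hγ2 hr hrρ.le hρ1.le)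
          rw [eLpNorm_two_sq]
          exact lintegral_mono_set (sdiff_subset.trans Metric.ball_subset_closedBall)
        · exact ((hP.aestronglyMeasurable_grad.mono_measure (Measure.restrict_mono
            (sdiff_subset.trans (Metric.ball_subset_ball hρ1.le)) le_rfl)).enorm.pow_const 2)

end UniformBound

/-! ### Gluing a competitor of the limit -/

section LocalMinimality

variable {n : ℕ} {γ : ℝ} {u : ℕ → EuclideanSpace ℝ (Fin n) → ℝ}
  {u₀ v : EuclideanSpace ℝ (Fin n) → ℝ} {G : ℕ → EuclideanSpace ℝ (Fin n) → EuclideanSpace ℝ (Fin n)}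
  {G₀ H : EuclideanSpace ℝ (Fin n) → EuclideanSpace ℝ (Fin n)} {K : Set (EuclideanSpace ℝ (Fin n))}

/-- Young's inequality: the weight `δ` goes to the energy of `u k`, which is merely bounded, and the
large weight to the barrier, whose energy tends to zero with the width of the layer. -/
theorem mul_add_le_of_pos {g d w p δ : ℝ} (hδ : 0 < δ) (hw : 0 ≤ w) (hp : 0 ≤ p) :
    g * d + 1 / 2 * d ^ 2 + p ≤
      δ * (1 / 2 * g ^ 2 + w) + (1 / (2 * δ) + 1) * (d ^ 2 + p) := by
  have h1 : 0 ≤ (δ * g - d) ^ 2 / (2 * δ) := by positivity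
  have h2 : (δ * g - d) ^ 2 / (2 * δ) = δ / 2 * g ^ 2 - g * d + 1 / (2 * δ) * d ^ 2 := by
    field_simp; ring
  have h3 : 0 ≤ 1 / (2 * δ) * p := by positivity
  nlinarith [sq_nonneg d, mul_nonneg hδ.le hw]

theorem energy_add_le {S : Set (EuclideanSpace ℝ (Fin n))} (hγ : 0 < γ)
    {a w : EuclideanSpace ℝ (Fin n) → ℝ} {Da D : EuclideanSpace ℝ (Fin n) → EuclideanSpace ℝ (Fin n)}
    {Ω : Set (EuclideanSpace ℝ (Fin n))} (hv : IsH1Loc Ω v H) (hS : S ⊆ Ω)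
    (hv0 : ∀ᵐ x ∂(volume.restrict S), 0 ≤ v x) (hw0 : ∀ x, 0 ≤ w x)
    (ha : ∀ᵐ x ∂(volume.restrict S), a x = w x) (hDa : ∀ᵐ x ∂(volume.restrict S), Da x = D x) :
    energy γ S (fun x => v x + a x) (fun x => H x + Da x) ≤
      2 * energy γ S v H + ∫⁻ x in S, ENNReal.ofReal (‖D x‖ ^ 2 + potential γ (w x)) := by
  unfold energy
  rw [← lintegral_const_mul' _ _ (by simp),
    ← lintegral_add_left' ((hv.aemeasurable_density γ hS).const_mul _)]
  refine lintegral_mono_ae ?_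
  filter_upwards [hv0, ha, hDa] with x h1 h2 h3
  have h22 : ∀ t : ℝ, 2 * ENNReal.ofReal t = ENNReal.ofReal (2 * t) := fun t => by
    rw [ENNReal.ofReal_mul zero_le_two, ENNReal.ofReal_ofNat]
  rw [h2, h3, h22, ← ENNReal.ofReal_add (mul_nonneg zero_le_two
      (add_nonneg (by positivity) (potential_nonneg hγ _)))
      (add_nonneg (by positivity) (potential_nonneg hγ _))]
  refine ENNReal.ofReal_le_ofReal ?_
  have h4 := norm_add_sq_le (H x) (D x)
  have h5 := potential_add_le hγ h1 (hw0 x)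
  have h6 := potential_nonneg hγ (v x)
  linarith

/-- Since `v = u₀` off `K`, in the layer `b` is the bare outer barrier and the energy of `v` is that
of `u₀`. All terms after the first vanish in the limit `ρ → r` followed by `δ → 0`. -/
theorem energy_ball_le_add (hn : 1 ≤ n) (hγ : 0 < γ) (hγ2 : γ < 2)
    (hmin : ∀ k, IsMinimizerWith γ (Metric.ball 0 1) (u k) (G k))
    (hconv : TendstoLocallyUniformlyOn u u₀ atTop (Metric.ball 0 1))
    (hu₀ : IsH1Loc (Metric.ball 0 1) u₀ G₀) (hK : IsCompact K)
    {r ρ R : ℝ} (hr : 1 / 2 ≤ r) (hrρ : r < ρ) (hρR : ρ < R) (hR : R < 1)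
    (hKr : K ⊆ Metric.ball 0 r) (hv : IsH1Loc (Metric.ball 0 1) v H)
    (hv0 : ∀ᵐ x ∂(volume.restrict (Metric.ball 0 1)), 0 ≤ v x)
    (hvu : ∀ᵐ x ∂(volume.restrict (Metric.ball 0 1 \ K)), v x = u₀ x)
    {C : ℝ≥0∞} (hC : ∀ᶠ k in atTop, energy γ (Metric.ball 0 R) (u k) (G k) ≤ C)
    {δ : ℝ} (hδ : 0 < δ) :
    ∀ᶠ k in atTop, energy γ (Metric.ball 0 r) (u k) (G k) ≤ energy γ (Metric.ball 0 r) v H +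
      (energy γ (Metric.ball 0 ρ \ Metric.ball 0 r) v H +
        ((2 * energy γ (Metric.ball 0 ρ \ Metric.ball 0 r) v H +
          barrierConst n γ * ENNReal.ofReal ((ρ - r) ^ (1 - barrierDecay γ))) +
        (ENNReal.ofReal δ * C + ENNReal.ofReal (1 / (2 * δ) + 1) *
          (barrierConst n γ * ENNReal.ofReal ((ρ - r) ^ (1 - barrierDecay γ)))))) := by
  have hρ1 : ρ < 1 := hρR.trans hR
  obtain ⟨ρ₂, hρρ₂, hρ₂1⟩ := exists_between hρ1
  obtain ⟨τ, hτ, hτ0, hτ1, hτr, hτρ, hτg, -⟩ :=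
    exists_radial_cutoff n (show 0 < ρ by linarith) hρρ₂
  -- Both barriers reach this height across the layer: the inner one at radius `ρ`, the outer one at
  -- radius `r`.
  set ε := posPow (barrierExp γ) (ρ ^ 2 - r ^ 2) with hε
  have hε0 : 0 < ε := posPow_pos (by nlinarith)
  have hunif := (Metric.tendstoUniformlyOn_iff.1 (tendstoUniformlyOn_closedBall hconv hρ₂1)) ε hε0
  have hΩ : IsOpen (Metric.ball (0 : EuclideanSpace ℝ (Fin n)) 1) := Metric.isOpen_ball
  have hψ := isH1Loc_innerBarrier hn hγ hγ2 hr (by linarith : r ≤ 1)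
  have hψ' := isH1Loc_outerBarrier hn hγ hγ2 (by linarith : 1 / 2 ≤ ρ) hρ1.le
  have hKc : IsCompact (Metric.closedBall (0 : EuclideanSpace ℝ (Fin n)) ρ) :=
    isCompact_closedBall _ _
  have hKΩ := closedBall_subset_unitBall (n := n) hρ1
  have hAK : Metric.ball (0 : EuclideanSpace ℝ (Fin n)) ρ \ Metric.ball 0 r ⊆
      Metric.ball 0 1 \ K := fun x hx =>
    ⟨Metric.ball_subset_ball hρ1.le hx.1, fun h => hx.2 (hKr h)⟩
  have hAΩ : Metric.ball (0 : EuclideanSpace ℝ (Fin n)) ρ \ Metric.ball 0 r ⊆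
      Metric.ball 0 1 := hAK.trans sdiff_subset
  have hAmeas : MeasurableSet
      (Metric.ball (0 : EuclideanSpace ℝ (Fin n)) ρ \ Metric.ball 0 r) :=
    measurableSet_ball.diff measurableSet_ball
  -- This removes the gradient of `|v - u₀|` from that of `b` in the layer.
  have hHG : ∀ᵐ x ∂(volume.restrict (Metric.ball 0 1 \ K)), H x = G₀ x :=
    (hv.1.mono sdiff_subset).ae_eq_of_ae_eq (hΩ.sdiff hK.isClosed) (hu₀.1.mono sdiff_subset) hvu
  have hb := ((hv.sub hu₀).abs hΩ).add hψ'
  filter_upwards [hunif, hC] with k hk hCk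
  have hclose : ∀ x ∈ Metric.closedBall 0 ρ₂, |u k x - u₀ x| ≤ ε := by
    intro x hx
    have h1 := hk x hx
    rw [dist_comm, Real.dist_eq] at h1
    exact h1.le
  have hd := (((hmin k).1.sub hu₀).abs hΩ).smooth_mul hΩ hτ
  have ha := hψ.add hd
  have hmk := (hmin k).2.2 _ hKc hKΩ
  have hglue := energy_le_of_glue (γ := γ) hΩ (Metric.isOpen_ball (x := 0) (ε := r))
    (Metric.ball_subset_closedBall.trans (Metric.closedBall_subset_closedBall hrρ.le)) hKΩ
    (hmin k).1 hv ha hb (hmin k).2.1 hv0 ?_ ?_ ?_ ?_ ?_ ?_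
    (q := fun x => potential γ (|v x - u₀ x| + outerBarrier γ ρ x)) ?_ hmk.1 hmk.2
  rotate_left
  · refine Eventually.of_forall fun x => add_nonneg (innerBarrier_nonneg γ r x) ?_
    exact mul_nonneg (hτ0 x) (abs_nonneg _)
  · exact Eventually.of_forall fun x => add_nonneg (abs_nonneg _) (outerBarrier_nonneg γ ρ x)
  · filter_upwards [ae_restrict_mem measurableSet_ball] with x hx
    have hx' : ‖x‖ < r := by simpa using hx
    simp [hτr x (hx'.le.trans hrρ.le), innerBarrier_eq_zero hγ hx'.le]
  · filter_upwards [ae_restrict_mem measurableSet_ball] with x hx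
    have hx' : ‖x‖ < r := by simpa using hx
    have h1 := (neg_abs_le _).trans' (neg_le_neg (hclose x (by simp; linarith)))
    have h2 := le_outerBarrier hγ (ρ := ρ) hx'.le
    have h3 := le_abs_self (v x - u₀ x)
    linarith
  · filter_upwards [ae_restrict_of_ae_restrict_of_subset (sdiff_subset_sdiff_right
      (hKr.trans ((Metric.ball_subset_ball hrρ.le).trans Metric.ball_subset_closedBall))) hvu,
      ae_restrict_mem (measurableSet_ball.diff measurableSet_closedBall)] with x hx hx2
    have hxρ : ρ < ‖x‖ := by simpa using hx2.2
    rw [hx, sub_self, abs_zero, zero_add, outerBarrier_eq_zero hγ (by linarith) hxρ.le]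
  · filter_upwards [ae_restrict_of_ae_restrict_of_subset (sdiff_subset_sdiff_right
      (hKr.trans ((Metric.ball_subset_ball hrρ.le).trans Metric.ball_subset_closedBall))) hvu,
      ae_restrict_mem (measurableSet_ball.diff measurableSet_closedBall)] with x hx hx2
    have hxρ : ρ < ‖x‖ := by simpa using hx2.2
    rw [hx]
    have h0 := innerBarrier_nonneg γ r x
    rcases le_or_gt ‖x‖ ρ₂ with h | h
    · have h1 := (le_abs_self _).trans (hclose x (by simpa using h))
      have h2 := le_innerBarrier hγ (r := r) (by linarith) hxρ.le
      have h3 : 0 ≤ τ x * |u k x - u₀ x| := mul_nonneg (hτ0 x) (abs_nonneg _)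
      linarith
    · rw [hτρ x h.le, one_mul]
      have := le_abs_self (u k x - u₀ x)
      linarith
  · filter_upwards [ae_restrict_of_ae_restrict_of_subset (sdiff_subset.trans hKΩ)
      (hmin k).2.1] with x hx
    exact potential_add_le hγ hx (add_nonneg (abs_nonneg _) (outerBarrier_nonneg γ ρ x))
  refine hglue.trans ?_
  have hres := restrict_closedBall_sdiff (n := n) (show ρ ≠ 0 by linarith) (Metric.ball 0 r)
  have hen : ∀ w D, energy γ (Metric.closedBall 0 ρ \ Metric.ball 0 r) w D
      = energy γ (Metric.ball (0 : EuclideanSpace ℝ (Fin n)) ρ \ Metric.ball 0 r) w D := by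
    intro w D
    rw [energy, hres, energy]
  rw [hen, hen, hres]
  gcongr
  · refine (energy_add_le hγ hv hAΩ (ae_restrict_of_ae_restrict_of_subset hAΩ hv0)
      (innerBarrier_nonneg γ r) (D := innerBarrierGrad γ r) ?_ ?_).trans ?_
    · filter_upwards [ae_restrict_mem hAmeas] with x hx
      have hxρ : ‖x‖ < ρ := by simpa using hx.1
      rw [hτr x hxρ.le, zero_mul, add_zero]
    · filter_upwards [ae_restrict_mem hAmeas] with x hx
      have hxρ : ‖x‖ < ρ := by simpa using hx.1
      rw [hτr x hxρ.le, hτg x hxρ, zero_smul, smul_zero, add_zero, add_zero]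
    · gcongr
      exact lintegral_innerBarrier_le hn hγ hγ2 hr hrρ.le hρ1.le
  · calc _ ≤ ∫⁻ x in Metric.ball (0 : EuclideanSpace ℝ (Fin n)) ρ \ Metric.ball 0 r,
          (ENNReal.ofReal δ * ENNReal.ofReal (1 / 2 * ‖G k x‖ ^ 2 + potential γ (u k x)) +
            ENNReal.ofReal (1 / (2 * δ) + 1) * ENNReal.ofReal
              (‖outerBarrierGrad γ ρ x‖ ^ 2 + potential γ (outerBarrier γ ρ x))) := by
          refine lintegral_mono_ae ?_
          filter_upwards [ae_restrict_of_ae_restrict_of_subset hAK hvu,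
            ae_restrict_of_ae_restrict_of_subset hAK hHG] with x h1 h2
          rw [h1, h2, sub_self, sub_self, abs_zero, neg_zero, if_neg (lt_irrefl _), zero_add,
            zero_add, ← ENNReal.ofReal_mul hδ.le, ← ENNReal.ofReal_mul (by positivity),
            ← ENNReal.ofReal_add
              (mul_nonneg hδ.le (add_nonneg (by positivity) (potential_nonneg hγ _)))
              (mul_nonneg (by positivity) (add_nonneg (by positivity) (potential_nonneg hγ _)))]
          exact ENNReal.ofReal_le_ofReal (mul_add_le_of_pos hδ (potential_nonneg hγ _)
            (potential_nonneg hγ _))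
      _ ≤ _ := by
          rw [lintegral_add_left' (((hmin k).1.aemeasurable_density γ hAΩ).const_mul _),
            lintegral_const_mul' _ _ ENNReal.ofReal_ne_top,
            lintegral_const_mul' _ _ ENNReal.ofReal_ne_top]
          gcongr
          · exact (energy_mono_set (sdiff_subset.trans (Metric.ball_subset_ball hρR.le))).trans hCk
          · exact lintegral_outerBarrier_le hn hγ hγ2 (by linarith) hrρ.le (by linarith) hρ1.le

end LocalMinimality

/-! ### Minimality of the limit -/

section LimitMinimality

variable {n : ℕ} {γ : ℝ} {u : ℕ → EuclideanSpace ℝ (Fin n) → ℝ}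
  {u₀ v : EuclideanSpace ℝ (Fin n) → ℝ} {G : ℕ → EuclideanSpace ℝ (Fin n) → EuclideanSpace ℝ (Fin n)}
  {G₀ H : EuclideanSpace ℝ (Fin n) → EuclideanSpace ℝ (Fin n)} {K : Set (EuclideanSpace ℝ (Fin n))}

theorem tendsto_volume_annulus {r : ℝ} (hr : 0 < r) :
    Tendsto (fun ρ => volume (Metric.ball (0 : EuclideanSpace ℝ (Fin n)) ρ \ Metric.ball 0 r))
      (𝓝[>] r) (𝓝 0) := by
  have h := tendsto_measure_biInter_gt (μ := volume) (a := r)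
    (s := fun ρ => Metric.ball (0 : EuclideanSpace ℝ (Fin n)) ρ \ Metric.ball 0 r)
    (fun ρ _ => (measurableSet_ball.diff measurableSet_ball).nullMeasurableSet)
    (fun i j _ hij => sdiff_subset_sdiff_left (Metric.ball_subset_ball hij))
    ⟨r + 1, by linarith, ((measure_mono sdiff_subset).trans_lt measure_ball_lt_top).ne⟩
  have h0 : volume (⋂ ρ > r, Metric.ball (0 : EuclideanSpace ℝ (Fin n)) ρ \ Metric.ball 0 r) = 0 := by
    refine measure_mono_null (fun x hx => ?_)
      (Measure.addHaar_sphere_of_ne_zero volume (0 : EuclideanSpace ℝ (Fin n)) hr.ne')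
    simp only [mem_iInter, Set.mem_sdiff, mem_ball_zero_iff, not_lt] at hx
    rw [mem_sphere_zero_iff_norm]
    refine le_antisymm (le_of_forall_gt_imp_ge_of_dense fun ρ hρ => (hx ρ hρ).1.le) ?_
    exact (hx (r + 1) (by linarith)).2
  rw [h0] at h
  exact h

theorem tendsto_ofReal_rpow {β r : ℝ} (hβ : β < 1) :
    Tendsto (fun ρ => ENNReal.ofReal ((ρ - r) ^ (1 - β))) (𝓝[>] r) (𝓝 0) := by
  have h1 : Tendsto (fun ρ : ℝ => (ρ - r) ^ (1 - β)) (𝓝 r) (𝓝 ((r - r) ^ (1 - β))) :=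
    ((continuous_id.sub continuous_const).tendsto r).rpow_const (Or.inr (by simp; linarith))
  rw [sub_self, Real.zero_rpow (by linarith)] at h1
  simpa [Function.comp_def] using
    (ENNReal.continuous_ofReal.tendsto 0).comp (h1.mono_left nhdsWithin_le_nhds)

theorem energy_limit_le (hγ : 0 < γ) (hw : ∀ k, IsH1Loc (Metric.ball 0 1) (u k) (G k))
    (hconv : TendstoLocallyUniformlyOn u u₀ atTop (Metric.ball 0 1)) {r : ℝ} (hr1 : r < 1)
    {C : ℝ≥0∞} (hC : C ≠ ⊤) (hE : ∀ᶠ k in atTop, energy γ (Metric.ball 0 r) (u k) (G k) ≤ C) :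
    ∃ G', HasWeakGradient (Metric.ball 0 r) u₀ G' ∧
      MemLp G' 2 (volume.restrict (Metric.ball 0 r)) ∧ energy γ (Metric.ball 0 r) u₀ G' ≤ C := by
  obtain ⟨N, hN⟩ := eventually_atTop.1 hE
  have hu := (tendstoUniformlyOn_closedBall hconv hr1).mono Metric.ball_subset_closedBall
  exact exists_weakGradient_energy_le hγ Metric.isOpen_ball (w := fun k => u (k + N))
    (D := fun k => G (k + N)) (fun k => (hw _).1.mono (Metric.ball_subset_ball hr1.le)) hC
    (fun k => hN _ (by omega)) fun V hV => (tendsto_add_atTop_nat N).eventually (hu V hV)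

/-- At fixed `ρ` and `δ`, lower semicontinuity lets `k → ∞`. Then `ρ → r`: the energy of `u₀` in the
shrinking annulus vanishes by absolute continuity, that of the barriers by their bound. Finally `δ →
0` removes `δ C`. -/
theorem energy_ball_le (hn : 1 ≤ n) (hγ : 0 < γ) (hγ2 : γ < 2)
    (hmin : ∀ k, IsMinimizerWith γ (Metric.ball 0 1) (u k) (G k))
    (hconv : TendstoLocallyUniformlyOn u u₀ atTop (Metric.ball 0 1))
    (hu₀ : IsH1Loc (Metric.ball 0 1) u₀ G₀)
    (hfin : ∀ K : Set (EuclideanSpace ℝ (Fin n)), IsCompact K → K ⊆ Metric.ball 0 1 →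
      energy γ K u₀ G₀ < ⊤) (hK : IsCompact K) {r : ℝ} (hr : 1 / 2 ≤ r) (hr1 : r < 1)
    (hKr : K ⊆ Metric.ball 0 r) (hv : IsH1Loc (Metric.ball 0 1) v H)
    (hv0 : ∀ᵐ x ∂(volume.restrict (Metric.ball 0 1)), 0 ≤ v x)
    (hvu : ∀ᵐ x ∂(volume.restrict (Metric.ball 0 1 \ K)), v x = u₀ x) :
    energy γ (Metric.ball 0 r) u₀ G₀ ≤ energy γ (Metric.ball 0 r) v H := by
  obtain ⟨R, hrR, hR1⟩ := exists_between hr1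
  obtain ⟨C, hC, hCk⟩ := exists_energy_bound hn hγ hγ2 hmin hconv (by linarith : 1 / 2 ≤ R) hR1
  have hΩ : IsOpen (Metric.ball (0 : EuclideanSpace ℝ (Fin n)) 1) := Metric.isOpen_ball
  have hHG : ∀ᵐ x ∂(volume.restrict (Metric.ball 0 1 \ K)), H x = G₀ x :=
    (hv.1.mono sdiff_subset).ae_eq_of_ae_eq (hΩ.sdiff hK.isClosed) (hu₀.1.mono sdiff_subset) hvu
  set A := fun ρ => Metric.ball (0 : EuclideanSpace ℝ (Fin n)) ρ \ Metric.ball 0 r with hA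
  have tA : Tendsto (fun ρ => energy γ (A ρ) v H) (𝓝[>] r) (𝓝 0) := by
    have h1 := tendsto_setLIntegral_zero (μ := volume)
      (f := (Metric.closedBall 0 R).indicator
        (fun x => ENNReal.ofReal (1 / 2 * ‖G₀ x‖ ^ 2 + potential γ (u₀ x)))) (by
          rw [lintegral_indicator measurableSet_closedBall]
          exact (hfin _ (isCompact_closedBall _ _) (closedBall_subset_unitBall hR1)).ne)
      (tendsto_volume_annulus (n := n) (show 0 < r by linarith))
    refine h1.congr' ?_
    filter_upwards [Ioo_mem_nhdsGT hrR] with ρ hρ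
    have hAK : A ρ ⊆ Metric.ball 0 1 \ K := fun x hx =>
      ⟨Metric.ball_subset_ball (hρ.2.trans hR1).le hx.1, fun h => hx.2 (hKr h)⟩
    refine lintegral_congr_ae ?_
    filter_upwards [ae_restrict_of_ae_restrict_of_subset hAK hvu,
      ae_restrict_of_ae_restrict_of_subset hAK hHG,
      ae_restrict_mem (measurableSet_ball.diff measurableSet_ball)] with x h2 h3 h4
    rw [indicator_of_mem (Metric.ball_subset_closedBall (Metric.ball_subset_ball hρ.2.le h4.1)),
      h2, h3]
  have tM : Tendsto (fun ρ => barrierConst n γ * ENNReal.ofReal ((ρ - r) ^ (1 - barrierDecay γ)))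
      (𝓝[>] r) (𝓝 0) := by
    simpa using ENNReal.Tendsto.const_mul (tendsto_ofReal_rpow (barrierDecay_lt_one hγ hγ2))
      (Or.inr (barrierConst_ne_top n γ))
  have hstep : ∀ δ : ℝ, 0 < δ → energy γ (Metric.ball 0 r) u₀ G₀ ≤
      energy γ (Metric.ball 0 r) v H + ENNReal.ofReal δ * C := by
    intro δ hδ
    have t1 := (tA.add (((ENNReal.Tendsto.const_mul (a := 2) tA (Or.inr (by simp))).add tM).add
      ((ENNReal.Tendsto.const_mul (a := ENNReal.ofReal (1 / (2 * δ) + 1)) tM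
        (Or.inr ENNReal.ofReal_ne_top)).const_add (ENNReal.ofReal δ * C)))).const_add
        (energy γ (Metric.ball 0 r) v H)
    simp only [mul_zero, add_zero, zero_add] at t1
    refine ge_of_tendsto t1 ?_
    filter_upwards [Ioo_mem_nhdsGT hrR] with ρ hρ
    have h := energy_ball_le_add hn hγ hγ2 hmin hconv hu₀ hK hr hρ.1 hρ.2 hR1 hKr hv hv0 hvu hCk hδ
    -- `v` may have infinite energy, while the lower semicontinuity lemma requires a finite bound.
    by_cases htop : energy γ (Metric.ball 0 r) v H + (energy γ (A ρ) v H + ((2 * energy γ (A ρ) v H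
        + barrierConst n γ * ENNReal.ofReal ((ρ - r) ^ (1 - barrierDecay γ))) +
        (ENNReal.ofReal δ * C + ENNReal.ofReal (1 / (2 * δ) + 1) *
          (barrierConst n γ * ENNReal.ofReal ((ρ - r) ^ (1 - barrierDecay γ)))))) = ⊤
    · rw [htop]; exact le_top
    · obtain ⟨G', h1, -, h2⟩ := energy_limit_le hγ (fun k => (hmin k).1) hconv hr1 htop h
      rwa [energy_congr EventuallyEq.rfl ((h1.ae_eq_of_ae_eq Metric.isOpen_ball
        (hu₀.1.mono (Metric.ball_subset_ball hr1.le)) EventuallyEq.rfl))] at h2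
  have t2 : Tendsto (fun δ : ℝ => energy γ (Metric.ball 0 r) v H + ENNReal.ofReal δ * C)
      (𝓝[>] 0) (𝓝 (energy γ (Metric.ball 0 r) v H)) := by
    have h1 : Tendsto (fun δ : ℝ => ENNReal.ofReal δ) (𝓝[>] 0) (𝓝 0) := by
      simpa using (ENNReal.continuous_ofReal.tendsto 0).mono_left nhdsWithin_le_nhds
    simpa using (ENNReal.Tendsto.mul_const h1 (Or.inr hC)).const_add
      (energy γ (Metric.ball 0 r) v H)
  refine ge_of_tendsto t2 ?_
  filter_upwards [self_mem_nhdsWithin] with δ hδ using hstep δ hδ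

theorem exists_ball_of_isCompact (hK : IsCompact K) (hK1 : K ⊆ Metric.ball 0 1) :
    ∃ r : ℝ, 1 / 2 ≤ r ∧ r < 1 ∧ K ⊆ Metric.ball 0 r := by
  obtain ⟨r, hr, hKr⟩ := exists_pos_lt_subset_ball one_pos hK.isClosed hK1
  exact ⟨max (1 / 2) r, le_max_left _ _, max_lt (by norm_num) hr.2,
    hKr.trans (Metric.ball_subset_ball (le_max_right _ _))⟩

/-- A sequence of radii increasing to `1`. -/
def exhaustion (m : ℕ) : ℝ := 1 - 1 / ((m : ℝ) + 2)

theorem exhaustion_lt_one (m : ℕ) : exhaustion m < 1 := by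
  have : 0 < 1 / ((m : ℝ) + 2) := by positivity
  rw [exhaustion]; linarith

/-- The shift by `2` starts the radii at `1/2`, as the barrier estimates require. -/
theorem half_le_exhaustion (m : ℕ) : 1 / 2 ≤ exhaustion m := by
  have : 1 / ((m : ℝ) + 2) ≤ 1 / 2 := by
    apply one_div_le_one_div_of_le two_pos
    linarith [(Nat.cast_nonneg m : (0 : ℝ) ≤ m)]
  rw [exhaustion]; linarith

theorem exhaustion_mono : Monotone exhaustion := by
  intro a b hab
  have : (a : ℝ) ≤ b := by exact_mod_cast hab
  simp only [exhaustion]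
  gcongr

theorem exists_lt_exhaustion {t : ℝ} (ht : t < 1) : ∃ m, t < exhaustion m := by
  obtain ⟨m, hm⟩ := exists_nat_one_div_lt (sub_pos.2 ht)
  refine ⟨m, ?_⟩
  have : 1 / ((m : ℝ) + 2) ≤ 1 / (m + 1) := by gcongr; norm_num
  rw [exhaustion]; linarith

/-- Gradients on nested balls agree almost everywhere by uniqueness; at each point the value is
taken from the first ball containing it. -/
theorem exists_isH1Loc_of_forall_ball {w : EuclideanSpace ℝ (Fin n) → ℝ}
    (hw : ∀ K : Set (EuclideanSpace ℝ (Fin n)), IsCompact K → K ⊆ Metric.ball 0 1 →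
      MemLp w 2 (volume.restrict K))
    (h : ∀ r : ℝ, 1 / 2 ≤ r → r < 1 → ∃ D, HasWeakGradient (Metric.ball 0 r) w D ∧
      MemLp D 2 (volume.restrict (Metric.ball 0 r))) :
    ∃ D, IsH1Loc (Metric.ball 0 1) w D := by
  classical
  choose D hD hD2 using fun m => h (exhaustion m) (half_le_exhaustion m) (exhaustion_lt_one m)
  let D₀ : EuclideanSpace ℝ (Fin n) → EuclideanSpace ℝ (Fin n) := fun x =>
    if hx : ∃ m, ‖x‖ < exhaustion m then D (Nat.find hx) x else 0
  have hD₀ : ∀ m, D₀ =ᵐ[volume.restrict (Metric.ball 0 (exhaustion m))] D m := by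
    intro m
    have h1 : ∀ i, i ≤ m → ∀ᵐ x ∂volume, x ∈ Metric.ball (0 : EuclideanSpace ℝ (Fin n)) (exhaustion i) →
        D i x = D m x := by
      intro i hi
      rw [← ae_restrict_iff' measurableSet_ball]
      exact (hD i).ae_eq_of_ae_eq Metric.isOpen_ball
        ((hD m).mono (Metric.ball_subset_ball (exhaustion_mono hi))) EventuallyEq.rfl
    rw [EventuallyEq, ae_restrict_iff' measurableSet_ball]
    filter_upwards [ae_all_iff.2 fun i => ae_all_iff.2 (h1 i)] with x hx hxm
    have hex : ∃ m, ‖x‖ < exhaustion m := ⟨m, by simpa using hxm⟩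
    simp only [D₀, dif_pos hex]
    exact hx _ (Nat.find_min' hex (by simpa using hxm)) (by simpa using Nat.find_spec hex)
  have hcov : ∀ K : Set (EuclideanSpace ℝ (Fin n)), IsCompact K → K ⊆ Metric.ball 0 1 →
      ∃ m, K ⊆ Metric.ball 0 (exhaustion m) := by
    intro K hK hK1
    obtain ⟨t, -, ht, hKt⟩ := exists_ball_of_isCompact hK hK1
    obtain ⟨m, hm⟩ := exists_lt_exhaustion ht
    exact ⟨m, hKt.trans (Metric.ball_subset_ball hm.le)⟩
  refine ⟨D₀, IsH1Loc.of_memLp Metric.isOpen_ball hw (fun K hK hK1 => ?_) fun φ hφ e => ?_⟩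
  · obtain ⟨m, hm⟩ := hcov K hK hK1
    exact ((hD2 m).ae_eq (hD₀ m).symm).mono_measure (Measure.restrict_mono hm le_rfl)
  · obtain ⟨m, hm⟩ := hcov _ hφ.compact hφ.support_subset
    have h1 := ((hD m).congr Metric.isOpen_ball EventuallyEq.rfl (hD₀ m).symm).integral_eq φ
      ⟨hφ.smooth, hφ.compact, hm⟩ e
    have key : ∀ {f g : EuclideanSpace ℝ (Fin n) → ℝ}, tsupport g ⊆ Metric.ball 0 (exhaustion m) →
        ∫ x in Metric.ball 0 1, f x * g x = ∫ x in Metric.ball 0 (exhaustion m), f x * g x := by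
      intro f g hg
      refine setIntegral_eq_of_subset_of_forall_sdiff_eq_zero measurableSet_ball
        (Metric.ball_subset_ball (exhaustion_lt_one m).le) fun x hx => ?_
      rw [image_eq_zero_of_notMem_tsupport fun hx' => hx.2 (hg hx'), mul_zero]
    rw [key hm, key ((IsTestFunction.tsupport_fderiv_apply_subset φ e).trans hm)]
    exact h1

theorem exists_isMinimizerWith_limit (hn : 1 ≤ n) (hγ : 0 < γ) (hγ2 : γ < 2)
    (hmin : ∀ k, IsMinimizerWith γ (Metric.ball 0 1) (u k) (G k))
    (hconv : TendstoLocallyUniformlyOn u u₀ atTop (Metric.ball 0 1)) :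
    ∃ G₀, IsMinimizerWith γ (Metric.ball 0 1) u₀ G₀ := by
  have hΩ : IsOpen (Metric.ball (0 : EuclideanSpace ℝ (Fin n)) 1) := Metric.isOpen_ball
  have hlim : ∀ r : ℝ, 1 / 2 ≤ r → r < 1 → ∃ D, HasWeakGradient (Metric.ball 0 r) u₀ D ∧
      MemLp D 2 (volume.restrict (Metric.ball 0 r)) ∧ energy γ (Metric.ball 0 r) u₀ D < ⊤ := by
    intro r hr hr1
    obtain ⟨C, hC, hCk⟩ := exists_energy_bound hn hγ hγ2 hmin hconv hr hr1
    obtain ⟨D, h1, h2, h3⟩ := energy_limit_le hγ (fun k => (hmin k).1) hconv hr1 hC hCk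
    exact ⟨D, h1, h2, h3.trans_lt hC.lt_top⟩
  have hpt : ∀ x ∈ Metric.ball 0 1, Tendsto (fun k => u k x) atTop (𝓝 (u₀ x)) := fun x hx =>
    hconv.tendsto_at hx
  have hum : AEStronglyMeasurable u₀ (volume.restrict (Metric.ball 0 1)) := by
    refine aestronglyMeasurable_of_tendsto_ae atTop
      (fun k => (hmin k).1.aestronglyMeasurable) ?_
    filter_upwards [ae_restrict_mem measurableSet_ball] with x hx using hpt x hx
  have hu0 : ∀ᵐ x ∂(volume.restrict (Metric.ball 0 1)), 0 ≤ u₀ x := by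
    filter_upwards [ae_restrict_mem measurableSet_ball, ae_all_iff.2 fun k => (hmin k).2.1]
      with x hx h0
    exact ge_of_tendsto (hpt x hx) (Eventually.of_forall h0)
  obtain ⟨G₀, hG₀⟩ := exists_isH1Loc_of_forall_ball (w := u₀) (fun K hK hK1 => by
    have hunif := (tendstoLocallyUniformlyOn_iff_forall_isCompact hΩ).1 hconv K hK1 hK
    obtain ⟨k, hk⟩ := ((Metric.tendstoUniformlyOn_iff.1 hunif) 1 one_pos).exists
    have : IsFiniteMeasure (volume.restrict K) := ⟨by simpa using hK.measure_lt_top⟩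
    have h1 : MemLp (fun x => u₀ x - u k x) 2 (volume.restrict K) := by
      refine MemLp.of_bound ((hum.mono_measure (Measure.restrict_mono hK1 le_rfl)).sub
        ((hmin k).1.2 K hK hK1).1) 1 ?_
      refine (ae_restrict_iff' hK.measurableSet).2 (Eventually.of_forall fun x hx => ?_)
      rw [← dist_eq_norm]
      exact (hk x hx).le
    exact (h1.add ((hmin k).1.2 K hK hK1)).ae_eq (Eventually.of_forall fun x => by simp))
    fun r hr hr1 => by
      obtain ⟨D, h1, h2, -⟩ := hlim r hr hr1
      exact ⟨D, h1, h2⟩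
  have hfinb : ∀ r : ℝ, 1 / 2 ≤ r → r < 1 → energy γ (Metric.ball 0 r) u₀ G₀ < ⊤ := by
    intro r hr hr1
    obtain ⟨D, h1, -, h3⟩ := hlim r hr hr1
    rwa [energy_congr EventuallyEq.rfl (h1.ae_eq_of_ae_eq Metric.isOpen_ball
      (hG₀.1.mono (Metric.ball_subset_ball hr1.le)) EventuallyEq.rfl)] at h3
  have hfin : ∀ K : Set (EuclideanSpace ℝ (Fin n)), IsCompact K → K ⊆ Metric.ball 0 1 →
      energy γ K u₀ G₀ < ⊤ := by
    intro K hK hK1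
    obtain ⟨r, hr, hr1, hKr⟩ := exists_ball_of_isCompact hK hK1
    exact (energy_mono_set hKr).trans_lt (hfinb r hr hr1)
  refine ⟨G₀, hG₀, hu0, fun K hK hK1 => ⟨hfin K hK hK1, fun v H hv hv0 hvu => ?_⟩⟩
  obtain ⟨r, hr, hr1, hKr⟩ := exists_ball_of_isCompact hK hK1
  -- The comparison holds on a ball containing `K`; off `K` the two energies coincide and are
  -- finite, so they cancel.
  have h := energy_ball_le hn hγ hγ2 hmin hconv hG₀ hfin hK hr hr1 hKr hv hv0 hvu
  have hsub : Metric.ball 0 r \ K ⊆ Metric.ball 0 1 \ K :=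
    sdiff_subset_sdiff_left (Metric.ball_subset_ball hr1.le)
  rw [← energy_add_sdiff hK.measurableSet hKr, ← energy_add_sdiff hK.measurableSet hKr,
    hv.energy_congr hG₀ (Metric.isOpen_ball.sdiff hK.isClosed) (hsub.trans sdiff_subset)
      (ae_restrict_of_ae_restrict_of_subset hsub hvu)] at h
  exact (ENNReal.add_le_add_iff_right
    ((energy_mono_set sdiff_subset).trans_lt (hfinb r hr hr1)).ne).1 h

end LimitMinimality

/-! ### Minimality for the own boundary data -/

section DirichletMinimality

variable {n : ℕ} {γ : ℝ} {u v η : EuclideanSpace ℝ (Fin n) → ℝ}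
  {G H D : EuclideanSpace ℝ (Fin n) → EuclideanSpace ℝ (Fin n)}

theorem setLIntegral_ofReal_le {A : Set (EuclideanSpace ℝ (Fin n))}
    {f p d i : EuclideanSpace ℝ (Fin n) → ℝ}
    (hf : ∀ᵐ x ∂(volume.restrict A), f x ≤ p x + 4 * d x + 2 * i x)
    (hp : AEMeasurable p (volume.restrict A)) (hd : AEMeasurable d (volume.restrict A)) :
    ∫⁻ x in A, ENNReal.ofReal (f x) ≤ (∫⁻ x in A, ENNReal.ofReal (p x)) +
      4 * (∫⁻ x in A, ENNReal.ofReal (d x)) + 2 * ∫⁻ x in A, ENNReal.ofReal (i x) := by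
  have hpd : AEMeasurable (fun x => ENNReal.ofReal (p x) + 4 * ENNReal.ofReal (d x))
      (volume.restrict A) := hp.ennreal_ofReal.add (hd.ennreal_ofReal.const_mul _)
  rw [← lintegral_const_mul' _ _ (by simp), ← lintegral_const_mul' _ _ (by simp),
    ← lintegral_add_left' hp.ennreal_ofReal, ← lintegral_add_left' hpd]
  refine lintegral_mono_ae ?_
  filter_upwards [hf] with x hx
  refine (ENNReal.ofReal_le_ofReal hx).trans (ENNReal.ofReal_add_le.trans ?_)
  gcongr
  · refine ENNReal.ofReal_add_le.trans ?_
    rw [ENNReal.ofReal_mul (by norm_num), ENNReal.ofReal_ofNat]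
  · rw [ENNReal.ofReal_mul (by norm_num), ENNReal.ofReal_ofNat]

theorem energy_unitBall_le {C : ℝ≥0∞}
    (h : ∀ m, energy γ (Metric.ball 0 (exhaustion m)) u G ≤ C) :
    energy γ (Metric.ball 0 1) u G ≤ C := by
  have hU : Metric.ball (0 : EuclideanSpace ℝ (Fin n)) 1 =
      ⋃ m, Metric.ball 0 (exhaustion m) := by
    ext x
    simp only [mem_ball_zero_iff, mem_iUnion]
    exact ⟨fun hx => exists_lt_exhaustion hx, fun ⟨m, hm⟩ => hm.trans (exhaustion_lt_one m)⟩
  rw [energy, hU, setLIntegral_iUnion_of_directed _ (Monotone.directed_le fun a b hab =>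
    Metric.ball_subset_ball (exhaustion_mono hab))]
  exact iSup_le h

/-- The gluing uses `a = |η|` plus the inner barrier and `b = |v - u - η|` plus the outer one. The
barriers alone control the potentials, so `η` need not be small in the supremum norm; only its
gradient counts. The bound contains `1 - r` in place of `ρ - r` so as not to depend on `ρ`. -/
theorem IsMinimizerWith.energy_ball_le_of_cutoff (hn : 1 ≤ n) (hγ : 0 < γ) (hγ2 : γ < 2)
    (hu : IsMinimizerWith γ (Metric.ball 0 1) u G) (hv : IsH1Loc (Metric.ball 0 1) v H)
    (hv0 : ∀ᵐ x ∂(volume.restrict (Metric.ball 0 1)), 0 ≤ v x)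
    (hη : IsH1Loc (Metric.ball 0 1) η D) {r ρ : ℝ} (hr : 1 / 2 ≤ r) (hrρ : r < ρ) (hρ : ρ < 1)
    (hηr : ∀ x, ‖x‖ < r → η x = 0) (hηρ : ∀ x, ρ < ‖x‖ → η x = v x - u x) :
    energy γ (Metric.ball 0 r) u G ≤ energy γ (Metric.ball 0 1) v H +
      2 * ((∫⁻ x in Metric.ball 0 1 \ Metric.ball 0 r,
        ENNReal.ofReal (9 * (‖G x‖ ^ 2 + ‖H x‖ ^ 2))) +
      4 * (∫⁻ x in Metric.ball 0 1, ENNReal.ofReal (‖D x‖ ^ 2)) +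
      2 * (barrierConst n γ * ENNReal.ofReal ((1 - r) ^ (1 - barrierDecay γ)))) := by
  have hΩ : IsOpen (Metric.ball (0 : EuclideanSpace ℝ (Fin n)) 1) := Metric.isOpen_ball
  have hψ := isH1Loc_innerBarrier hn hγ hγ2 hr (by linarith : r ≤ 1)
  have hψ' := isH1Loc_outerBarrier hn hγ hγ2 (by linarith : 1 / 2 ≤ ρ) hρ.le
  have hKc : IsCompact (Metric.closedBall (0 : EuclideanSpace ℝ (Fin n)) ρ) :=
    isCompact_closedBall _ _
  have hKΩ := closedBall_subset_unitBall (n := n) hρ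
  have hmu := hu.2.2 _ hKc hKΩ
  set A := Metric.ball (0 : EuclideanSpace ℝ (Fin n)) ρ \ Metric.ball 0 r with hA
  have hAΩ : A ⊆ Metric.ball 0 1 := sdiff_subset.trans (Metric.ball_subset_ball hρ.le)
  have hAmeas : MeasurableSet A := measurableSet_ball.diff measurableSet_ball
  have hres := restrict_closedBall_sdiff (n := n) (show ρ ≠ 0 by linarith) (Metric.ball 0 r)
  have ha := (hη.abs hΩ).add hψ
  have hb := (((hv.sub hu.1).sub hη).abs hΩ).add hψ'
  have hglue := energy_le_of_glue (γ := γ) hΩ (Metric.isOpen_ball (x := 0) (ε := r))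
    (Metric.ball_subset_closedBall.trans (Metric.closedBall_subset_closedBall hrρ.le)) hKΩ
    hu.1 hv ha hb hu.2.1 hv0 ?_ ?_ ?_ ?_ ?_ ?_
    (q := fun x => potential γ (outerBarrier γ ρ x)) ?_ hmu.1 hmu.2
  rotate_left
  · exact Eventually.of_forall fun x => add_nonneg (abs_nonneg _) (innerBarrier_nonneg γ r x)
  · exact Eventually.of_forall fun x => add_nonneg (abs_nonneg _) (outerBarrier_nonneg γ ρ x)
  · filter_upwards [ae_restrict_mem measurableSet_ball] with x hx
    have hx' : ‖x‖ < r := by simpa using hx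
    simp [hηr x hx', innerBarrier_eq_zero hγ hx'.le]
  · filter_upwards [ae_restrict_mem measurableSet_ball] with x hx
    have hx' : ‖x‖ < r := by simpa using hx
    rw [hηr x hx', sub_zero]
    linarith [le_abs_self (v x - u x), outerBarrier_nonneg γ ρ x]
  · filter_upwards [ae_restrict_mem (measurableSet_ball.diff measurableSet_closedBall)] with x hx
    have hxρ : ρ < ‖x‖ := by simpa using hx.2
    rw [hηρ x hxρ, sub_self, abs_zero, zero_add, outerBarrier_eq_zero hγ (by linarith) hxρ.le]
  · filter_upwards [ae_restrict_mem (measurableSet_ball.diff measurableSet_closedBall)] with x hx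
    have hxρ : ρ < ‖x‖ := by simpa using hx.2
    rw [hηρ x hxρ]
    linarith [neg_abs_le (v x - u x), innerBarrier_nonneg γ r x]
  · rw [hres]
    filter_upwards [ae_restrict_mem hAmeas, ae_restrict_of_ae_restrict_of_subset hAΩ hu.2.1]
      with x hx h0
    have hxρ : ‖x‖ < ρ := by simpa using hx.1
    have h1 : 0 < outerBarrier γ ρ x :=
      (posPow_pos (by nlinarith [norm_nonneg x])).trans_le (le_outerBarrier hγ le_rfl)
    refine (potential_anti hγ h1 ?_).trans (le_add_of_nonneg_left (potential_nonneg hγ _))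
    linarith [abs_nonneg (v x - u x - η x)]
  have hp : AEMeasurable (fun x => 9 * (‖G x‖ ^ 2 + ‖H x‖ ^ 2)) (volume.restrict A) :=
    (((hu.1.aestronglyMeasurable_grad.norm.aemeasurable.pow_const 2).add
      (hv.aestronglyMeasurable_grad.norm.aemeasurable.pow_const 2)).const_mul 9).mono_measure
      (Measure.restrict_mono hAΩ le_rfl)
  have hd : AEMeasurable (fun x => ‖D x‖ ^ 2) (volume.restrict A) :=
    (hη.aestronglyMeasurable_grad.norm.aemeasurable.pow_const 2).mono_measure
      (Measure.restrict_mono hAΩ le_rfl)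
  have hsph : ∀ᵐ x ∂(volume.restrict A), r < ‖x‖ := by
    have hs : ∀ᵐ x ∂(volume : Measure (EuclideanSpace ℝ (Fin n))), x ∉ Metric.sphere 0 r :=
      measure_eq_zero_iff_ae_notMem.1
        (Measure.addHaar_sphere_of_ne_zero volume _ (show r ≠ 0 by linarith))
    filter_upwards [ae_restrict_mem hAmeas, ae_restrict_of_ae hs] with x hx hx2
    rw [mem_sphere_zero_iff_norm] at hx2
    have hx' : r ≤ ‖x‖ := by simpa using hx.2
    exact lt_of_le_of_ne hx' (Ne.symm hx2)
  have hpow : (ρ - r) ^ (1 - barrierDecay γ) ≤ (1 - r) ^ (1 - barrierDecay γ) :=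
    Real.rpow_le_rpow (by linarith) (by linarith) (by linarith [barrierDecay_lt_one hγ hγ2])
  have hsub : A ⊆ Metric.ball 0 1 \ Metric.ball 0 r :=
    sdiff_subset_sdiff_left (Metric.ball_subset_ball hρ.le)
  rw [← add_assoc, energy_add_sdiff measurableSet_ball
    (Metric.ball_subset_closedBall.trans (Metric.closedBall_subset_closedBall hrρ.le))] at hglue
  refine hglue.trans (add_le_add (energy_mono_set hKΩ) ?_)
  rw [two_mul, energy, hres]
  refine add_le_add ?_ ?_
  · refine (setLIntegral_ofReal_le (p := fun x => 9 * (‖G x‖ ^ 2 + ‖H x‖ ^ 2))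
      (d := fun x => ‖D x‖ ^ 2)
      (i := fun x => ‖innerBarrierGrad γ r x‖ ^ 2 + potential γ (innerBarrier γ r x))
      ?_ hp hd).trans ?_
    · filter_upwards [ae_restrict_of_ae_restrict_of_subset hAΩ hv0, hsph] with x h0 hx
      have h1 : 0 < innerBarrier γ r x :=
        (posPow_pos (by nlinarith [norm_nonneg x])).trans_le
          (le_innerBarrier hγ (norm_nonneg x) le_rfl)
      have h2 := potential_anti hγ h1
        (show innerBarrier γ r x ≤ v x + (|η x| + innerBarrier γ r x) by
          linarith [abs_nonneg (η x)])
      have h3 : ‖if η x < -η x then -D x else D x‖ = ‖D x‖ := by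
        split_ifs <;> simp
      have h4 := norm_add_sq_le (H x)
        ((if η x < -η x then -D x else D x) + innerBarrierGrad γ r x)
      have h5 := norm_add_sq_le (if η x < -η x then -D x else D x) (innerBarrierGrad γ r x)
      rw [h3] at h5
      have h6 := potential_nonneg hγ (innerBarrier γ r x)
      nlinarith [sq_nonneg ‖G x‖, sq_nonneg ‖H x‖, sq_nonneg ‖D x‖]
    · refine add_le_add (add_le_add (lintegral_mono_set hsub) ?_) ?_
      · exact mul_le_mul_right (lintegral_mono_set hAΩ) _
      refine mul_le_mul_right ((lintegral_innerBarrier_le hn hγ hγ2 hr hrρ.le hρ.le).trans ?_) _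
      exact mul_le_mul_right (ENNReal.ofReal_le_ofReal hpow) _
  · refine (setLIntegral_ofReal_le (p := fun x => 9 * (‖G x‖ ^ 2 + ‖H x‖ ^ 2))
      (d := fun x => ‖D x‖ ^ 2)
      (i := fun x => ‖outerBarrierGrad γ ρ x‖ ^ 2 + potential γ (outerBarrier γ ρ x))
      ?_ hp hd).trans ?_
    · refine Eventually.of_forall fun x => ?_
      have h3 : ‖if v x - u x - η x < -(v x - u x - η x) then -(H x - G x - D x)
          else H x - G x - D x‖ = ‖H x - G x - D x‖ := by
        split_ifs
        · rw [norm_neg]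
        · rfl
      have h4 := norm_add_sq_le (if v x - u x - η x < -(v x - u x - η x) then -(H x - G x - D x)
          else H x - G x - D x) (outerBarrierGrad γ ρ x)
      rw [h3] at h4
      have h5 := norm_add_sq_le (H x - G x) (-D x)
      have h6 := norm_add_sq_le (H x) (-G x)
      rw [norm_neg, ← sub_eq_add_neg] at h5 h6
      have h7 := potential_nonneg hγ (outerBarrier γ ρ x)
      -- The integrand is at most `|G|²/2 + |Db|²` plus the potential, and `|Db|² ≤ 8 (|G|² + |H|²)
      -- + 4 |D|²` plus twice the squared barrier gradient; `9` absorbs `8 + 1/2`.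
      have h8 := sq_nonneg (‖G x‖ - ‖(if v x - u x - η x < -(v x - u x - η x)
        then -(H x - G x - D x) else H x - G x - D x) + outerBarrierGrad γ ρ x‖)
      nlinarith [sq_nonneg ‖G x‖, sq_nonneg ‖H x‖, sq_nonneg ‖D x‖]
    · refine add_le_add (add_le_add (lintegral_mono_set hsub) ?_) ?_
      · exact mul_le_mul_right (lintegral_mono_set hAΩ) _
      refine mul_le_mul_right ((lintegral_outerBarrier_le hn hγ hγ2 (by linarith) hrρ.le (by linarith) hρ.le).trans ?_) _
      exact mul_le_mul_right (ENNReal.ofReal_le_ofReal hpow) _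

/-- With `η = θ (v - u - φ j)` and `φ j` the approximating test functions, `η = v - u` near the unit
sphere and its gradient tends to `0` in `L²` for fixed `θ`. The radius beyond which `φ j` vanishes
depends on `j`, but the bound does not. -/
theorem IsMinimizerWith.energy_ball_le_of_isH1Zero (hn : 1 ≤ n) (hγ : 0 < γ) (hγ2 : γ < 2)
    (hu : IsMinimizerWith γ (Metric.ball 0 1) u G) (hv : IsH1Loc (Metric.ball 0 1) v H)
    (hv0 : ∀ᵐ x ∂(volume.restrict (Metric.ball 0 1)), 0 ≤ v x)
    (hvu : IsH1Zero (Metric.ball 0 1) (fun x => v x - u x)) {r : ℝ} (hr : 1 / 2 ≤ r)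
    (hr1 : r < 1) :
    energy γ (Metric.ball 0 r) u G ≤ energy γ (Metric.ball 0 1) v H +
      2 * ((∫⁻ x in Metric.ball 0 1 \ Metric.ball 0 r,
        ENNReal.ofReal (9 * (‖G x‖ ^ 2 + ‖H x‖ ^ 2))) +
      2 * (barrierConst n γ * ENNReal.ofReal ((1 - r) ^ (1 - barrierDecay γ)))) := by
  have hΩ : IsOpen (Metric.ball (0 : EuclideanSpace ℝ (Fin n)) 1) := Metric.isOpen_ball
  obtain ⟨F, hF, φ, hφ, hφ0, hφ1⟩ := hvu
  obtain ⟨ρ₁, hrρ₁, hρ₁1⟩ := exists_between hr1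
  obtain ⟨θ, hθ, hθ0, hθ1, hθr, hθρ, -, L, hL⟩ :=
    exists_radial_cutoff n (show 0 < r by linarith) hrρ₁
  have hFG : (fun x => H x - G x) =ᵐ[volume.restrict (Metric.ball 0 1)] F :=
    (hv.1.sub hu.1.1).ae_eq_of_ae_eq hΩ hF.1 EventuallyEq.rfl
  have hφH : ∀ j, IsH1Loc (Metric.ball 0 1) (φ j) (gradient (φ j)) := fun j =>
    IsH1Loc.of_contDiff hΩ ((hφ j).smooth.of_le (by simp))
  have hη := fun j => ((hv.sub hu.1).sub (hφH j)).smooth_mul hΩ hθ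
  have hD : ∀ j, ∫⁻ x in Metric.ball 0 1, ENNReal.ofReal
      (‖θ x • (H x - G x - gradient (φ j) x) + (v x - u x - φ j x) • gradient θ x‖ ^ 2) ≤
      2 * eLpNorm (fun x => gradient (φ j) x - F x) 2 (volume.restrict (Metric.ball 0 1)) ^ 2 +
      ENNReal.ofReal (2 * L ^ 2) *
        eLpNorm (fun x => φ j x - (v x - u x)) 2 (volume.restrict (Metric.ball 0 1)) ^ 2 := by
    intro j
    have hm : AEMeasurable (fun x => 2 * ‖gradient (φ j) x - F x‖ₑ ^ 2)
        (volume.restrict (Metric.ball 0 1)) :=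
      ((((hφH j).aestronglyMeasurable_grad.sub
        hF.isH1Loc.aestronglyMeasurable_grad).enorm.pow_const 2).const_mul _)
    rw [eLpNorm_two_sq, eLpNorm_two_sq, ← lintegral_const_mul' _ _ (by simp),
      ← lintegral_const_mul' _ _ ENNReal.ofReal_ne_top, ← lintegral_add_left' hm]
    refine lintegral_mono_ae ?_
    filter_upwards [hFG] with x hx
    have h1 : ∀ {E : Type} [NormedAddCommGroup E] (y : E), ‖y‖ₑ ^ 2 = ENNReal.ofReal (‖y‖ ^ 2) :=
      fun y => by rw [ENNReal.ofReal_pow (norm_nonneg _), ofReal_norm]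
    have h22 : ∀ t : ℝ, 2 * ENNReal.ofReal t = ENNReal.ofReal (2 * t) := fun t => by
      rw [ENNReal.ofReal_mul zero_le_two, ENNReal.ofReal_ofNat]
    rw [hx, h1, h1, h22, ← ENNReal.ofReal_mul (by positivity),
      ← ENNReal.ofReal_add (by positivity) (by positivity)]
    refine ENNReal.ofReal_le_ofReal ((norm_add_sq_le _ _).trans ?_)
    rw [norm_smul, norm_smul, norm_sub_rev (F x), ← norm_sub_rev (φ j x), mul_pow, mul_pow,
      mul_assoc 2 (L ^ 2), mul_comm (L ^ 2)]
    have h2 : ‖θ x‖ ^ 2 ≤ 1 := by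
      rw [Real.norm_of_nonneg (hθ0 x)]
      exact pow_le_one₀ (hθ0 x) (hθ1 x)
    have h3 : ‖gradient θ x‖ ^ 2 ≤ L ^ 2 := by
      have := hL x
      gcongr
    gcongr
    exact mul_le_of_le_one_left (sq_nonneg _) h2
  have hD0 : Tendsto (fun j => ∫⁻ x in Metric.ball 0 1, ENNReal.ofReal
      (‖θ x • (H x - G x - gradient (φ j) x) + (v x - u x - φ j x) • gradient θ x‖ ^ 2))
      atTop (𝓝 0) := by
    refine tendsto_of_tendsto_of_tendsto_of_le_of_le tendsto_const_nhds ?_ (fun j => zero_le)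
      hD
    have h1 := ENNReal.Tendsto.const_mul (a := 2) (ENNReal.Tendsto.pow hφ1 (n := 2)) (Or.inr (by simp))
    have h2 := ENNReal.Tendsto.const_mul (a := ENNReal.ofReal (2 * L ^ 2)) (ENNReal.Tendsto.pow hφ0 (n := 2))
      (Or.inr ENNReal.ofReal_ne_top)
    simpa using h1.add h2
  have hlim := ((ENNReal.Tendsto.const_mul (a := 2) (((ENNReal.Tendsto.const_mul (a := 4) hD0
    (Or.inr (by simp))).const_add (∫⁻ x in Metric.ball 0 1 \ Metric.ball 0 r,
        ENNReal.ofReal (9 * (‖G x‖ ^ 2 + ‖H x‖ ^ 2)))).add_const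
        (2 * (barrierConst n γ * ENNReal.ofReal ((1 - r) ^ (1 - barrierDecay γ)))))
        (Or.inr (by simp))).const_add (energy γ (Metric.ball 0 1) v H))
  rw [mul_zero, add_zero] at hlim
  refine ge_of_tendsto hlim (Eventually.of_forall fun j => ?_)
  obtain ⟨ρ₂, -, hρ₂1, hφρ⟩ := exists_ball_of_isCompact (hφ j).compact (hφ j).support_subset
  refine hu.energy_ball_le_of_cutoff hn hγ hγ2 hv hv0 (hη j) hr
    (lt_max_of_lt_left hrρ₁ : r < max ρ₁ ρ₂) (max_lt hρ₁1 hρ₂1) (fun x hx => ?_) fun x hx => ?_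
  · rw [hθr x hx.le, zero_mul]
  · have h1 : φ j x = 0 := image_eq_zero_of_notMem_tsupport fun h => by
      have := hφρ h
      rw [mem_ball_zero_iff] at this
      exact (((le_max_right _ _).trans_lt hx).trans this).false
    rw [hθρ x ((le_max_left _ _).trans hx.le), h1, sub_zero, one_mul]

theorem lintegral_norm_sq_lt_top {S : Set (EuclideanSpace ℝ (Fin n))}
    (hG : MemLp G 2 (volume.restrict S)) :
    ∫⁻ x in S, ENNReal.ofReal (‖G x‖ ^ 2) < ⊤ := by
  have h := ENNReal.pow_lt_top hG.2 (n := 2)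
  rw [eLpNorm_two_sq] at h
  refine (lintegral_congr fun x => ?_).trans_lt h
  rw [ENNReal.ofReal_pow (norm_nonneg _), ofReal_norm]

theorem tendsto_exhaustion : Tendsto exhaustion atTop (𝓝 1) := by
  have h := (tendsto_const_div_atTop_nhds_zero_nat (1 : ℝ)).comp (tendsto_add_atTop_nat 2)
  have h2 := h.const_sub 1
  rw [sub_zero] at h2
  refine h2.congr fun m => ?_
  simp [exhaustion]

theorem tendsto_volume_sdiff_exhaustion :
    Tendsto (fun m => volume (Metric.ball (0 : EuclideanSpace ℝ (Fin n)) 1 \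
      Metric.ball 0 (exhaustion m))) atTop (𝓝 0) := by
  have h := tendsto_measure_iInter_atTop (μ := volume)
    (s := fun m => Metric.ball (0 : EuclideanSpace ℝ (Fin n)) 1 \ Metric.ball 0 (exhaustion m))
    (fun m => (measurableSet_ball.diff measurableSet_ball).nullMeasurableSet)
    (fun a b hab => sdiff_subset_sdiff_right (Metric.ball_subset_ball (exhaustion_mono hab)))
    ⟨0, ((measure_mono sdiff_subset).trans_lt measure_ball_lt_top).ne⟩
  have h0 : ⋂ m, Metric.ball (0 : EuclideanSpace ℝ (Fin n)) 1 \ Metric.ball 0 (exhaustion m)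
      = ∅ := by
    refine eq_empty_of_forall_notMem fun x hx => ?_
    simp only [mem_iInter, Set.mem_sdiff, mem_ball_zero_iff, not_lt] at hx
    obtain ⟨m, hm⟩ := exists_lt_exhaustion (hx 0).1
    exact ((hx m).2.trans_lt hm).false
  rw [h0, measure_empty] at h
  exact h

/-- Comparison with `u` plus the outer barrier of radius `ρ`: the potential becomes at most that of
the barrier, and the resulting bound is uniform as `ρ → 1`. -/
theorem IsMinimizerWith.energy_unitBall_lt_top (hn : 1 ≤ n) (hγ : 0 < γ) (hγ2 : γ < 2)
    (hu : IsMinimizerWith γ (Metric.ball 0 1) u G) (hG : IsH1 (Metric.ball 0 1) u G) :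
    energy γ (Metric.ball 0 1) u G < ⊤ := by
  have hΩ : IsOpen (Metric.ball (0 : EuclideanSpace ℝ (Fin n)) 1) := Metric.isOpen_ball
  refine lt_of_le_of_lt (energy_unitBall_le (C := (∫⁻ x in Metric.ball 0 1,
    ENNReal.ofReal (‖G x‖ ^ 2)) + barrierConst n γ) fun m => ?_)
    (ENNReal.add_lt_top.2 ⟨lintegral_norm_sq_lt_top hG.3, (barrierConst_ne_top n γ).lt_top⟩)
  set ρ := exhaustion m
  have hρ1 : ρ < 1 := exhaustion_lt_one m
  have hρ : 1 / 2 ≤ ρ := half_le_exhaustion m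
  have hψ := isH1Loc_outerBarrier hn hγ hγ2 hρ hρ1.le
  have hKΩ := closedBall_subset_unitBall (n := n) hρ1
  have hBΩ := Metric.ball_subset_ball (x := (0 : EuclideanSpace ℝ (Fin n))) hρ1.le
  refine (energy_mono_set Metric.ball_subset_closedBall).trans
    (((hu.2.2 _ (isCompact_closedBall _ _) hKΩ).2 _ _ (hu.1.add hψ) ?_ ?_).trans ?_)
  · filter_upwards [hu.2.1] with x hx using add_nonneg hx (outerBarrier_nonneg γ ρ x)
  · filter_upwards [ae_restrict_mem (measurableSet_ball.diff measurableSet_closedBall)] with x hx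
    have hxρ : ρ < ‖x‖ := by simpa using hx.2
    rw [outerBarrier_eq_zero hγ (by linarith) hxρ.le, add_zero]
  rw [energy, Measure.restrict_congr_set (closedBall_ae_eq_ball (by linarith : ρ ≠ 0))]
  calc _ ≤ ∫⁻ x in Metric.ball 0 ρ, (ENNReal.ofReal (‖G x‖ ^ 2) + ENNReal.ofReal
        (‖outerBarrierGrad γ ρ x‖ ^ 2 + potential γ (outerBarrier γ ρ x))) := by
        refine lintegral_mono_ae ?_
        filter_upwards [ae_restrict_mem measurableSet_ball,
          ae_restrict_of_ae_restrict_of_subset hBΩ hu.2.1] with x hx h0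
        have hxρ : ‖x‖ < ρ := by simpa using hx
        rw [← ENNReal.ofReal_add (by positivity)
          (add_nonneg (by positivity) (potential_nonneg hγ _))]
        refine ENNReal.ofReal_le_ofReal ?_
        have h1 : 0 < outerBarrier γ ρ x :=
          (posPow_pos (by nlinarith [norm_nonneg x])).trans_le (le_outerBarrier hγ le_rfl)
        have h2 := potential_anti hγ h1
          (show outerBarrier γ ρ x ≤ u x + outerBarrier γ ρ x by linarith)
        have h3 := norm_add_sq_le (G x) (outerBarrierGrad γ ρ x)
        linarith
    _ ≤ _ := by
        rw [lintegral_add_left' ((hu.1.aestronglyMeasurable_grad.norm.aemeasurable.pow_const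
          2).ennreal_ofReal.mono_measure (Measure.restrict_mono hBΩ le_rfl))]
        refine add_le_add (lintegral_mono_set hBΩ) ?_
        have h := lintegral_outerBarrier_le (n := n) hn hγ hγ2 le_rfl
          (by linarith : (0 : ℝ) ≤ ρ) hρ hρ1.le
        rw [Metric.ball_zero, sdiff_empty, sub_zero] at h
        refine h.trans (mul_le_of_le_one_right zero_le (ENNReal.ofReal_le_one.2 ?_))
        exact Real.rpow_le_one (by linarith) hρ1.le (by linarith [barrierDecay_lt_one hγ hγ2])

/-- As `r → 1`, the error near the sphere vanishes by absolute continuity of the integral of `|∇u|²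
+ |∇v|²` and by the barrier bound. -/
theorem IsMinimizerWith.isDirichletMinimizer (hn : 1 ≤ n) (hγ : 0 < γ) (hγ2 : γ < 2)
    (hu : IsMinimizerWith γ (Metric.ball 0 1) u G) (hG : IsH1 (Metric.ball 0 1) u G) :
    IsDirichletMinimizer γ (Metric.ball 0 1) u := by
  refine ⟨G, hG, hu.2.1, hu.energy_unitBall_lt_top hn hγ hγ2 hG, fun v H hv hv0 hvu =>
    energy_unitBall_le fun m => ?_⟩
  have t1 : Tendsto (fun k => ∫⁻ x in Metric.ball 0 1 \ Metric.ball 0 (exhaustion k),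
      ENNReal.ofReal (9 * (‖G x‖ ^ 2 + ‖H x‖ ^ 2))) atTop (𝓝 0) := by
    have hfin : ∫⁻ x in Metric.ball 0 1, ENNReal.ofReal (9 * (‖G x‖ ^ 2 + ‖H x‖ ^ 2)) ≠ ⊤ := by
      refine ne_top_of_le_ne_top (ENNReal.mul_ne_top ENNReal.ofReal_ne_top (ENNReal.add_ne_top.2
        ⟨(lintegral_norm_sq_lt_top hG.3).ne, (lintegral_norm_sq_lt_top hv.3).ne⟩))
        (b := ENNReal.ofReal 9 * _) ?_
      rw [← lintegral_add_left' (hG.3.1.norm.aemeasurable.pow_const 2).ennreal_ofReal,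
        ← lintegral_const_mul' _ _ ENNReal.ofReal_ne_top]
      refine lintegral_mono fun x => ?_
      simp only
      rw [← ENNReal.ofReal_add (by positivity) (by positivity),
        ← ENNReal.ofReal_mul (by norm_num)]
    rw [← lintegral_indicator measurableSet_ball] at hfin
    refine (tendsto_setLIntegral_zero hfin (tendsto_volume_sdiff_exhaustion (n := n))).congr
      fun k => ?_
    refine setLIntegral_congr_fun (measurableSet_ball.diff measurableSet_ball) fun x hx => ?_
    exact indicator_of_mem hx.1 _
  have t2 : Tendsto (fun k => barrierConst n γ *
      ENNReal.ofReal ((1 - exhaustion k) ^ (1 - barrierDecay γ))) atTop (𝓝 0) := by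
    have hβ := barrierDecay_lt_one hγ hγ2
    have h1 := (tendsto_exhaustion.const_sub 1).rpow_const
      (p := 1 - barrierDecay γ) (Or.inr (by linarith))
    rw [sub_self, Real.zero_rpow (by linarith)] at h1
    have h2 := (ENNReal.continuous_ofReal.tendsto 0).comp h1
    rw [ENNReal.ofReal_zero] at h2
    have h3 := ENNReal.Tendsto.const_mul h2 (Or.inr (barrierConst_ne_top n γ))
    rw [mul_zero] at h3
    exact h3
  have t3 := (ENNReal.Tendsto.const_mul (a := 2) (t1.add (ENNReal.Tendsto.const_mul (a := 2) t2
    (Or.inr (by simp)))) (Or.inr (by simp))).const_add (energy γ (Metric.ball 0 1) v H)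
  rw [mul_zero, add_zero, mul_zero, add_zero] at t3
  refine ge_of_tendsto t3 (eventually_atTop.2 ⟨m, fun k hk => ?_⟩)
  exact (energy_mono_set (Metric.ball_subset_ball (exhaustion_mono hk))).trans
    (hu.energy_ball_le_of_isH1Zero hn hγ hγ2 hv.isH1Loc hv0 hvu (half_le_exhaustion k)
      (exhaustion_lt_one k))

end DirichletMinimality

end AltPhillips

end

theorem mainTheorem10 (n : ℕ) (hn : 1 ≤ n) (γ : ℝ) (hγ0 : 0 < γ) (hγ2 : γ < 2)
    (u : ℕ → EuclideanSpace ℝ (Fin n) → ℝ) (u₀ : EuclideanSpace ℝ (Fin n) → ℝ)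
    (hmin : ∀ k, AltPhillips.IsMinimizer γ (Metric.ball 0 1) (u k) ∨
      AltPhillips.IsDirichletMinimizer γ (Metric.ball 0 1) (u k))
    (hconv : TendstoLocallyUniformlyOn u u₀ atTop (Metric.ball 0 1)) :
    AltPhillips.IsMinimizer γ (Metric.ball 0 1) u₀ ∧
      ((∃ G : EuclideanSpace ℝ (Fin n) → EuclideanSpace ℝ (Fin n),
          AltPhillips.IsH1 (Metric.ball 0 1) u₀ G) →
        AltPhillips.IsDirichletMinimizer γ (Metric.ball 0 1) u₀) := by
  have hM : ∀ k, AltPhillips.IsMinimizer γ (Metric.ball 0 1) (u k) := fun k =>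
    (hmin k).elim id fun h => h.isMinimizer Metric.isOpen_ball
  choose G hG using hM
  obtain ⟨G₀, hG₀⟩ := AltPhillips.exists_isMinimizerWith_limit hn hγ0 hγ2 hG hconv
  refine ⟨⟨G₀, hG₀⟩, fun ⟨D, hD⟩ => hG₀.isDirichletMinimizer hn hγ0 hγ2 ⟨hG₀.1.1, hD.2, ?_⟩⟩
  -- The gradient supplied with `u₀ ∈ H¹` agrees almost everywhere with `G₀`, which is therefore
  -- square integrable on the ball.
  exact hD.3.ae_eq (hD.1.ae_eq_of_ae_eq Metric.isOpen_ball hG₀.1.1 EventuallyEq.rfl)
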